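/- Let $\alpha\ge 1$ be real. For an integer $n\ge 2$ let $\mu$ be the probability measure on $\mathbb{R}^n$ (with Euclidean norm $\Vert\cdot\Vert$) whose Lebesgue density is proportional to $e^{-\Vert x\Vert^{\alpha}/\alpha}$, and let $\mathcal L_\mu$ be the diffusion operator $$\mathcal L_\mu f(x)=\Delta f(x)-\Vert x\Vert^{\alpha-2}\,x\cdot\nabla f(x),$$ defined on $\mathcal C_0^\infty(\mathbb{R}^n)$ and extended to a self-adjoint operator in $L^2(\mu)$, still denoted $\mathcal L_\mu$: the one associated with the closure of the Dirichlet form $f\mapsto\int\Vert\nabla f\Vert^2\,d\mu$, $f\in\mathcal C_0^\infty(\mathbb{R}^n)$. Let $\lambda_1(-\mathcal L_\mu)$ be its spectral gap, that is, the largest real $\lambda$ such that the spectrum of $-\mathcal L_\mu$ is contained in $\{0\}\cup[\lambda,+\infty)$. Then for every $n\ge 2$ this largest real exists, and $$\frac{(n-1)\,\Gamma\left(\frac n\alpha\right)}{\alpha^{2/\alpha}\,\Gamma\left(\frac{n+2}\alpha\right)}\;\le\;\lambda_1(-\mathcal L_\mu)\;\le\;\frac{n\,\Gamma\left(\frac n\alpha\right)}{\alpha^{2/\alpha}\,\Gamma\left(\frac{n+2}\alpha\right)},$$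 and moreover $$\frac{n-1}{n+1}\,n^{1-2/\alpha}\;\le\;\lambda_1(-\mathcal L_\mu)\;\le\;\frac{n+2}{n}\,n^{1-2/\alpha}.$$ In particular, for fixed $\alpha$, $\lambda_1(-\mathcal L_\mu)\sim n^{1-2/\alpha}$ as $n\to\infty$, i.e. the ratio of the two sides tends to $1$. -/

import Mathlib

open MeasureTheory Filter Topology
open scoped ContDiff Gradient Laplacian

/-! ### Spectrum and spectral gap of an unbounded operator -/

section Spectrum

variable {H : Type*} [NormedAddCommGroup H] [NormedSpace ℝ H]

/-- The (real) resolvent set of an unbounded operator `A` on `H`: the reals `z` for which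
`A - z : D(A) → H` is bijective with a bounded everywhere defined inverse `R`. -/
def unboundedResolventSet (A : H →ₗ.[ℝ] H) : Set ℝ :=
  {z | ∃ R : H →L[ℝ] H,
    (∀ g : H, ∃ f : A.domain, (f : H) = R g ∧ A f - z • (f : H) = g) ∧
    ∀ f : A.domain, R (A f - z • (f : H)) = f}

/-- The (real) spectrum of an unbounded operator. For a self-adjoint operator on a real Hilbert
space this is the whole spectrum of its complexification. -/
def unboundedSpectrum (A : H →ₗ.[ℝ] H) : Set ℝ := (unboundedResolventSet A)ᶜ

/-- The reals `l` such that the spectrum of `A` lies in `{0} ∪ [l, +∞)`. -/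
def gapSet (A : H →ₗ.[ℝ] H) : Set ℝ := {l | unboundedSpectrum A ⊆ {0} ∪ Set.Ici l}

/-- The spectral gap of `A`: the largest real `l` such that the spectrum of `A` lies in
`{0} ∪ [l, +∞)`. This is meaningful when the largest element exists, that is, when
`IsGreatest (gapSet A) (spectralGap A)`. -/
noncomputable def spectralGap (A : H →ₗ.[ℝ] H) : ℝ := sSup (gapSet A)

end Spectrum

/-! ### Exponential power distributions and their diffusion operators -/

/-- The measure on `ℝⁿ` with Lebesgue density `exp (-(‖x‖ ^ α) / α)`, not normalized. -/
noncomputable def expPowerWeight (n : ℕ) (α : ℝ) : Measure (EuclideanSpace ℝ (Fin n)) :=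
  volume.withDensity fun x => ENNReal.ofReal (Real.exp (-(‖x‖ ^ α) / α))

/-- The exponential power distribution `μ`: the probability measure on `ℝⁿ` with Lebesgue density
proportional to `exp (-(‖x‖ ^ α) / α)`. -/
noncomputable def expPowerMeasure (n : ℕ) (α : ℝ) : Measure (EuclideanSpace ℝ (Fin n)) :=
  (expPowerWeight n α Set.univ)⁻¹ • expPowerWeight n α

/-- The differential expression `L f (x) = Δ f (x) - ‖x‖ ^ (α - 2) x · ∇ f (x)`. -/
noncomputable def expPowerL (n : ℕ) (α : ℝ) (f : EuclideanSpace ℝ (Fin n) → ℝ)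
    (x : EuclideanSpace ℝ (Fin n)) : ℝ :=
  Δ f x - ‖x‖ ^ (α - 2) * inner ℝ x (∇ f x)

section TestFunctions

variable {n : ℕ}

/-- Smooth compactly supported real functions on `ℝⁿ`. -/
def IsTest (φ : EuclideanSpace ℝ (Fin n) → ℝ) : Prop := ContDiff ℝ ∞ φ ∧ HasCompactSupport φ

theorem IsTest.zero : IsTest (0 : EuclideanSpace ℝ (Fin n) → ℝ) :=
  ⟨contDiff_const, HasCompactSupport.zero⟩

theorem IsTest.add {φ ψ : EuclideanSpace ℝ (Fin n) → ℝ} (hφ : IsTest φ) (hψ : IsTest ψ) :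
    IsTest (φ + ψ) := ⟨hφ.1.add hψ.1, hφ.2.add hψ.2⟩

theorem IsTest.smul {φ : EuclideanSpace ℝ (Fin n) → ℝ} (c : ℝ) (hφ : IsTest φ) :
    IsTest (c • φ) := ⟨hφ.1.const_smul c, hφ.2.smul_left (f := fun _ => c)⟩

theorem IsTest.differentiable {φ : EuclideanSpace ℝ (Fin n) → ℝ} (hφ : IsTest φ) :
    Differentiable ℝ φ := hφ.1.differentiable (by simp)

theorem IsTest.contDiffAt_two {φ : EuclideanSpace ℝ (Fin n) → ℝ} (hφ : IsTest φ)
    {x : EuclideanSpace ℝ (Fin n)} : ContDiffAt ℝ 2 φ x :=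
  (contDiff_infty.1 hφ.1 2).contDiffAt

theorem gradient_zero_fun (x : EuclideanSpace ℝ (Fin n)) :
    ∇ (0 : EuclideanSpace ℝ (Fin n) → ℝ) x = 0 := by
  simp [gradient]

theorem IsTest.gradient_add {φ ψ : EuclideanSpace ℝ (Fin n) → ℝ} (hφ : IsTest φ)
    (hψ : IsTest ψ) (x : EuclideanSpace ℝ (Fin n)) : ∇ (φ + ψ) x = ∇ φ x + ∇ ψ x := by
  simp [gradient, fderiv_add (hφ.differentiable x) (hψ.differentiable x)]

theorem IsTest.gradient_smul {φ : EuclideanSpace ℝ (Fin n) → ℝ} (c : ℝ) (hφ : IsTest φ)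
    (x : EuclideanSpace ℝ (Fin n)) : ∇ (c • φ) x = c • ∇ φ x := by
  simp [gradient, fderiv_const_smul (hφ.differentiable x)]

theorem expPowerL_zero (α : ℝ) (x : EuclideanSpace ℝ (Fin n)) : expPowerL n α 0 x = 0 := by
  have h : Δ (0 : EuclideanSpace ℝ (Fin n) → ℝ) x = 0 := by
    have := InnerProductSpace.laplacian_smul (f := (0 : EuclideanSpace ℝ (Fin n) → ℝ)) (x := x)
      (0 : ℝ) contDiffAt_const
    simpa using this
  simp [expPowerL, h, gradient_zero_fun]

theorem IsTest.expPowerL_add (α : ℝ) {φ ψ : EuclideanSpace ℝ (Fin n) → ℝ} (hφ : IsTest φ)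
    (hψ : IsTest ψ) (x : EuclideanSpace ℝ (Fin n)) :
    expPowerL n α (φ + ψ) x = expPowerL n α φ x + expPowerL n α ψ x := by
  have h := ContDiffAt.laplacian_add (x := x) hφ.contDiffAt_two
    hψ.contDiffAt_two
  rw [expPowerL, expPowerL, expPowerL, h, hφ.gradient_add hψ, inner_add_right]
  ring

theorem IsTest.expPowerL_smul (α c : ℝ) {φ : EuclideanSpace ℝ (Fin n) → ℝ} (hφ : IsTest φ)
    (x : EuclideanSpace ℝ (Fin n)) : expPowerL n α (c • φ) x = c * expPowerL n α φ x := by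
  have h := InnerProductSpace.laplacian_smul (x := x) c hφ.contDiffAt_two
  rw [expPowerL, expPowerL, h, hφ.gradient_smul, inner_smul_right, smul_eq_mul]
  ring

end TestFunctions

/-- The graph in `L²(μ) × L²(μ)` of `φ ↦ -L φ` on smooth compactly supported functions. -/
noncomputable def expPowerGraph (n : ℕ) (α : ℝ) :
    Submodule ℝ (Lp ℝ 2 (expPowerMeasure n α) × Lp ℝ 2 (expPowerMeasure n α)) where
  carrier := {p | ∃ φ, IsTest φ ∧ p.1 =ᵐ[expPowerMeasure n α] φ ∧
    p.2 =ᵐ[expPowerMeasure n α] fun x => -expPowerL n α φ x}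
  zero_mem' := by
    refine ⟨0, IsTest.zero, Lp.coeFn_zero _ _ _, ?_⟩
    filter_upwards [Lp.coeFn_zero ℝ 2 (expPowerMeasure n α)] with x hx
    simpa [expPowerL_zero] using hx
  add_mem' := by
    rintro p q ⟨φ, hφ, h1, h2⟩ ⟨ψ, hψ, k1, k2⟩
    refine ⟨φ + ψ, hφ.add hψ, ?_, ?_⟩
    · filter_upwards [Lp.coeFn_add p.1 q.1, h1, k1] with x hx a b
      rw [Prod.fst_add, hx, Pi.add_apply, Pi.add_apply, a, b]
    · filter_upwards [Lp.coeFn_add p.2 q.2, h2, k2] with x hx a b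
      rw [Prod.snd_add, hx, Pi.add_apply, a, b, hφ.expPowerL_add α hψ]
      ring
  smul_mem' := by
    rintro c p ⟨φ, hφ, h1, h2⟩
    refine ⟨c • φ, hφ.smul c, ?_, ?_⟩
    · filter_upwards [Lp.coeFn_smul c p.1, h1] with x hx a
      rw [Prod.smul_fst, hx, Pi.smul_apply, Pi.smul_apply, a]
    · filter_upwards [Lp.coeFn_smul c p.2, h2] with x hx a
      rw [Prod.smul_snd, hx, Pi.smul_apply, a, hφ.expPowerL_smul, smul_eq_mul]
      ring

/-- `-L` is well defined on classes of smooth compactly supported functions. -/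
theorem expPowerGraph_singleValued (n : ℕ) (α : ℝ)
    (p : Lp ℝ 2 (expPowerMeasure n α) × Lp ℝ 2 (expPowerMeasure n α))
    (hp : p ∈ expPowerGraph n α) (h0 : p.1 = 0) : p.2 = 0 := by
  obtain ⟨φ, hφ, h1, h2⟩ := hp
  rw [h0] at h1
  have h3 : φ =ᵐ[expPowerMeasure n α] 0 := h1.symm.trans (Lp.coeFn_zero _ _ _)
  rw [Lp.eq_zero_iff_ae_eq_zero]
  by_cases hc : (expPowerWeight n α Set.univ)⁻¹ = 0
  · have hz : expPowerMeasure n α = 0 := by rw [expPowerMeasure, hc, zero_smul]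
    have : ae (expPowerMeasure n α) = ⊥ := by rw [hz, ae_zero]
    simp [EventuallyEq, this]
  · have h4 : φ =ᵐ[expPowerWeight n α] 0 := by
      rw [EventuallyEq, expPowerMeasure, Measure.ae_ennreal_smul_measure_iff hc] at h3
      exact h3
    have h5 : φ =ᵐ[volume] 0 := by
      have hm : Measurable fun x : EuclideanSpace ℝ (Fin n) =>
          ENNReal.ofReal (Real.exp (-(‖x‖ ^ α) / α)) := by fun_prop
      rw [EventuallyEq, expPowerWeight, ae_withDensity_iff hm] at h4
      filter_upwards [h4] with x hx
      exact hx (by simp [Real.exp_pos])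
    have h6 : φ = 0 := Continuous.ae_eq_iff_eq volume hφ.1.continuous continuous_const |>.1 h5
    subst h6
    filter_upwards [h2] with x hx
    rw [hx]
    simp [expPowerL_zero]

/-- The minimal operator: `-L` as an unbounded operator on `L²(μ)` with domain the smooth
compactly supported functions. -/
noncomputable def expPowerMinimal (n : ℕ) (α : ℝ) :
    Lp ℝ 2 (expPowerMeasure n α) →ₗ.[ℝ] Lp ℝ 2 (expPowerMeasure n α) :=
  (expPowerGraph n α).toLinearPMap

theorem expPowerMinimal_graph (n : ℕ) (α : ℝ) :
    (expPowerMinimal n α).graph = expPowerGraph n α :=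
  Submodule.toLinearPMap_graph_eq _ fun p hp h0 => expPowerGraph_singleValued n α p hp h0

/-- The pairs `(φ, ∇ φ)` in `L²(μ) × L²(μ; ℝⁿ)`, for `φ` smooth and compactly supported. -/
noncomputable def gradientGraph (n : ℕ) (α : ℝ) :
    Submodule ℝ (Lp ℝ 2 (expPowerMeasure n α) ×
      Lp (EuclideanSpace ℝ (Fin n)) 2 (expPowerMeasure n α)) where
  carrier := {p | ∃ φ, IsTest φ ∧ p.1 =ᵐ[expPowerMeasure n α] φ ∧
    p.2 =ᵐ[expPowerMeasure n α] fun x => ∇ φ x}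
  zero_mem' := by
    refine ⟨0, IsTest.zero, Lp.coeFn_zero _ _ _, ?_⟩
    filter_upwards [Lp.coeFn_zero (EuclideanSpace ℝ (Fin n)) 2 (expPowerMeasure n α)] with x hx
    simpa [gradient_zero_fun] using hx
  add_mem' := by
    rintro p q ⟨φ, hφ, h1, h2⟩ ⟨ψ, hψ, k1, k2⟩
    refine ⟨φ + ψ, hφ.add hψ, ?_, ?_⟩
    · filter_upwards [Lp.coeFn_add p.1 q.1, h1, k1] with x hx a b
      rw [Prod.fst_add, hx, Pi.add_apply, Pi.add_apply, a, b]
    · filter_upwards [Lp.coeFn_add p.2 q.2, h2, k2] with x hx a b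
      rw [Prod.snd_add, hx, Pi.add_apply, a, b, hφ.gradient_add hψ]
  smul_mem' := by
    rintro c p ⟨φ, hφ, h1, h2⟩
    refine ⟨c • φ, hφ.smul c, ?_, ?_⟩
    · filter_upwards [Lp.coeFn_smul c p.1, h1] with x hx a
      rw [Prod.smul_fst, hx, Pi.smul_apply, Pi.smul_apply, a]
    · filter_upwards [Lp.coeFn_smul c p.2, h2] with x hx a
      rw [Prod.smul_snd, hx, Pi.smul_apply, a, hφ.gradient_smul]

/-- The domain of the Dirichlet form `E(f, f) = ∫ ‖∇ f‖² dμ`: the completion in `L²(μ)` of the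
smooth compactly supported functions for the norm `(‖f‖² + E(f, f))^(1/2)`. -/
noncomputable def dirichletDomain (n : ℕ) (α : ℝ) : Submodule ℝ (Lp ℝ 2 (expPowerMeasure n α)) :=
  (gradientGraph n α).topologicalClosure.map (LinearMap.fst ℝ _ _)

/-- The self-adjoint operator `-L_μ` on `L²(μ)` extending `-L` from the smooth compactly supported
functions. It is realized as the extension attached to the closed Dirichlet form: the restriction
of the adjoint of the minimal operator to the domain of the form. (The minimal operator
being essentially self-adjoint, this is its only self-adjoint extension.) -/
noncomputable def expPowerOperator (n : ℕ) (α : ℝ) :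
    Lp ℝ 2 (expPowerMeasure n α) →ₗ.[ℝ] Lp ℝ 2 (expPowerMeasure n α) :=
  (expPowerMinimal n α).adjoint.domRestrict (dirichletDomain n α)

/-! Write `m = n - 1`, let `w` be the weight `r ^ m exp (-(r ^ α) / α)` on `(0, ∞)`, and let `σ²` be
the mean of `‖x‖ ^ 2` under the measure, which is `secondMoment n α`. The core estimate is `(n - 1)
/ σ² ≤ λ₁ ≤ n / σ²`. The Gamma function bounds are this estimate with `σ²` made explicit, and the
power bounds follow from log-convexity of Gamma.

Upper bound: a linear function `x ↦ ⟨v, x⟩` with `‖v‖ = 1` has mean zero and energy `1`, and the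
second moments of the coordinates add up to `σ²`, so one of them is at least `σ² / n`. Cutoffs put
affine functions in the form domain.

Lower bound: this is a Poincaré inequality with constant `c = m / σ²`, proved in polar coordinates
(`polar_poincare`). A function is the sum of its spherical average `A(r)` and of a remainder `q`
with zero mean on every sphere. The Poincaré inequality of the unit sphere, with constant `m`,
bounds the tangential energy of `q` below by the potential `m / r ^ 2`. There remain two
inequalities for the weight `w`, both with constant `c`: a Poincaré inequality for `A`
(`RadialPoincare`) and a Hardy type inequality for `q` along rays (`RadialHardy`).

These two are linked. Derivatives of solutions of the radial Poisson equation obey a Schrödinger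
form with potential `m / r ^ 2 + (α - 1) r ^ (α - 2)`, and a lower bound of that form is a Poincaré
constant. Since `α ≥ 1` the potential dominates `m / r ^ 2`, so Hardy implies Poincaré. Conversely,
Cauchy-Schwarz gives `c (∫ h w) ^ 2 ≤ (∫ w) ∫ h ^ 2 (m / r ^ 2) w`, so Poincaré with constant `c`
implies Hardy with constant `c`. For `α ≤ 2` the Hardy inequality comes from an explicit test
function in Barta's method. For `α ≥ 2` the potential is at least `1`, and any Poincaré constant
below `c` can be strictly improved, so the best one in `[0, c]` is `c`.

The sphere inequality is deduced from the Gaussian Poincaré inequality, itself proved on the line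
and tensorized. Finally `spectralGap_of_form` identifies the spectral gap of the operator with the
infimum of Rayleigh quotients orthogonal to the constants, using Lax-Milgram and no spectral
theorem. -/

/-! ### Spectral gap of the operator attached to a form -/

section FormOperator

open scoped RealInnerProductSpace

/-- A real `z` for which `A - z` is bounded below and onto lies in the resolvent set. -/
theorem mem_unboundedResolventSet_of_bound {H : Type*} [NormedAddCommGroup H] [NormedSpace ℝ H]
    (A : H →ₗ.[ℝ] H) {z d : ℝ} (hd : 0 < d)
    (hb : ∀ f : A.domain, d * ‖(f : H)‖ ≤ ‖A f - z • (f : H)‖)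
    (hs : ∀ h : H, ∃ f : A.domain, A f - z • (f : H) = h) : z ∈ unboundedResolventSet A := by
  let S : A.domain →ₗ[ℝ] H := A.toFun - z • A.domain.subtype
  have hS : ∀ f : A.domain, S f = A f - z • (f : H) := fun f => rfl
  have hinj : Function.Injective S := by
    rw [← LinearMap.ker_eq_bot, LinearMap.ker_eq_bot']
    intro f hf
    have := hb f
    rw [← hS, hf, norm_zero] at this
    have h0 : ‖(f : H)‖ ≤ 0 := by nlinarith [norm_nonneg (f : H)]
    exact Subtype.ext (norm_le_zero_iff.1 h0)
  let E := LinearEquiv.ofBijective S ⟨hinj, fun h => hs h⟩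
  have hE : ∀ f, E f = A f - z • (f : H) := fun f => rfl
  let R₀ : H →ₗ[ℝ] H := A.domain.subtype ∘ₗ (E.symm : H →ₗ[ℝ] A.domain)
  refine ⟨R₀.mkContinuous d⁻¹ fun g => ?_, fun g => ⟨E.symm g, rfl, ?_⟩, fun f => ?_⟩
  · have := hb (E.symm g)
    rw [← hE, E.apply_symm_apply] at this
    rw [inv_mul_eq_div, le_div_iff₀ hd, mul_comm]
    exact this
  · rw [← hE, E.apply_symm_apply]
  · change ((E.symm (A f - z • (f : H)) : A.domain) : H) = f
    rw [← hE, E.symm_apply_apply]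

variable {H K : Type*} [NormedAddCommGroup H] [InnerProductSpace ℝ H] [CompleteSpace H]
  [NormedAddCommGroup K] [InnerProductSpace ℝ K] [CompleteSpace K]

/-- The Lax-Milgram theorem for the form `‖F‖² - z ‖f‖²` on a closed subspace of `H × K` on which
`c ‖f‖² ≤ ‖F‖²` for some `c > z`. -/
theorem exists_weak_solution {V : Submodule ℝ (H × K)} (hV : IsClosed (V : Set (H × K)))
    {c z : ℝ} (hc : 0 ≤ c) (hz : z < c) (hP : ∀ p ∈ V, c * ‖p.1‖ ^ 2 ≤ ‖p.2‖ ^ 2) (h : H) :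
    ∃ p ∈ V, ∀ q ∈ V, ⟪p.2, q.2⟫ - z * ⟪p.1, q.1⟫ = ⟪h, q.1⟫ := by
  let T := WithLp.prodContinuousLinearEquiv 2 ℝ H K
  let U : Submodule ℝ (WithLp 2 (H × K)) := V.comap (T : WithLp 2 (H × K) →ₗ[ℝ] H × K)
  have hU : IsClosed (U : Set (WithLp 2 (H × K))) := hV.preimage T.continuous
  have : CompleteSpace U := hU.completeSpace_coe
  let P₁ : U →L[ℝ] H := (ContinuousLinearMap.fst ℝ H K) ∘L (T : _ →L[ℝ] _) ∘L U.subtypeL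
  let P₂ : U →L[ℝ] K := (ContinuousLinearMap.snd ℝ H K) ∘L (T : _ →L[ℝ] _) ∘L U.subtypeL
  let B : U →L[ℝ] U →L[ℝ] ℝ :=
    (innerSL ℝ).bilinearComp P₂ P₂ - z • (innerSL ℝ).bilinearComp P₁ P₁
  have hB : ∀ u v, B u v = ⟪P₂ u, P₂ v⟫ - z * ⟪P₁ u, P₁ v⟫ := fun u v => by simp [B]
  have hn : ∀ u : U, ‖u‖ ^ 2 = ‖P₁ u‖ ^ 2 + ‖P₂ u‖ ^ 2 := fun u =>
    WithLp.prod_norm_sq_eq_of_L2 (u : WithLp 2 (H × K))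
  have hcoer : IsCoercive B := by
    -- With `κ` this constant, `κ ≤ 1` allows the fraction `1 - κ` of `‖F‖ ^ 2` to be replaced by
    -- `(1 - κ) c ‖f‖ ^ 2`; what is left is nonnegative exactly when `κ (1 + c) ≤ c - z`.
    refine ⟨min 1 ((c - z) / (1 + c)), lt_min one_pos (div_pos (by linarith) (by linarith)), ?_⟩
    intro u
    have h1 := hP (T u) u.2
    change c * ‖P₁ u‖ ^ 2 ≤ ‖P₂ u‖ ^ 2 at h1
    have h2 : min 1 ((c - z) / (1 + c)) * (1 + c) ≤ c - z :=
      (mul_le_mul_of_nonneg_right (min_le_right _ _) (by linarith)).trans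
        (div_mul_cancel₀ _ (by linarith)).le
    have h3 := min_le_left 1 ((c - z) / (1 + c))
    rw [mul_assoc, ← sq, hn, hB, real_inner_self_eq_norm_sq, real_inner_self_eq_norm_sq]
    generalize min 1 ((c - z) / (1 + c)) = κ at *
    nlinarith [mul_le_mul_of_nonneg_left h1 (sub_nonneg.2 h3),
      mul_le_mul_of_nonneg_right h2 (sq_nonneg ‖P₁ u‖)]
  let ℓ : U →L[ℝ] ℝ := (innerSL ℝ h) ∘L P₁
  obtain ⟨u, hu⟩ := hcoer.continuousLinearEquivOfBilin.surjective
    ((InnerProductSpace.toDual ℝ U).symm ℓ)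
  refine ⟨T u, u.2, fun q hq => ?_⟩
  have hq' : T.symm q ∈ U := by
    change T (T.symm q) ∈ V
    rwa [T.apply_symm_apply]
  have h1 := hcoer.continuousLinearEquivOfBilin_apply u ⟨T.symm q, hq'⟩
  rw [hu, InnerProductSpace.toDual_symm_apply, hB] at h1
  have h2 : T (T.symm q) = q := T.apply_symm_apply q
  have h3 : P₁ ⟨T.symm q, hq'⟩ = q.1 := congrArg Prod.fst h2
  have h4 : P₂ ⟨T.symm q, hq'⟩ = q.2 := congrArg Prod.snd h2
  have h5 : ℓ ⟨T.symm q, hq'⟩ = ⟪h, q.1⟫ := by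
    change ⟪h, P₁ ⟨T.symm q, hq'⟩⟫ = _
    rw [h3]
  rw [h3, h4, h5] at h1
  exact h1.symm

/-- The spectral gap of the operator `A` attached to a closed form. The form is given by the closed
subspace `V` of the pairs `(f, F)`, with energy `‖F‖²`, and `e` is a unit vector of zero energy. -/
theorem spectralGap_of_form {A : H →ₗ.[ℝ] H} {V : Submodule ℝ (H × K)}
    (hV : IsClosed (V : Set (H × K))) {e : H} (he : ‖e‖ = 1) (heV : (e, (0 : K)) ∈ V)
    (hA : ∀ f : A.domain, ∃ F : K, ((f : H), F) ∈ V ∧ ∀ q ∈ V, ⟪A f, q.1⟫ = ⟪F, q.2⟫)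
    (hA' : ∀ p ∈ V, ∀ h : H, (∀ q ∈ V, ⟪h, q.1⟫ = ⟪p.2, q.2⟫) →
      ∃ f : A.domain, (f : H) = p.1 ∧ A f = h)
    {c : ℝ} (hc : 0 < c) (hP : ∀ p ∈ V, ⟪e, p.1⟫ = 0 → c * ‖p.1‖ ^ 2 ≤ ‖p.2‖ ^ 2)
    {p₀ : H × K} (hp₀ : p₀ ∈ V) (hp₀e : ⟪e, p₀.1⟫ = 0) (hp₀0 : p₀.1 ≠ 0) :
    IsGreatest (gapSet A) (spectralGap A) ∧ c ≤ spectralGap A ∧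
      ∀ p ∈ V, ⟪e, p.1⟫ = 0 → spectralGap A * ‖p.1‖ ^ 2 ≤ ‖p.2‖ ^ 2 := by
  have hee : ⟪e, e⟫ = 1 := by rw [real_inner_self_eq_norm_sq, he, one_pow]
  -- The Rayleigh quotients of the form on the orthogonal complement of `e`; the gap will be their
  -- infimum `l`.
  set Q : Set ℝ := {t | ∃ p ∈ V, ⟪e, p.1⟫ = 0 ∧ p.1 ≠ 0 ∧ t = ‖p.2‖ ^ 2 / ‖p.1‖ ^ 2} with hQ
  have hQne : Q.Nonempty := ⟨_, p₀, hp₀, hp₀e, hp₀0, rfl⟩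
  have hQc : c ∈ lowerBounds Q := by
    rintro _ ⟨p, hp, hpe, hp0, rfl⟩
    rw [le_div_iff₀ (by positivity)]
    exact hP p hp hpe
  set l := sInf Q with hl
  have hcl : c ≤ l := le_csInf hQne hQc
  have hl0 : 0 < l := hc.trans_le hcl
  have hPl : ∀ p ∈ V, ⟪e, p.1⟫ = 0 → l * ‖p.1‖ ^ 2 ≤ ‖p.2‖ ^ 2 := by
    intro p hp hpe
    by_cases h0 : p.1 = 0
    · rw [h0, norm_zero]
      nlinarith [sq_nonneg ‖p.2‖]
    · rw [← le_div_iff₀ (by positivity)]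
      exact csInf_le ⟨c, hQc⟩ ⟨p, hp, hpe, h0, rfl⟩
  have hAe : ∀ f : A.domain, ⟪e, A f⟫ = 0 := by
    intro f
    obtain ⟨F, -, hF⟩ := hA f
    rw [real_inner_comm, hF _ heV, inner_zero_right]
  have hproj : ∀ p ∈ V, (p.1 - ⟪e, p.1⟫ • e, p.2) ∈ V := by
    intro p hp
    have := V.sub_mem hp (V.smul_mem ⟪e, p.1⟫ heV)
    simpa [Prod.sub_def] using this
  have horth : ∀ g : H, ⟪e, g - ⟪e, g⟫ • e⟫ = 0 := by
    intro g
    rw [inner_sub_right, inner_smul_right, hee, mul_one, sub_self]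
  -- below `l`, only `0` is in the spectrum
  have hres : ∀ z < l, z ≠ 0 → z ∈ unboundedResolventSet A := by
    intro z hz hz0
    have hlz : 0 < l - z := sub_pos.2 hz
    have hz0' : 0 < |z| := abs_pos.2 hz0
    -- The two summands are the inverse bounds on the two invariant pieces: `A - z` multiplies the
    -- `e` component by `-z`, and it is bounded below by `l - z` on the orthogonal complement of
    -- `e`.
    refine mem_unboundedResolventSet_of_bound A (d := ((l - z)⁻¹ + |z|⁻¹)⁻¹) (by positivity) ?_ ?_
    · intro f
      obtain ⟨F, hFV, hF⟩ := hA f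
      set g := A f - z • (f : H) with hg
      have h1 : ⟪e, g⟫ = -(z * ⟪e, (f : H)⟫) := by
        rw [hg, inner_sub_right, hAe, inner_smul_right, zero_sub]
      have h2 : |z| * |⟪e, (f : H)⟫| ≤ ‖g‖ := by
        rw [← abs_mul, ← abs_neg, ← h1]
        calc |⟪e, g⟫| ≤ ‖e‖ * ‖g‖ := abs_real_inner_le_norm _ _
          _ = ‖g‖ := by rw [he, one_mul]
      set f₀ := (f : H) - ⟪e, (f : H)⟫ • e with hf₀
      have h3 := hproj _ hFV
      have h4 := hPl _ h3 (horth _)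
      change l * ‖f₀‖ ^ 2 ≤ ‖F‖ ^ 2 at h4
      have h5 : ⟪g, f₀⟫ = ‖F‖ ^ 2 - z * ‖f₀‖ ^ 2 := by
        have h6 : ⟪(f : H), f₀⟫ = ‖f₀‖ ^ 2 := by
          have : (f : H) = f₀ + ⟪e, (f : H)⟫ • e := by rw [hf₀]; abel
          rw [this, inner_add_left, inner_smul_left, horth, real_inner_self_eq_norm_sq]
          simp
        have h7 := hF _ h3
        change ⟪A f, f₀⟫ = ⟪F, F⟫ at h7
        rw [hg, inner_sub_left, h7, inner_smul_left, h6, real_inner_self_eq_norm_sq]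
        simp
      have h8 : (l - z) * ‖f₀‖ ≤ ‖g‖ := by
        have h9 : (l - z) * ‖f₀‖ ^ 2 ≤ ‖g‖ * ‖f₀‖ := by
          calc (l - z) * ‖f₀‖ ^ 2 ≤ ⟪g, f₀⟫ := by rw [h5]; linarith
            _ ≤ ‖g‖ * ‖f₀‖ := real_inner_le_norm _ _
        rcases (norm_nonneg f₀).eq_or_lt with h0 | h0
        · rw [← h0, mul_zero]; positivity
        · nlinarith
      have h10 : ‖(f : H)‖ ≤ ‖f₀‖ + |⟪e, (f : H)⟫| := by
        calc ‖(f : H)‖ = ‖f₀ + ⟪e, (f : H)⟫ • e‖ := by rw [hf₀]; congr 1; abel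
          _ ≤ ‖f₀‖ + ‖⟪e, (f : H)⟫ • e‖ := norm_add_le _ _
          _ = _ := by rw [norm_smul, he, mul_one, Real.norm_eq_abs]
      rw [inv_mul_le_iff₀ (by positivity), add_mul]
      refine h10.trans (add_le_add ?_ ?_)
      · rw [inv_mul_eq_div, le_div_iff₀ hlz, mul_comm]; exact h8
      · rw [inv_mul_eq_div, le_div_iff₀ hz0', mul_comm]; exact h2
    · intro h
      -- Lax-Milgram needs `z` below the bottom of the form, which holds only orthogonally to `e`.
      -- The component of the data along `e` is solved by hand: the correction `-(⟪e, h⟫ / z) • e`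
      -- is where `z ≠ 0` enters.
      let V₀ : Submodule ℝ (H × K) := V ⊓ ((innerSL ℝ e).toLinearMap ∘ₗ LinearMap.fst ℝ H K).ker
      have hV₀ : ∀ p, p ∈ V₀ ↔ p ∈ V ∧ ⟪e, p.1⟫ = 0 := fun p => by simp [V₀]
      have hV₀c : IsClosed (V₀ : Set (H × K)) := by
        have : (V₀ : Set (H × K)) = (V : Set (H × K)) ∩ {p : H × K | ⟪e, p.1⟫ = 0} := by
          ext p; exact hV₀ p
        rw [this]
        exact hV.inter (isClosed_eq (by fun_prop) continuous_const)
      obtain ⟨p, hp, hpw⟩ := exists_weak_solution hV₀c hl0.le hz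
        (fun p hp => hPl p ((hV₀ p).1 hp).1 ((hV₀ p).1 hp).2) (h - ⟪e, h⟫ • e)
      obtain ⟨hpV, hpe⟩ := (hV₀ p).1 hp
      have hp' : (p.1 - (⟪e, h⟫ / z) • e, p.2) ∈ V := by
        have := V.sub_mem hpV (V.smul_mem (⟪e, h⟫ / z) heV)
        simpa [Prod.sub_def] using this
      obtain ⟨f, hf1, hf2⟩ := hA' _ hp' (h + z • (p.1 - (⟪e, h⟫ / z) • e)) (by
        intro q hq
        have h1 := hpw _ ((hV₀ _).2 ⟨hproj q hq, horth _⟩)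
        simp only [inner_sub_left, inner_sub_right, inner_smul_left, inner_smul_right, hee,
          inner_add_left, conj_trivial] at h1 ⊢
        rw [real_inner_comm e p.1, hpe, real_inner_comm e h] at h1
        field_simp
        linarith)
      refine ⟨f, ?_⟩
      rw [hf2, hf1, add_sub_cancel_right]
  -- `l` is in the spectrum
  have hspec : l ∈ unboundedSpectrum A := by
    rintro ⟨R, hR, -⟩
    have hRn : 0 < ‖R‖ + 1 := by positivity
    -- An almost minimizer `p` and its image `f = R p` contradict the nonnegativity of the form `‖F‖
    -- ^ 2 - l ‖f‖ ^ 2`: moving from `p` in the direction `-f` lowers the form at a rate governed by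
    -- `‖p‖ ^ 2`, while its value at `p` is as small as desired.
    obtain ⟨t, ⟨p, hp, hpe, hp0, rfl⟩, ht⟩ := exists_lt_of_csInf_lt hQne
      (show sInf Q < l + (‖R‖ + 1)⁻¹ by rw [← hl]; linarith [inv_pos.2 hRn])
    obtain ⟨f, hf1, hf2⟩ := hR p.1
    obtain ⟨F, hFV, hF⟩ := hA f
    have hfe : ⟪e, (f : H)⟫ = 0 := by
      have h1 : ⟪e, A f - l • (f : H)⟫ = 0 := by rw [hf2, hpe]
      rw [inner_sub_right, hAe, inner_smul_right, zero_sub, neg_eq_zero, mul_eq_zero] at h1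
      exact h1.resolve_left hl0.ne'
    have hpn : 0 < ‖p.1‖ ^ 2 := by positivity
    set N := ‖p.1‖ ^ 2 with hN
    have hform : ∀ q ∈ V, ⟪F, q.2⟫ - l * ⟪(f : H), q.1⟫ = ⟪p.1, q.1⟫ := by
      intro q hq
      rw [← hF q hq, ← hf2, inner_sub_left, inner_smul_left]
      rfl
    have e1 := hform _ hFV
    have e2 := hform _ hp
    rw [real_inner_self_eq_norm_sq] at e2
    have e3 : ⟪p.1, (f : H)⟫ ≤ ‖R‖ * N := by
      rw [hf1]
      calc ⟪p.1, R p.1⟫ ≤ ‖p.1‖ * ‖R p.1‖ := real_inner_le_norm _ _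
        _ ≤ ‖p.1‖ * (‖R‖ * ‖p.1‖) := by gcongr; exact R.le_opNorm _
        _ = ‖R‖ * N := by rw [hN]; ring
    rw [div_lt_iff₀ hpn] at ht
    -- the form is nonnegative at `p - s f`
    have key : ∀ s : ℝ, 0 ≤ (‖p.2‖ ^ 2 - l * N) - 2 * s * N + s ^ 2 * (‖R‖ * N) := by
      intro s
      have hq : (p.1 - s • (f : H), p.2 - s • F) ∈ V := V.sub_mem hp (V.smul_mem s hFV)
      have h1 := hPl _ hq (by
        change ⟪e, p.1 - s • (f : H)⟫ = 0
        rw [inner_sub_right, inner_smul_right, hpe, hfe]; ring)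
      change l * ‖p.1 - s • (f : H)‖ ^ 2 ≤ ‖p.2 - s • F‖ ^ 2 at h1
      rw [norm_sub_sq_real, norm_sub_sq_real, norm_smul, norm_smul, inner_smul_right,
        inner_smul_right, mul_pow, mul_pow, Real.norm_eq_abs, sq_abs] at h1
      rw [real_inner_comm p.2 F, real_inner_comm p.1 (f : H)] at e2
      rw [real_inner_self_eq_norm_sq, real_inner_self_eq_norm_sq] at e1
      have h2 : s ^ 2 * ⟪p.1, (f : H)⟫ ≤ s ^ 2 * (‖R‖ * N) := by gcongr
      have h3 : s ^ 2 * (‖F‖ ^ 2 - l * ‖(f : H)‖ ^ 2) = s ^ 2 * ⟪p.1, (f : H)⟫ := by rw [e1]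
      have h4 : s * (⟪p.2, F⟫ - l * ⟪p.1, (f : H)⟫) = s * N := by rw [e2]
      nlinarith
    -- With `r = (‖R‖ + 1)⁻¹` the first bracket is less than `r N` and the quadratic term is at most
    -- `r N`, so the sum is below `r N - 2 r N + r N = 0`.
    have h1 := key (‖R‖ + 1)⁻¹
    have h2 : (‖R‖ + 1)⁻¹ * (‖R‖ + 1) = 1 := inv_mul_cancel₀ hRn.ne'
    set r := (‖R‖ + 1)⁻¹ with hr
    have hr0 : 0 < r := inv_pos.2 hRn
    have h3 : ‖R‖ * r ≤ 1 := by nlinarith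
    have h4 : r ^ 2 * (‖R‖ * N) ≤ r * N := by
      have : r * N * (‖R‖ * r) ≤ r * N * 1 := by gcongr
      nlinarith
    nlinarith
  have hgap : gapSet A = Set.Iic l := by
    ext m
    constructor
    · intro hm
      rcases hm hspec with h0 | h0
      · exact absurd h0 hl0.ne'
      · exact h0
    · intro hm z hz
      by_cases hz0 : z = 0
      · exact Or.inl hz0
      · right
        by_contra hlt
        exact hz (hres z ((not_le.1 hlt).trans_le hm) hz0)
  have hgl : spectralGap A = l := by rw [spectralGap, hgap, csSup_Iic]
  rw [hgl, hgap]
  exact ⟨isGreatest_Iic, hcl, hPl⟩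

end FormOperator

/-! ### One-dimensional inequalities for the radial weight -/

section Radial

open Set

/-- The weight `r ^ m exp (-(r ^ α) / α)` on `(0, ∞)`. -/
noncomputable def radialWeight (m α r : ℝ) : ℝ := r ^ m * Real.exp (-(r ^ α) / α)

/-- Minus the logarithmic derivative of the radial weight. -/
noncomputable def radialDrift (m α r : ℝ) : ℝ := r ^ (α - 1) - m / r

/-- Differentiable functions on `(0, ∞)` that are bounded and have a bounded derivative. -/
def IsBoundedLip (f : ℝ → ℝ) : Prop :=
  ∃ C, ∀ r, 0 < r → DifferentiableAt ℝ f r ∧ |f r| ≤ C ∧ |deriv f r| ≤ C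

/-- Bounded differentiable functions on `(0, ∞)` with bounded derivative and `f r = O(r)`. -/
def IsBoundedLipZero (f : ℝ → ℝ) : Prop :=
  IsBoundedLip f ∧ ∃ C, ∀ r, 0 < r → |f r| ≤ C * r

theorem integral_Ioi_deriv_eq_zero {F F' : ℝ → ℝ} (hF : ∀ r, 0 < r → HasDerivAt F (F' r) r)
    (hi : IntegrableOn F' (Ioi 0)) (h0 : Tendsto F (𝓝[>] 0) (𝓝 0))
    (hinf : Tendsto F atTop (𝓝 0)) : ∫ r in Ioi 0, F' r = 0 := by
  have := integral_Ioi_deriv_mul_eq_sub (u := F) (v := fun _ => 1) (u' := F') (v' := fun _ => 0)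
    (a := 0) (a' := 0) (b' := 0) hF (fun x _ => hasDerivAt_const x 1)
    (by refine hi.congr_fun (fun x _ => ?_) measurableSet_Ioi; simp)
    (by simpa [Pi.mul_def] using h0) (by simpa [Pi.mul_def] using hinf)
  simpa using this

theorem IntegrableOn.bdd_mul_Ioi {g k : ℝ → ℝ} (hk : IntegrableOn k (Ioi 0))
    (hg : AEStronglyMeasurable g (volume.restrict (Ioi 0))) {C : ℝ}
    (hb : ∀ r, 0 < r → |g r| ≤ C) : IntegrableOn (fun r => g r * k r) (Ioi 0) :=
  Integrable.bdd_mul hk hg ((ae_restrict_iff' measurableSet_Ioi).2 (.of_forall fun r hr => hb r hr))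

theorem IntegrableOn.fun_add {f g : ℝ → ℝ} {s : Set ℝ} (hf : IntegrableOn f s)
    (hg : IntegrableOn g s) : IntegrableOn (fun r => f r + g r) s := hf.add hg

theorem IntegrableOn.fun_sub {f g : ℝ → ℝ} {s : Set ℝ} (hf : IntegrableOn f s)
    (hg : IntegrableOn g s) : IntegrableOn (fun r => f r - g r) s := hf.sub hg

theorem ContinuousOn.aesm_Ioi {g : ℝ → ℝ} (hg : ContinuousOn g (Ioi 0)) :
    AEStronglyMeasurable g (volume.restrict (Ioi 0)) :=
  hg.aestronglyMeasurable measurableSet_Ioi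

section Weight

variable {m α : ℝ}

theorem radialWeight_pos {r : ℝ} (hr : 0 < r) : 0 < radialWeight m α r := by
  unfold radialWeight; positivity

theorem rpow_mul_radialWeight (p : ℝ) {r : ℝ} (hr : 0 < r) :
    r ^ p * radialWeight m α r = radialWeight (p + m) α r := by
  rw [radialWeight, radialWeight, Real.rpow_add hr]; ring

theorem continuousOn_radialWeight : ContinuousOn (radialWeight m α) (Ioi 0) := by
  unfold radialWeight
  have h : ∀ q : ℝ, ContinuousOn (fun r : ℝ => r ^ q) (Ioi 0) := fun q =>
    continuousOn_id.rpow_const fun r hr => Or.inl (ne_of_gt hr)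
  exact (h m).mul (((h α).neg.div_const α).rexp)

theorem hasDerivAt_radialWeight (hα : α ≠ 0) {r : ℝ} (hr : 0 < r) :
    HasDerivAt (radialWeight m α) (-(radialDrift m α r * radialWeight m α r)) r := by
  have h1 := (Real.hasDerivAt_rpow_const (p := m) (Or.inl hr.ne')).mul
    (((Real.hasDerivAt_rpow_const (p := α) (Or.inl hr.ne')).neg.div_const α).exp)
  refine h1.congr_deriv ?_
  simp only [radialDrift, radialWeight, Pi.neg_apply]
  rw [Real.rpow_sub_one hr.ne' m]
  field_simp
  ring

theorem integrableOn_radialWeight (hm : -1 < m) (hα : 0 < α) :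
    IntegrableOn (radialWeight m α) (Ioi 0) := by
  refine (integrableOn_rpow_mul_exp_neg_mul_rpow (b := 1 / α) hm hα (by positivity)).congr_fun
    (fun r _ => ?_) measurableSet_Ioi
  simp only [radialWeight]
  congr 2; ring

theorem integrableOn_rpow_mul_radialWeight {p : ℝ} (hm : -1 < p + m) (hα : 0 < α) :
    IntegrableOn (fun r => r ^ p * radialWeight m α r) (Ioi 0) :=
  (integrableOn_radialWeight hm hα).congr_fun
    (fun _ hr => (rpow_mul_radialWeight p hr).symm) measurableSet_Ioi

theorem tendsto_radialWeight_zero (hm : 0 < m) (hα : 0 < α) :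
    Tendsto (radialWeight m α) (𝓝[>] 0) (𝓝 0) := by
  have h : ContinuousAt (radialWeight m α) 0 := by
    unfold radialWeight
    have h1 : ∀ q : ℝ, 0 < q → ContinuousAt (fun r : ℝ => r ^ q) 0 := fun q hq =>
      Real.continuousAt_rpow_const 0 q (Or.inr hq.le)
    exact (h1 m hm).mul (((h1 α hα).neg.div_const α).rexp)
  have h2 := h.tendsto.mono_left (nhdsWithin_le_nhds (s := Ioi 0))
  simpa [radialWeight, Real.zero_rpow hm.ne'] using h2

theorem tendsto_radialWeight_atTop (hα : 0 < α) :
    Tendsto (radialWeight m α) atTop (𝓝 0) := by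
  have h1 := (tendsto_rpow_mul_exp_neg_mul_atTop_nhds_zero (m / α) (1 / α)
    (by positivity)).comp (tendsto_rpow_atTop hα)
  refine h1.congr' ?_
  filter_upwards [eventually_gt_atTop 0] with r hr
  simp only [Function.comp, radialWeight]
  rw [← Real.rpow_mul hr.le, mul_div_cancel₀ _ hα.ne']
  congr 2; ring

theorem IsBoundedLip.continuousOn {f : ℝ → ℝ} (hf : IsBoundedLip f) : ContinuousOn f (Ioi 0) := by
  obtain ⟨C, hC⟩ := hf
  exact fun r hr => (hC r hr).1.continuousAt.continuousWithinAt

theorem IsBoundedLip.integrableOn_mul {f : ℝ → ℝ} (hf : IsBoundedLip f) {k : ℝ → ℝ}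
    (hk : IntegrableOn k (Ioi 0)) : IntegrableOn (fun r => f r * k r) (Ioi 0) := by
  obtain ⟨C, hC⟩ := id hf
  exact IntegrableOn.bdd_mul_Ioi hk (hf.continuousOn.aesm_Ioi) fun r hr => (hC r hr).2.1

theorem IsBoundedLip.integrableOn_sq_mul {f : ℝ → ℝ} (hf : IsBoundedLip f) {k : ℝ → ℝ}
    (hk : IntegrableOn k (Ioi 0)) : IntegrableOn (fun r => f r ^ 2 * k r) (Ioi 0) := by
  simpa [sq, mul_assoc] using hf.integrableOn_mul (hf.integrableOn_mul hk)

theorem IsBoundedLip.integrableOn_deriv_mul {f : ℝ → ℝ} (hf : IsBoundedLip f) {k : ℝ → ℝ}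
    (hk : IntegrableOn k (Ioi 0)) : IntegrableOn (fun r => deriv f r * k r) (Ioi 0) := by
  obtain ⟨C, hC⟩ := hf
  exact IntegrableOn.bdd_mul_Ioi hk (measurable_deriv f).aestronglyMeasurable
    fun r hr => (hC r hr).2.2

theorem IsBoundedLip.integrableOn_deriv_sq_mul {f : ℝ → ℝ} (hf : IsBoundedLip f) {k : ℝ → ℝ}
    (hk : IntegrableOn k (Ioi 0)) : IntegrableOn (fun r => deriv f r ^ 2 * k r) (Ioi 0) := by
  simpa [sq, mul_assoc] using hf.integrableOn_deriv_mul (hf.integrableOn_deriv_mul hk)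

/-- A function that is `O(r)` may be divided by `r`. -/
theorem IsBoundedLipZero.integrableOn_mul {f : ℝ → ℝ} (hf : IsBoundedLipZero f) {k : ℝ → ℝ}
    (hk : IntegrableOn (fun r => r * k r) (Ioi 0)) : IntegrableOn (fun r => f r * k r) (Ioi 0) := by
  obtain ⟨h1, C, hC⟩ := hf
  refine (IntegrableOn.bdd_mul_Ioi (g := fun r => f r / r) (C := C) hk ?_ fun r hr => ?_).congr_fun
    (fun r hr => ?_) measurableSet_Ioi
  · exact (h1.continuousOn.div continuousOn_id fun r hr => ne_of_gt hr).aesm_Ioi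
  · rw [abs_div, abs_of_pos hr, div_le_iff₀ hr]; exact hC r hr
  · have : r ≠ 0 := ne_of_gt hr
    simp only []; field_simp

theorem IsBoundedLipZero.integrableOn_sq_mul {f : ℝ → ℝ} (hf : IsBoundedLipZero f) {k : ℝ → ℝ}
    (hk : IntegrableOn (fun r => r ^ 2 * k r) (Ioi 0)) :
    IntegrableOn (fun r => f r ^ 2 * k r) (Ioi 0) := by
  have := hf.integrableOn_mul (k := fun r => f r * k r) ?_
  · simpa [sq, mul_assoc] using this
  · have := hf.integrableOn_mul (k := fun r => r * k r) (by simpa [sq, mul_assoc] using hk)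
    refine this.congr_fun (fun r _ => ?_) measurableSet_Ioi
    simp only []; ring

end Weight

section Identities

variable {m α : ℝ}

theorem integrableOn_rpow_mul_pow {p q : ℝ} (hm : 0 < m) (hα : 1 ≤ α) (hp : 0 ≤ p) :
    IntegrableOn (fun r => q * r ^ p * radialWeight m α r) (Ioi 0) := by
  have h := (integrableOn_rpow_mul_radialWeight (m := m) (p := p) (α := α)
    (by linarith) (by linarith)).const_mul q
  simp only [mul_assoc]
  exact h

/-- Each factor `h = O(r)` absorbs one factor `1 / r`, so all singular terms at the origin reduce to
nonnegative powers of `r` times the weight. These are the terms that appear when `(h' - h v) ^ 2` is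
expanded with `v = a / r + b r ^ (α - 1)`, and when `h ^ 2 v w` is differentiated. -/
theorem IsBoundedLipZero.integrableOn_vec (hm : 1 ≤ m) (hα : 1 ≤ α) {h : ℝ → ℝ}
    (hh : IsBoundedLipZero h) (a b : ℝ) :
    IntegrableOn (fun r => 2 * h r * deriv h r * (a / r + b * r ^ (α - 1)) * radialWeight m α r)
        (Ioi 0) ∧
      IntegrableOn (fun r => h r ^ 2 * (-a / r ^ 2 + b * (α - 1) * r ^ (α - 2)) *
        radialWeight m α r) (Ioi 0) ∧
      ∀ a' b' : ℝ, IntegrableOn (fun r => h r ^ 2 * ((a / r + b * r ^ (α - 1)) *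
        (a' / r + b' * r ^ (α - 1))) * radialWeight m α r) (Ioi 0) := by
  have hm0 : 0 < m := by linarith
  have I := fun q p hp => integrableOn_rpow_mul_pow (p := p) (q := q) hm0 hα hp
  have e1 : ∀ r : ℝ, 0 < r → r ^ α = r * r ^ (α - 1) := fun r hr => by
    rw [mul_comm, ← Real.rpow_add_one hr.ne']; congr 1; ring
  have e2 : ∀ r : ℝ, 0 < r → r ^ α = r ^ 2 * r ^ (α - 2) := fun r hr => by
    rw [mul_comm, ← Real.rpow_natCast, ← Real.rpow_add hr]; congr 1; norm_num
  refine ⟨?_, ?_, fun a' b' => ?_⟩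
  · have h1 := hh.integrableOn_mul (k := fun r => deriv h r *
      (2 * (a / r + b * r ^ (α - 1)) * radialWeight m α r)) (by
        have h2 := hh.1.integrableOn_deriv_mul ((I (2 * a) 0 le_rfl).add (I (2 * b) α (by linarith)))
        refine h2.congr_fun (fun r hr => ?_) measurableSet_Ioi
        have hr0 : r ≠ 0 := ne_of_gt hr
        simp only [Pi.add_apply, Real.rpow_zero, e1 r hr]
        field_simp)
    refine h1.congr_fun (fun r _ => ?_) measurableSet_Ioi
    simp only []; ring
  · have h1 := hh.integrableOn_sq_mul (k := fun r => (-a / r ^ 2 + b * (α - 1) * r ^ (α - 2)) *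
        radialWeight m α r) (by
      refine ((I (-a) 0 le_rfl).add (I (b * (α - 1)) α (by linarith))).congr_fun
        (fun r hr => ?_) measurableSet_Ioi
      have hr0 : r ≠ 0 := ne_of_gt hr
      simp only [Pi.add_apply, Real.rpow_zero, e2 r hr]
      field_simp)
    refine h1.congr_fun (fun r _ => ?_) measurableSet_Ioi
    simp only []; ring
  · have h1 := hh.integrableOn_sq_mul (k := fun r => ((a / r + b * r ^ (α - 1)) *
        (a' / r + b' * r ^ (α - 1))) * radialWeight m α r) (by
      refine (((I (a * a') 0 le_rfl).add (I (a * b' + b * a') α (by linarith))).add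
        (I (b * b') (α + α) (by linarith))).congr_fun (fun r hr => ?_) measurableSet_Ioi
      have hr0 : r ≠ 0 := ne_of_gt hr
      simp only [Pi.add_apply, Real.rpow_zero, Real.rpow_add hr, e1 r hr]
      field_simp
      ring)
    refine h1.congr_fun (fun r _ => ?_) measurableSet_Ioi
    simp only []; ring

/-- Integration by parts of `(h²)'` against the vector field `a / r + b r ^ (α - 1)`. -/
theorem IsBoundedLipZero.integral_sq_deriv_mul (hm : 1 ≤ m) (hα : 1 ≤ α) {h : ℝ → ℝ}
    (hh : IsBoundedLipZero h) (a b : ℝ) :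
    ∫ r in Ioi 0, 2 * h r * deriv h r * (a / r + b * r ^ (α - 1)) * radialWeight m α r =
      (∫ r in Ioi 0, h r ^ 2 * ((a / r + b * r ^ (α - 1)) * (-m / r + 1 * r ^ (α - 1))) *
        radialWeight m α r) -
      ∫ r in Ioi 0, h r ^ 2 * (-a / r ^ 2 + b * (α - 1) * r ^ (α - 2)) * radialWeight m α r := by
  obtain ⟨i1, i2, i3⟩ := hh.integrableOn_vec hm hα a b
  have i3 := i3 (-m) 1
  obtain ⟨⟨C, hC⟩, K, hK⟩ := id hh
  have hα0 : 0 < α := by linarith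
  -- The boundary terms vanish at both ends: `|h| ≤ K r` bounds them by multiples of radial weights
  -- with positive exponents.
  have hlim : ∀ l : Filter ℝ, (∀ᶠ r in l, 0 < r) →
      (∀ p : ℝ, 0 < p → Tendsto (radialWeight p α) l (𝓝 0)) →
      Tendsto (fun r => h r ^ 2 * (a / r + b * r ^ (α - 1)) * radialWeight m α r) l (𝓝 0) := by
    intro l hl hw
    have h1 : Tendsto (fun r => K ^ 2 * (|a| * radialWeight (1 + m) α r +
        |b| * radialWeight ((α + 1) + m) α r)) l (𝓝 0) := by
      simpa using (((hw (1 + m) (by linarith)).const_mul |a|).add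
        ((hw ((α + 1) + m) (by linarith)).const_mul |b|)).const_mul (K ^ 2)
    refine squeeze_zero_norm' ?_ h1
    filter_upwards [hl] with r hr
    rw [← rpow_mul_radialWeight 1 hr, ← rpow_mul_radialWeight (α + 1) hr, Real.norm_eq_abs, abs_mul,
      abs_mul, abs_of_pos (radialWeight_pos hr), abs_of_nonneg (sq_nonneg (h r))]
    have e1 : |a / r + b * r ^ (α - 1)| ≤ |a| / r + |b| * r ^ (α - 1) := by
      refine (abs_add_le _ _).trans_eq ?_
      rw [abs_div, abs_mul, abs_of_pos hr, abs_of_pos (Real.rpow_pos_of_pos hr _)]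
    have e2 : h r ^ 2 ≤ (K * r) ^ 2 := by
      rw [← sq_abs]; exact pow_le_pow_left₀ (abs_nonneg _) (hK r hr) 2
    have e3 : r ^ (α + 1) = r ^ 2 * r ^ (α - 1) := by
      rw [← Real.rpow_natCast, ← Real.rpow_add hr]; congr 1; norm_num; ring
    calc h r ^ 2 * |a / r + b * r ^ (α - 1)| * radialWeight m α r
        ≤ (K * r) ^ 2 * (|a| / r + |b| * r ^ (α - 1)) * radialWeight m α r := by
          have := (radialWeight_pos (m := m) (α := α) hr).le
          gcongr
      _ = _ := by
          rw [e3, Real.rpow_one]; field_simp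
  have key := integral_Ioi_deriv_eq_zero
    (F := fun r => h r ^ 2 * (a / r + b * r ^ (α - 1)) * radialWeight m α r)
    (F' := fun r => 2 * h r * deriv h r * (a / r + b * r ^ (α - 1)) * radialWeight m α r +
      (h r ^ 2 * (-a / r ^ 2 + b * (α - 1) * r ^ (α - 2)) * radialWeight m α r -
      h r ^ 2 * ((a / r + b * r ^ (α - 1)) * (-m / r + 1 * r ^ (α - 1))) * radialWeight m α r))
    (fun r hr => by
      have d1 := ((hC r hr).1.hasDerivAt.pow 2)
      have d2 := ((hasDerivAt_inv hr.ne').const_mul a).add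
        ((Real.hasDerivAt_rpow_const (p := α - 1) (Or.inl hr.ne')).const_mul b)
      refine (((d1.mul d2).mul (hasDerivAt_radialWeight (m := m) hα0.ne' hr)).congr_deriv
        ?_).congr_of_eventuallyEq (.of_forall fun x => ?_)
      · simp only [radialDrift, Pi.mul_apply, Pi.add_apply, Pi.pow_apply]
        rw [show α - 1 - 1 = α - 2 by ring]
        field_simp
        ring
      · simp [div_eq_mul_inv])
    (IntegrableOn.fun_add i1 (IntegrableOn.fun_sub i2 i3))
    (hlim _ self_mem_nhdsWithin fun p hp => tendsto_radialWeight_zero hp hα0)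
    (hlim _ (eventually_gt_atTop 0) fun p _ => tendsto_radialWeight_atTop hα0)
  rw [integral_add i1 (IntegrableOn.fun_sub i2 i3), integral_sub i2 i3] at key
  linarith

/-- The Bochner identity. -/
theorem IsBoundedLipZero.integral_sq_sub_drift (hm : 1 ≤ m) (hα : 1 ≤ α) {h : ℝ → ℝ}
    (hh : IsBoundedLipZero h) :
    ∫ r in Ioi 0, (deriv h r - radialDrift m α r * h r) ^ 2 * radialWeight m α r =
      (∫ r in Ioi 0, deriv h r ^ 2 * radialWeight m α r) +
      ∫ r in Ioi 0, h r ^ 2 * (m / r ^ 2 + (α - 1) * r ^ (α - 2)) * radialWeight m α r := by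
  obtain ⟨i1, i2, i3⟩ := hh.integrableOn_vec hm hα (-m) 1
  have i3 := i3 (-m) 1
  have i0 := hh.1.integrableOn_deriv_sq_mul
    (integrableOn_radialWeight (m := m) (α := α) (by linarith) (by linarith))
  have h1 := hh.integral_sq_deriv_mul hm hα (-m) 1
  have h2 : ∫ r in Ioi 0, (deriv h r - radialDrift m α r * h r) ^ 2 * radialWeight m α r =
      ∫ r in Ioi 0, (deriv h r ^ 2 * radialWeight m α r +
        (h r ^ 2 * ((-m / r + 1 * r ^ (α - 1)) * (-m / r + 1 * r ^ (α - 1))) * radialWeight m α r -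
        2 * h r * deriv h r * (-m / r + 1 * r ^ (α - 1)) * radialWeight m α r)) := by
    congr 1; ext r; simp only [radialDrift]; ring
  rw [h2, integral_add i0 (IntegrableOn.fun_sub i3 i1), integral_sub i3 i1, h1]
  simp only [neg_neg, one_mul]
  ring

/-- Barta's inequality with the test function of logarithmic derivative `1 / r + b r ^ (α - 1)`. -/
theorem IsBoundedLipZero.barta (hm : 1 ≤ m) (hα : 1 ≤ α) {h : ℝ → ℝ}
    (hh : IsBoundedLipZero h) {b c : ℝ}
    (hc : ∀ r, 0 < r → c ≤ (1 - (m + 1 + α) * b) * r ^ (α - 2) + (b - b ^ 2) * (r ^ (α - 1)) ^ 2) :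
    c * ∫ r in Ioi 0, h r ^ 2 * radialWeight m α r ≤
      (∫ r in Ioi 0, deriv h r ^ 2 * radialWeight m α r) +
      ∫ r in Ioi 0, h r ^ 2 * (m / r ^ 2) * radialWeight m α r := by
  obtain ⟨i1, i2, i3⟩ := hh.integrableOn_vec hm hα 1 b
  have i4 := i3 (-m) 1
  have i5 := i3 1 b
  have iw := integrableOn_radialWeight (m := m) (α := α) (by linarith) (by linarith)
  have i0 := hh.1.integrableOn_deriv_sq_mul iw
  have i00 := hh.1.integrableOn_sq_mul iw
  have i6 : IntegrableOn (fun r => h r ^ 2 * (m / r ^ 2) * radialWeight m α r) (Ioi 0) := by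
    simpa using (hh.integrableOn_vec hm hα (-m) 0).2.1
  have h1 := hh.integral_sq_deriv_mul hm hα 1 b
  -- If `ψ` has logarithmic derivative `v = 1 / r + b r ^ (α - 1)`, this integrand is `ψ ^ 2 ((h /
  -- ψ)') ^ 2 w`.
  have h2 : 0 ≤ ∫ r in Ioi 0, (deriv h r - h r * (1 / r + b * r ^ (α - 1))) ^ 2 *
      radialWeight m α r := by
    refine setIntegral_nonneg measurableSet_Ioi fun r hr => ?_
    have := (radialWeight_pos (m := m) (α := α) hr).le
    positivity
  have h3 : ∫ r in Ioi 0, (deriv h r - h r * (1 / r + b * r ^ (α - 1))) ^ 2 *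
      radialWeight m α r = (∫ r in Ioi 0, deriv h r ^ 2 * radialWeight m α r) +
      ((∫ r in Ioi 0, h r ^ 2 * ((1 / r + b * r ^ (α - 1)) * (1 / r + b * r ^ (α - 1))) *
        radialWeight m α r) -
      ∫ r in Ioi 0, 2 * h r * deriv h r * (1 / r + b * r ^ (α - 1)) * radialWeight m α r) := by
    rw [← integral_sub i5 i1, ← integral_add i0 (IntegrableOn.fun_sub i5 i1)]
    congr 1; ext r; ring
  -- With `u` the drift, the claim is the pointwise bound `c ≤ m / r ^ 2 + u v - v' - v ^ 2`. All
  -- terms in `1 / r ^ 2` cancel because `ψ` behaves like `r`, which solves `-ψ'' - (m / r) ψ' + (m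
  -- / r ^ 2) ψ = 0`; what remains is the right side of `hc`.
  have h4 : c * ∫ r in Ioi 0, h r ^ 2 * radialWeight m α r ≤
      (∫ r in Ioi 0, h r ^ 2 * (m / r ^ 2) * radialWeight m α r) +
      ((∫ r in Ioi 0, h r ^ 2 * ((1 / r + b * r ^ (α - 1)) * (-m / r + 1 * r ^ (α - 1))) *
        radialWeight m α r) -
      (∫ r in Ioi 0, h r ^ 2 * (-1 / r ^ 2 + b * (α - 1) * r ^ (α - 2)) * radialWeight m α r) -
      ∫ r in Ioi 0, h r ^ 2 * ((1 / r + b * r ^ (α - 1)) * (1 / r + b * r ^ (α - 1))) *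
        radialWeight m α r) := by
    rw [← integral_const_mul, ← integral_sub i4 i2, ← integral_sub (IntegrableOn.fun_sub i4 i2) i5,
      ← integral_add i6 (IntegrableOn.fun_sub (IntegrableOn.fun_sub i4 i2) i5)]
    refine setIntegral_mono_on (i00.const_mul c) (IntegrableOn.fun_add i6 (IntegrableOn.fun_sub (IntegrableOn.fun_sub i4 i2) i5))
      measurableSet_Ioi fun r hr => ?_
    have hr' : 0 < r := hr
    have e1 : r ^ (α - 1) = r * r ^ (α - 2) := by
      rw [mul_comm, ← Real.rpow_add_one hr'.ne']; congr 1; ring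
    have h5 := mul_le_mul_of_nonneg_right (hc r hr)
      (mul_nonneg (sq_nonneg (h r)) (radialWeight_pos (m := m) (α := α) hr').le)
    calc c * (h r ^ 2 * radialWeight m α r) ≤ _ := h5
      _ = _ := by
        rw [e1]
        field_simp
        ring
  rw [h3, h1] at h2
  linarith

end Identities

end Radial

/-! ### From the Schrödinger form to the radial Poincaré inequality -/

section Poincare

open Set

/-- The Poincaré inequality with constant `l` for the radial weight. -/
def RadialPoincare (m α l : ℝ) : Prop :=
  ∀ f, IsBoundedLip f →
    l * ((∫ r in Ioi 0, radialWeight m α r) * (∫ r in Ioi 0, f r ^ 2 * radialWeight m α r) -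
      (∫ r in Ioi 0, f r * radialWeight m α r) ^ 2) ≤
    (∫ r in Ioi 0, radialWeight m α r) * ∫ r in Ioi 0, deriv f r ^ 2 * radialWeight m α r

/-- The lower bound `l` for the Schrödinger form of the radial weight with potential the second
derivative of minus the logarithm of the weight. -/
def RadialSchrodinger (m α l : ℝ) : Prop :=
  ∀ h, IsBoundedLipZero h →
    l * (∫ r in Ioi 0, h r ^ 2 * radialWeight m α r) ≤
    (∫ r in Ioi 0, deriv h r ^ 2 * radialWeight m α r) +
      ∫ r in Ioi 0, h r ^ 2 * (m / r ^ 2 + (α - 1) * r ^ (α - 2)) * radialWeight m α r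

/-- The lower bound `l` for the Schrödinger form of the radial weight with potential `m / r ^ 2`. -/
def RadialHardy (m α l : ℝ) : Prop :=
  ∀ h, IsBoundedLipZero h →
    l * (∫ r in Ioi 0, h r ^ 2 * radialWeight m α r) ≤
    (∫ r in Ioi 0, deriv h r ^ 2 * radialWeight m α r) +
      ∫ r in Ioi 0, h r ^ 2 * (m / r ^ 2) * radialWeight m α r

variable {m α : ℝ}

theorem radialDrift_mono (hm : 0 ≤ m) (hα : 1 ≤ α) {r s : ℝ} (hr : 0 < r) (hrs : r ≤ s) :
    radialDrift m α r ≤ radialDrift m α s := by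
  unfold radialDrift
  have h1 : r ^ (α - 1) ≤ s ^ (α - 1) := Real.rpow_le_rpow hr.le hrs (by linarith)
  have h2 : m / s ≤ m / r := by gcongr
  linarith

theorem integrableOn_drift_mul_weight (hm : 1 ≤ m) (hα : 1 ≤ α) :
    IntegrableOn (fun r => radialDrift m α r * radialWeight m α r) (Ioi 0) := by
  have h1 := integrableOn_rpow_mul_radialWeight (m := m) (p := α - 1) (α := α)
    (by linarith) (by linarith)
  have h2 := (integrableOn_rpow_mul_radialWeight (m := m) (p := -1) (α := α)
    (by linarith) (by linarith)).const_mul m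
  refine (IntegrableOn.fun_sub h1 h2).congr_fun (fun r hr => ?_) measurableSet_Ioi
  simp only [radialDrift, Real.rpow_neg_one]
  ring

theorem integral_Ioi_drift_mul_weight (hm : 1 ≤ m) (hα : 1 ≤ α) {r : ℝ} (hr : 0 < r) :
    ∫ s in Ioi r, radialDrift m α s * radialWeight m α s = radialWeight m α r := by
  have hα0 : 0 < α := by linarith
  have := integral_Ioi_of_hasDerivAt_of_tendsto' (a := r) (m := 0)
    (fun x hx => (hasDerivAt_radialWeight (m := m) hα0.ne' (hr.trans_le hx)).neg)
    (by simpa using (integrableOn_drift_mul_weight hm hα).mono_set (Ioi_subset_Ioi hr.le))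
    (neg_zero (G := ℝ) ▸ (tendsto_radialWeight_atTop (m := m) hα0).neg)
  simpa using this

theorem integral_Ioc_add_Ioi {k : ℝ → ℝ} (hk : IntegrableOn k (Ioi 0)) {r : ℝ} (hr : 0 < r) :
    (∫ s in Ioc 0 r, k s) + ∫ s in Ioi r, k s = ∫ s in Ioi 0, k s := by
  rw [← Ioc_union_Ioi_eq_Ioi hr.le, setIntegral_union Ioc_disjoint_Ioi_same measurableSet_Ioi
    (hk.mono_set Ioc_subset_Ioi_self) (hk.mono_set (Ioi_subset_Ioi hr.le))]

theorem integral_Ioc_drift_mul_weight (hm : 1 ≤ m) (hα : 1 ≤ α) {r : ℝ} (hr : 0 < r) :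
    ∫ s in Ioc 0 r, radialDrift m α s * radialWeight m α s = -radialWeight m α r := by
  have hα0 : 0 < α := by linarith
  have h1 := integral_Ioi_deriv_eq_zero (fun r hr => hasDerivAt_radialWeight (m := m) hα0.ne' hr)
    (integrableOn_drift_mul_weight hm hα).neg (tendsto_radialWeight_zero (by linarith) hα0)
    (tendsto_radialWeight_atTop hα0)
  rw [integral_neg, neg_eq_zero] at h1
  have h2 := integral_Ioc_add_Ioi (integrableOn_drift_mul_weight hm hα) hr
  rw [h1, integral_Ioi_drift_mul_weight hm hα hr] at h2
  linarith

/-- The mass to the left, or to the right, of `r` is controlled by the drift at `r`. -/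
theorem abs_drift_mul_integral_le (hm : 1 ≤ m) (hα : 1 ≤ α) {g : ℝ → ℝ} {C : ℝ}
    (hg : ∀ r, 0 < r → |g r| ≤ C)
    (hgi : IntegrableOn (fun r => g r * radialWeight m α r) (Ioi 0))
    (hg0 : ∫ r in Ioi 0, g r * radialWeight m α r = 0) {r : ℝ} (hr : 0 < r) :
    |radialDrift m α r| * |∫ s in Ioc 0 r, g s * radialWeight m α s| ≤
      C * radialWeight m α r := by
  have hC : 0 ≤ C := (abs_nonneg _).trans (hg r hr)
  have hi := integrableOn_drift_mul_weight hm hα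
  have hiw := integrableOn_radialWeight (m := m) (α := α) (by linarith) (by linarith)
  have hgen : ∀ S : Set ℝ, S ⊆ Ioi 0 → MeasurableSet S →
      |∫ s in S, g s * radialWeight m α s| ≤ ∫ s in S, C * radialWeight m α s := by
    intro S hS hSm
    refine (abs_integral_le_integral_abs).trans ?_
    refine setIntegral_mono_on (hgi.mono_set hS).abs ((hiw.mono_set hS).const_mul C) hSm
      fun s hs => ?_
    have hs0 : 0 < s := hS hs
    rw [abs_mul, abs_of_pos (radialWeight_pos hs0)]
    exact mul_le_mul_of_nonneg_right (hg s hs0) (radialWeight_pos hs0).le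
  -- The drift `u` is increasing and `u w = -w'`. Where `u r ≤ 0`, `|u r|` is at most `|u s|` for
  -- all `s ≤ r`, so it can enter the integral over `(0, r]`. Where `u r ≥ 0` the same works on `(r,
  -- ∞)`, and the zero mean exchanges the two integrals up to sign.
  rcases le_total (radialDrift m α r) 0 with hu | hu
  · have hS : Ioc 0 r ⊆ Ioi 0 := Ioc_subset_Ioi_self
    calc |radialDrift m α r| * |∫ s in Ioc 0 r, g s * radialWeight m α s|
        ≤ |radialDrift m α r| * ∫ s in Ioc 0 r, C * radialWeight m α s := by
          gcongr; exact hgen _ hS measurableSet_Ioc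
      _ = ∫ s in Ioc 0 r, C * (-radialDrift m α r * radialWeight m α s) := by
          rw [← integral_const_mul, abs_of_nonpos hu]; congr 1; ext s; ring
      _ ≤ ∫ s in Ioc 0 r, C * (-(radialDrift m α s * radialWeight m α s)) := by
          refine setIntegral_mono_on (((hiw.mono_set hS).const_mul _).const_mul C)
            ((hi.mono_set hS).neg.const_mul C) measurableSet_Ioc fun s hs => ?_
          have h1 := radialDrift_mono (m := m) (by linarith) hα hs.1 hs.2
          rw [← neg_mul]
          have := (radialWeight_pos (m := m) (α := α) hs.1).le
          gcongr
      _ = C * radialWeight m α r := by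
          rw [integral_const_mul, integral_neg, integral_Ioc_drift_mul_weight hm hα hr, neg_neg]
  · have hS : Ioi r ⊆ Ioi 0 := Ioi_subset_Ioi hr.le
    have h0 : |∫ s in Ioc 0 r, g s * radialWeight m α s| =
        |∫ s in Ioi r, g s * radialWeight m α s| := by
      have := integral_Ioc_add_Ioi hgi hr
      rw [hg0] at this
      rw [eq_neg_of_add_eq_zero_left this, abs_neg]
    rw [h0]
    calc |radialDrift m α r| * |∫ s in Ioi r, g s * radialWeight m α s|
        ≤ |radialDrift m α r| * ∫ s in Ioi r, C * radialWeight m α s := by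
          gcongr; exact hgen _ hS measurableSet_Ioi
      _ = ∫ s in Ioi r, C * (radialDrift m α r * radialWeight m α s) := by
          rw [← integral_const_mul, abs_of_nonneg hu]; congr 1; ext s; ring
      _ ≤ ∫ s in Ioi r, C * (radialDrift m α s * radialWeight m α s) := by
          refine setIntegral_mono_on (((hiw.mono_set hS).const_mul _).const_mul C)
            ((hi.mono_set hS).const_mul C) measurableSet_Ioi fun s hs => ?_
          have h1 := radialDrift_mono (m := m) (by linarith) hα hr (le_of_lt hs)
          have := (radialWeight_pos (m := m) (α := α) (hr.trans hs)).le
          gcongr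
      _ = C * radialWeight m α r := by
          rw [integral_const_mul, integral_Ioi_drift_mul_weight hm hα hr]

/-- A bounded centered function is `h' - u h` for a regular `h`, where `u` is the drift. -/
theorem exists_primitive (hm : 1 ≤ m) (hα : 1 ≤ α) {g : ℝ → ℝ} {C : ℝ}
    (hg : ∀ r, 0 < r → |g r| ≤ C) (hgc : ContinuousOn g (Ioi 0))
    (hg0 : ∫ r in Ioi 0, g r * radialWeight m α r = 0) :
    ∃ h, IsBoundedLipZero h ∧
      ∀ r, 0 < r → HasDerivAt h (g r + radialDrift m α r * h r) r := by
  have hα0 : 0 < α := by linarith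
  have hC : 0 ≤ C := (abs_nonneg _).trans (hg 1 one_pos)
  have hgi : IntegrableOn (fun r => g r * radialWeight m α r) (Ioi 0) :=
    IntegrableOn.bdd_mul_Ioi (integrableOn_radialWeight (by linarith) hα0) hgc.aesm_Ioi hg
  -- The equation `h' - u h = g` reads `(h w)' = g w`; integrating from `0` selects the solution
  -- regular at the origin.
  set h : ℝ → ℝ := fun r => (∫ s in (0 : ℝ)..r, g s * radialWeight m α s) / radialWeight m α r
    with hh
  have hd : ∀ r, 0 < r → HasDerivAt h (g r + radialDrift m α r * h r) r := by
    intro r hr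
    have hcont : ContinuousOn (fun r => g r * radialWeight m α r) (Ioi 0) :=
      hgc.mul continuousOn_radialWeight
    have h1 : HasDerivAt (fun r => ∫ s in (0 : ℝ)..r, g s * radialWeight m α s)
        (g r * radialWeight m α r) r := by
      refine intervalIntegral.integral_hasDerivAt_right ?_ ?_ ?_
      · rw [intervalIntegrable_iff_integrableOn_Ioc_of_le hr.le]
        exact hgi.mono_set Ioc_subset_Ioi_self
      · exact hcont.stronglyMeasurableAtFilter isOpen_Ioi r hr
      · exact hcont.continuousAt (Ioi_mem_nhds hr)
    have hw := radialWeight_pos (m := m) (α := α) hr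
    refine (h1.div (hasDerivAt_radialWeight hα0.ne' hr) hw.ne').congr_deriv ?_
    simp only [hh]
    field_simp
    ring
  have hu : ∀ r, 0 < r → |radialDrift m α r| * |h r| ≤ C := by
    intro r hr
    have hw := radialWeight_pos (m := m) (α := α) hr
    have h1 := abs_drift_mul_integral_le hm hα hg hgi hg0 hr
    simp only [hh]
    rw [abs_div, abs_of_pos hw, intervalIntegral.integral_of_le hr.le, ← mul_div_assoc,
      div_le_iff₀ hw]
    exact h1
  have hcont : ContinuousOn h (Ioi 0) := fun r hr => (hd r hr).continuousAt.continuousWithinAt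
  -- near zero
  have hsmall : ∀ r, 0 < r → r ≤ 1 / 2 → |h r| ≤ 2 * C * r := by
    intro r hr hr1
    have h1 : r ^ (α - 1) ≤ 1 := Real.rpow_le_one hr.le (by linarith) (by linarith)
    have h2 : 1 / r ≤ m / r := by gcongr
    have h3 : 2 ≤ 1 / r := by rw [le_div_iff₀ hr]; linarith
    -- Near `0` the drift is at most `1 - 1 / r`, hence at most `-1 / (2 r)` for `r ≤ 1 / 2`; with
    -- `|u h| ≤ C` this gives `h = O(r)`.
    have h4 : 1 / (2 * r) ≤ |radialDrift m α r| := by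
      rw [abs_of_nonpos (by unfold radialDrift; linarith), radialDrift]
      have : 1 / (2 * r) = 1 / r / 2 := by field_simp
      linarith
    have h5 := (mul_le_mul_of_nonneg_right h4 (abs_nonneg (h r))).trans (hu r hr)
    rw [one_div_mul_eq_div, div_le_iff₀ (by positivity)] at h5
    linarith
  have hlarge : ∀ r, 2 * m ≤ r → |h r| ≤ 2 * C := by
    intro r hr
    have hr0 : 0 < r := by linarith
    have h1 : 1 ≤ r ^ (α - 1) := Real.one_le_rpow (by linarith) (by linarith)
    have h2 : m / r ≤ 1 / 2 := by rw [div_le_iff₀ hr0]; linarith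
    have h4 : 1 / 2 ≤ |radialDrift m α r| := by
      rw [abs_of_nonneg (by unfold radialDrift; linarith), radialDrift]
      linarith
    have h5 := (mul_le_mul_of_nonneg_right h4 (abs_nonneg (h r))).trans (hu r hr0)
    linarith
  obtain ⟨K, hK⟩ := (isCompact_Icc (a := (1 / 2 : ℝ)) (b := 2 * m)).exists_bound_of_continuousOn
    (hcont.mono fun r hr => (by norm_num : (0 : ℝ) < 1 / 2).trans_le hr.1)
  have hK0 : 0 ≤ K := (norm_nonneg _).trans (hK (1 / 2) ⟨le_rfl, by linarith⟩)
  have hb : ∀ r, 0 < r → |h r| ≤ 2 * C + K ∧ |h r| ≤ (4 * C + 2 * K) * r := by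
    intro r hr
    rcases le_total r (1 / 2) with h1 | h1
    · have := hsmall r hr h1
      constructor <;> nlinarith
    · rcases le_total r (2 * m) with h2 | h2
      · have := hK r ⟨h1, h2⟩
        rw [Real.norm_eq_abs] at this
        constructor <;> nlinarith
      · have := hlarge r h2
        constructor <;> nlinarith
  refine ⟨h, ⟨⟨max (2 * C + K) (2 * C), fun r hr => ⟨(hd r hr).differentiableAt,
    (hb r hr).1.trans (le_max_left _ _), ?_⟩⟩, _, fun r hr => (hb r hr).2⟩, hd⟩
  rw [(hd r hr).deriv]
  refine le_trans ?_ (le_max_right _ _)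
  calc |g r + radialDrift m α r * h r| ≤ |g r| + |radialDrift m α r * h r| := abs_add_le _ _
    _ ≤ C + C := add_le_add (hg r hr) (by rw [abs_mul]; exact hu r hr)
    _ = 2 * C := by ring

theorem integral_radialWeight_pos (hm : -1 < m) (hα : 0 < α) :
    0 < ∫ r in Ioi 0, radialWeight m α r := by
  refine (setIntegral_pos_iff_support_of_nonneg_ae ?_ (integrableOn_radialWeight hm hα)).2 ?_
  · filter_upwards [ae_restrict_mem measurableSet_Ioi] with r hr using (radialWeight_pos hr).le
  · have : Function.support (radialWeight m α) ∩ Ioi 0 = Ioi 0 :=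
      inter_eq_right.2 fun r hr => (radialWeight_pos hr).ne'
    simp [this]

/-- The intertwining between the diffusion and the Schrödinger operator of its derivative: a lower
bound for the latter is a Poincaré constant for the former. -/
theorem RadialSchrodinger.radialPoincare (hm : 1 ≤ m) (hα : 1 ≤ α) {l : ℝ} (hl : 0 < l)
    (hE : RadialSchrodinger m α l) : RadialPoincare m α l := by
  intro f hf
  have hα0 : 0 < α := by linarith
  have iw := integrableOn_radialWeight (m := m) (α := α) (by linarith) hα0
  have hM := integral_radialWeight_pos (m := m) (α := α) (by linarith) hα0
  set M := ∫ r in Ioi 0, radialWeight m α r with hMdef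
  set a := (∫ r in Ioi 0, f r * radialWeight m α r) / M with ha
  have hfa : ∫ r in Ioi 0, f r * radialWeight m α r = a * M := by rw [ha]; field_simp
  have if1 := hf.integrableOn_mul iw
  have if2 := hf.integrableOn_sq_mul iw
  have ifd2 := hf.integrableOn_deriv_sq_mul iw
  obtain ⟨C, hC⟩ := id hf
  have hg0 : ∫ r in Ioi 0, (f r - a) * radialWeight m α r = 0 := by
    have : ∀ r, (f r - a) * radialWeight m α r =
        f r * radialWeight m α r - a * radialWeight m α r := fun r => by ring
    simp_rw [this]
    rw [integral_sub if1 (iw.const_mul a), integral_const_mul, hfa, ← hMdef, sub_self]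
  have hgb : ∀ r, 0 < r → |f r - a| ≤ C + |a| := fun r hr =>
    (abs_sub _ _).trans (add_le_add (hC r hr).2.1 le_rfl)
  -- Here `h` plays the role of the derivative of a solution `G` of the Poisson equation `G'' - u G'
  -- = f - a`.
  obtain ⟨h, hh, hd⟩ := exists_primitive hm hα hgb (hf.continuousOn.sub continuousOn_const) hg0
  have ih2 := hh.1.integrableOn_sq_mul iw
  have hvar : ∫ r in Ioi 0, (f r - a) ^ 2 * radialWeight m α r =
      (∫ r in Ioi 0, f r ^ 2 * radialWeight m α r) - a ^ 2 * M := by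
    have : ∀ r, (f r - a) ^ 2 * radialWeight m α r =
        f r ^ 2 * radialWeight m α r - (2 * a * (f r * radialWeight m α r) -
          a ^ 2 * radialWeight m α r) := fun r => by ring
    simp_rw [this]
    rw [integral_sub if2 (IntegrableOn.fun_sub (if1.const_mul _) (iw.const_mul _)),
      integral_sub (if1.const_mul _) (iw.const_mul _), integral_const_mul, integral_const_mul, hfa,
      ← hMdef]
    ring
  -- Bochner
  have h1 : l * (∫ r in Ioi 0, h r ^ 2 * radialWeight m α r) ≤
      ∫ r in Ioi 0, (f r - a) ^ 2 * radialWeight m α r := by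
    refine (hE h hh).trans_eq ?_
    rw [← hh.integral_sq_sub_drift hm hα]
    refine setIntegral_congr_fun measurableSet_Ioi fun r hr => ?_
    simp only [(hd r hr).deriv]
    ring
  -- integration by parts
  have ig2 : IntegrableOn (fun r => (f r - a) ^ 2 * radialWeight m α r) (Ioi 0) := by
    have := IntegrableOn.fun_sub if2
      (IntegrableOn.fun_sub (if1.const_mul (2 * a)) (iw.const_mul (a ^ 2)))
    refine this.congr_fun (fun r _ => ?_) measurableSet_Ioi
    simp only []; ring
  have ifh : IntegrableOn (fun r => deriv f r * (h r * radialWeight m α r)) (Ioi 0) :=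
    hf.integrableOn_deriv_mul (hh.1.integrableOn_mul iw)
  have ifg : IntegrableOn (fun r => (f r - a) * ((f r - a) * radialWeight m α r)) (Ioi 0) := by
    refine ig2.congr_fun (fun r _ => ?_) measurableSet_Ioi
    simp only []; ring
  obtain ⟨D, hD⟩ := id hh.1
  have hlim : ∀ l : Filter ℝ, (∀ᶠ r in l, 0 < r) → Tendsto (radialWeight m α) l (𝓝 0) →
      Tendsto (fun r => (f r - a) * (h r * radialWeight m α r)) l (𝓝 0) := by
    intro l hl hw
    have h2 : Tendsto (fun r => (C + |a|) * (D * radialWeight m α r)) l (𝓝 0) := by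
      simpa using (hw.const_mul D).const_mul (C + |a|)
    refine squeeze_zero_norm' ?_ h2
    filter_upwards [hl] with r hr
    have hw0 := (radialWeight_pos (m := m) (α := α) hr)
    rw [Real.norm_eq_abs, abs_mul, abs_mul, abs_of_pos hw0]
    have h3 := hgb r hr
    have h4 := (hD r hr).2.1
    have h5 : 0 ≤ C + |a| := (abs_nonneg _).trans h3
    gcongr
  have h2 := integral_Ioi_deriv_eq_zero
    (F := fun r => (f r - a) * (h r * radialWeight m α r))
    (F' := fun r => deriv f r * (h r * radialWeight m α r) +
      (f r - a) * ((f r - a) * radialWeight m α r)) (fun r hr => by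
      refine (((hC r hr).1.hasDerivAt.sub_const a).mul ((hd r hr).mul
        (hasDerivAt_radialWeight hα0.ne' hr))).congr_deriv ?_
      simp only [Pi.mul_apply]
      ring)
    (IntegrableOn.fun_add ifh ifg)
    (hlim _ self_mem_nhdsWithin (tendsto_radialWeight_zero (by linarith) hα0))
    (hlim _ (eventually_gt_atTop 0) (tendsto_radialWeight_atTop hα0))
  rw [integral_add ifh ifg] at h2
  -- Expanding `∫ (f' + l h) ^ 2 w ≥ 0` and inserting `∫ (f - a) ^ 2 w = -∫ f' h w`. Since `l ∫ h ^
  -- 2 w ≤ ∫ (f - a) ^ 2 w`, the last term costs at most one of the two copies of `l ∫ (f - a) ^ 2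
  -- w`.
  have h3 : 2 * l * ∫ r in Ioi 0, (f r - a) * ((f r - a) * radialWeight m α r) ≤
      (∫ r in Ioi 0, deriv f r ^ 2 * radialWeight m α r) +
      l ^ 2 * ∫ r in Ioi 0, h r ^ 2 * radialWeight m α r := by
    have h4 : 0 ≤ ∫ r in Ioi 0, (deriv f r ^ 2 * radialWeight m α r +
        (2 * l * (deriv f r * (h r * radialWeight m α r)) +
          l ^ 2 * (h r ^ 2 * radialWeight m α r))) := by
      refine setIntegral_nonneg measurableSet_Ioi fun r hr => ?_
      have hw0 := (radialWeight_pos (m := m) (α := α) hr).le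
      have : 0 ≤ (deriv f r + l * h r) ^ 2 * radialWeight m α r := by positivity
      linarith
    rw [integral_add ifd2 (IntegrableOn.fun_add (ifh.const_mul _) (ih2.const_mul _)),
      integral_add (ifh.const_mul _) (ih2.const_mul _), integral_const_mul, integral_const_mul] at h4
    have h5 : ∫ r in Ioi 0, (f r - a) * ((f r - a) * radialWeight m α r) =
      -∫ r in Ioi 0, deriv f r * (h r * radialWeight m α r) := by linarith
    rw [h5]
    linarith
  have h6 : ∫ r in Ioi 0, (f r - a) * ((f r - a) * radialWeight m α r) =
      ∫ r in Ioi 0, (f r - a) ^ 2 * radialWeight m α r := by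
    congr 1; ext r; ring
  rw [h6] at h3
  have h7 : l * ∫ r in Ioi 0, (f r - a) ^ 2 * radialWeight m α r ≤
      ∫ r in Ioi 0, deriv f r ^ 2 * radialWeight m α r := by
    nlinarith
  rw [hvar] at h7
  rw [hfa]
  have h8 := mul_le_mul_of_nonneg_left h7 hM.le
  nlinarith

end Poincare

/-! ### Second moments, and the Hardy inequality for `α ≤ 2` -/

section Moments

open Set

/-! ### Ratios of values of the Gamma function -/

/-- Log-convexity of Gamma between `y` and `y + 1`, together with `Γ(y + 1) = y Γ(y)`. -/
theorem Gamma_add_le {y s : ℝ} (hy : 0 < y) (hs0 : 0 ≤ s) (hs1 : s ≤ 1) :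
    Real.Gamma (y + s) ≤ y ^ s * Real.Gamma y := by
  rcases hs0.eq_or_lt with rfl | hs0
  · simp
  rcases hs1.eq_or_lt with rfl | hs1
  · rw [Real.Gamma_add_one hy.ne', Real.rpow_one]
  have h := Real.Gamma_mul_add_mul_le_rpow_Gamma_mul_rpow_Gamma hy (by linarith : 0 < y + 1)
    (sub_pos.2 hs1) hs0 (by ring)
  have hG := Real.Gamma_pos_of_pos hy
  rw [Real.Gamma_add_one hy.ne', Real.mul_rpow hy.le hG.le, mul_left_comm, ← Real.rpow_add hG,
    sub_add_cancel, Real.rpow_one] at h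
  convert! h using 2
  ring

/-- The upper bound read from the other end: `y` is reached from `y + s - 1` by a step `1 - s`, and
`Γ(y + s) = (y + s - 1) Γ(y + s - 1)`. -/
theorem le_Gamma_add {y s : ℝ} (hys : 0 < y + s - 1) (hs0 : 0 ≤ s) (hs1 : s ≤ 1) :
    (y + s - 1) ^ s * Real.Gamma y ≤ Real.Gamma (y + s) := by
  have h := Gamma_add_le hys (sub_nonneg.2 hs1) (by linarith : 1 - s ≤ 1)
  have h2 : Real.Gamma (y + s) = (y + s - 1) * Real.Gamma (y + s - 1) := by
    rw [← Real.Gamma_add_one hys.ne']; congr 1; ring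
  rw [show y + s - 1 + (1 - s) = y by ring] at h
  calc (y + s - 1) ^ s * Real.Gamma y
      ≤ (y + s - 1) ^ s * ((y + s - 1) ^ (1 - s) * Real.Gamma (y + s - 1)) := by gcongr
    _ = Real.Gamma (y + s) := by
      rw [← mul_assoc, ← Real.rpow_add hys, h2]; norm_num

/-- The mean of `r ^ 2` under the radial law of dimension `n`. -/
noncomputable def secondMoment (n α : ℝ) : ℝ :=
  α ^ (2 / α) * Real.Gamma ((n + 2) / α) / Real.Gamma (n / α)

theorem secondMoment_pos {n α : ℝ} (hn : 0 < n) (hα : 0 < α) : 0 < secondMoment n α := by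
  unfold secondMoment
  have := Real.Gamma_pos_of_pos (div_pos hn hα)
  have := Real.Gamma_pos_of_pos (div_pos (by linarith : 0 < n + 2) hα)
  positivity

/-- The bounds on the second moment, for `1 ≤ α ≤ 2`. -/
theorem secondMoment_bounds_of_le_two {n α : ℝ} (hn : 0 < n) (hα : 1 ≤ α) (hα2 : α ≤ 2) :
    n * (n + 2 - α) ^ (2 / α - 1) ≤ secondMoment n α ∧
      secondMoment n α ≤ n * (n + α) ^ (2 / α - 1) := by
  have hα0 : 0 < α := by linarith
  set s := 2 / α - 1 with hs
  have hsα : α * s = 2 - α := by rw [hs]; field_simp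
  have hs0 : 0 ≤ s := by rw [hs, sub_nonneg, le_div_iff₀ hα0]; linarith
  have hs1 : s ≤ 1 := by rw [hs, sub_le_iff_le_add, div_le_iff₀ hα0]; linarith
  have hx : 0 < n / α := by positivity
  have hG := Real.Gamma_pos_of_pos hx
  -- For `α ≤ 2` the shift `2 / α` lies in `[1, 2]`: one unit step by the functional equation and a
  -- fractional step `s` by log-convexity.
  have e1 : (n + 2) / α = n / α + 1 + s := by rw [hs]; field_simp; ring
  have e2 : α ^ (2 / α) = α * α ^ s := by
    rw [mul_comm, ← Real.rpow_add_one hα0.ne', hs, sub_add_cancel]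
  have e3 : α ^ s * (n / α + s) ^ s = (n + 2 - α) ^ s := by
    rw [← Real.mul_rpow hα0.le (by positivity), mul_add, hsα, mul_div_cancel₀ _ hα0.ne',
      add_sub_assoc]
  have e4 : α ^ s * (n / α + 1) ^ s = (n + α) ^ s := by
    rw [← Real.mul_rpow hα0.le (by positivity), mul_add, mul_one, mul_div_cancel₀ _ hα0.ne']
  unfold secondMoment
  rw [e1, e2, le_div_iff₀ hG, div_le_iff₀ hG]
  constructor
  · have h := le_Gamma_add (y := n / α + 1) (s := s) (by linarith) hs0 hs1
    rw [Real.Gamma_add_one hx.ne', show n / α + 1 + s - 1 = n / α + s by ring] at h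
    calc n * (n + 2 - α) ^ s * Real.Gamma (n / α)
        = α * α ^ s * ((n / α + s) ^ s * (n / α * Real.Gamma (n / α))) := by
          rw [← e3]; field_simp
      _ ≤ _ := by gcongr
  · have h := Gamma_add_le (y := n / α + 1) (s := s) (by linarith) hs0 hs1
    rw [Real.Gamma_add_one hx.ne'] at h
    calc _ ≤ α * α ^ s * ((n / α + 1) ^ s * (n / α * Real.Gamma (n / α))) := by gcongr
      _ = _ := by rw [← e4]; field_simp

/-- For `α ≥ 2` the shift `2 / α` is itself a fractional step. The upper bound interpolates from `n
/ α` up to `(n + 2) / α`; the lower bound interpolates from there up to `n / α + 1`. -/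
theorem secondMoment_bounds_of_two_le {n α : ℝ} (hn : 0 < n) (hα2 : 2 ≤ α) :
    n * (n + 2) ^ (2 / α - 1) ≤ secondMoment n α ∧ secondMoment n α ≤ n ^ (2 / α) := by
  have hα0 : 0 < α := by linarith
  set s := 2 / α with hs
  have hsα : α * s = 2 := by rw [hs]; field_simp
  have hs0 : 0 ≤ s := by positivity
  have hs1 : s ≤ 1 := by rw [hs, div_le_iff₀ hα0]; linarith
  have hx : 0 < n / α := by positivity
  have hG := Real.Gamma_pos_of_pos hx
  have e1 : (n + 2) / α = n / α + s := by rw [hs]; field_simp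
  have e3 : α ^ (s - 1) * (n / α + s) ^ (s - 1) = (n + 2) ^ (s - 1) := by
    rw [← Real.mul_rpow hα0.le (by positivity), mul_add, hsα, mul_div_cancel₀ _ hα0.ne']
  have e4 : α ^ s * (n / α) ^ s = n ^ s := by
    rw [← Real.mul_rpow hα0.le (by positivity), mul_div_cancel₀ _ hα0.ne']
  unfold secondMoment
  rw [e1, le_div_iff₀ hG, div_le_iff₀ hG]
  constructor
  · have hy : 0 < n / α + s := by positivity
    have h := Gamma_add_le (y := n / α + s) (s := 1 - s) hy (by linarith) (by linarith)
    rw [show n / α + s + (1 - s) = n / α + 1 by ring, Real.Gamma_add_one hx.ne'] at h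
    have e5 : (n / α + s) ^ (s - 1) * (n / α + s) ^ (1 - s) = 1 := by
      rw [← Real.rpow_add hy]; norm_num
    calc n * (n + 2) ^ (s - 1) * Real.Gamma (n / α)
        = α ^ s * ((n / α + s) ^ (s - 1) * (n / α * Real.Gamma (n / α))) := by
          rw [← e3, Real.rpow_sub_one hα0.ne']; field_simp
      _ ≤ α ^ s * ((n / α + s) ^ (s - 1) * ((n / α + s) ^ (1 - s) * Real.Gamma (n / α + s))) := by
          gcongr
      _ = _ := by rw [← mul_assoc ((n / α + s) ^ (s - 1)), e5, one_mul]
  · have h := Gamma_add_le hx hs0 hs1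
    calc _ ≤ α ^ s * ((n / α) ^ s * Real.Gamma (n / α)) := by gcongr
      _ = _ := by rw [← e4]; ring

/-- For `α ≤ 2`, Bernoulli's inequality gives `(n + α) ^ s ≤ n ^ s (1 + s α / n)` with `s = 2 / α -
1`, and `s α = 2 - α ≤ 1`. For `α ≥ 2` the bound `n ^ (2 / α)` is already enough. -/
theorem secondMoment_le {n α : ℝ} (hn : 0 < n) (hα : 1 ≤ α) :
    secondMoment n α ≤ (n + 1) * n ^ (2 / α - 1) := by
  have hα0 : 0 < α := by linarith
  rcases le_total α 2 with h2 | h2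
  · refine (secondMoment_bounds_of_le_two hn hα h2).2.trans ?_
    have hs0 : 0 ≤ 2 / α - 1 := by rw [sub_nonneg, le_div_iff₀ hα0]; linarith
    have hs1 : 2 / α - 1 ≤ 1 := by rw [sub_le_iff_le_add, div_le_iff₀ hα0]; linarith
    have hsα : α * (2 / α - 1) = 2 - α := by field_simp
    have h3 : n + α = n * (1 + α / n) := by field_simp
    have h4 := rpow_one_add_le_one_add_mul_self (s := α / n)
      (by have : 0 ≤ α / n := by positivity
          linarith) hs0 hs1
    have h5 : n * (1 + (2 / α - 1) * (α / n)) ≤ n + 1 := by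
      have : n * (1 + (2 / α - 1) * (α / n)) = n + α * (2 / α - 1) := by field_simp
      rw [this, hsα]; linarith
    rw [h3, Real.mul_rpow hn.le (by positivity)]
    calc n * (n ^ (2 / α - 1) * (1 + α / n) ^ (2 / α - 1))
        ≤ n * (n ^ (2 / α - 1) * (1 + (2 / α - 1) * (α / n))) := by gcongr
      _ = n * (1 + (2 / α - 1) * (α / n)) * n ^ (2 / α - 1) := by ring
      _ ≤ _ := by gcongr
  · refine (secondMoment_bounds_of_two_le hn h2).2.trans ?_
    rw [Real.rpow_sub_one hn.ne', mul_div_assoc', le_div_iff₀ hn, mul_comm]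
    gcongr
    linarith

theorem le_secondMoment {n α : ℝ} (hn : 0 < n) (hα : 1 ≤ α) :
    n * n ^ (2 / α) / (n + 2) ≤ secondMoment n α := by
  have hα0 : 0 < α := by linarith
  rcases le_total α 2 with h2 | h2
  · refine le_trans ?_ (secondMoment_bounds_of_le_two hn hα h2).1
    have hs0 : 0 ≤ 2 / α - 1 := by rw [sub_nonneg, le_div_iff₀ hα0]; linarith
    have h3 : n ^ (2 / α) = n * n ^ (2 / α - 1) := by
      rw [Real.rpow_sub_one hn.ne']; field_simp
    have h4 : n ^ (2 / α - 1) ≤ (n + 2 - α) ^ (2 / α - 1) := by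
      apply Real.rpow_le_rpow hn.le (by linarith) hs0
    rw [h3, div_le_iff₀ (by positivity)]
    calc n * (n * n ^ (2 / α - 1)) ≤ n * ((n + 2) * (n + 2 - α) ^ (2 / α - 1)) := by
          gcongr; linarith
      _ = _ := by ring
  · refine le_trans ?_ (secondMoment_bounds_of_two_le hn h2).1
    rw [Real.rpow_sub_one (by positivity), mul_div_assoc']
    gcongr
    linarith

variable {m α : ℝ}

theorem integral_radialWeight (hm : -1 < m) (hα : 0 < α) :
    ∫ r in Ioi 0, radialWeight m α r = α ^ ((m + 1) / α) / α * Real.Gamma ((m + 1) / α) := by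
  have h := integral_rpow_mul_exp_neg_mul_rpow (b := 1 / α) hα hm (by positivity)
  have h2 : ∫ r in Ioi 0, radialWeight m α r =
      ∫ r in Ioi 0, r ^ m * Real.exp (-(1 / α) * r ^ α) := by
    refine setIntegral_congr_fun measurableSet_Ioi fun r _ => ?_
    simp only [radialWeight]
    congr 2; ring
  rw [h2, h, neg_div, Real.rpow_neg (by positivity), one_div, Real.inv_rpow hα.le, inv_inv]
  ring

theorem integral_sq_mul_radialWeight (hm : -1 < m) (hα : 0 < α) :
    ∫ r in Ioi 0, r ^ 2 * radialWeight m α r =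
      secondMoment (m + 1) α * ∫ r in Ioi 0, radialWeight m α r := by
  have h : ∫ r in Ioi 0, r ^ 2 * radialWeight m α r = ∫ r in Ioi 0, radialWeight (2 + m) α r := by
    refine setIntegral_congr_fun measurableSet_Ioi fun r hr => ?_
    rw [← rpow_mul_radialWeight 2 hr]
    norm_num
  rw [h, integral_radialWeight hm hα, integral_radialWeight (by linarith) hα, secondMoment]
  have hG := Real.Gamma_pos_of_pos (div_pos (by linarith : 0 < m + 1) hα)
  have e1 : α ^ ((2 + m + 1) / α) = α ^ (2 / α) * α ^ ((m + 1) / α) := by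
    rw [← Real.rpow_add hα]; congr 1; ring
  rw [e1, show 2 + m + 1 = m + 1 + 2 by ring]
  field_simp

/-- Barta's inequality leaves a combination of `r ^ (α - 2)`, which decreases, and `r ^ (2 (α -
1))`, which increases. The choice of `b` makes the weighted arithmetic-geometric mean inequality
remove all dependence on `r`; the resulting constant `β ^ s` is then compared with `m / secondMoment
(m + 1) α` through the lower Gamma bound. -/
theorem radialHardy_of_le_two (hm : 1 ≤ m) (hα : 1 ≤ α) (hα2 : α ≤ 2) :
    RadialHardy m α (m / secondMoment (m + 1) α) := by
  have hα0 : 0 < α := by linarith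
  set s := 2 / α - 1 with hs
  have hsα : α * s = 2 - α := by rw [hs]; field_simp
  have hs0 : 0 ≤ s := by rw [hs, sub_nonneg, le_div_iff₀ hα0]; linarith
  have hs1 : s ≤ 1 := by rw [hs, sub_le_iff_le_add, div_le_iff₀ hα0]; linarith
  set N := m + 1 + α with hN
  have hN0 : 0 < N := by linarith
  -- This makes the coefficient `1 - N b` of `r ^ (α - 2)` equal to `1 - s`, and the other
  -- coefficient `b - b ^ 2` equal to `s β`, so the weights are `1 - s` and `s`.
  set b := s / N with hb
  have hb1 : b < 1 := by rw [hb, div_lt_one hN0]; linarith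
  set β := (1 - b) / N with hβ
  have hβ0 : 0 < β := div_pos (by linarith) hN0
  have hc : m / secondMoment (m + 1) α ≤ β ^ s := by
    have h1 := (secondMoment_bounds_of_le_two (n := m + 1) (by linarith) hα hα2).1
    rw [← hs] at h1
    have hk : 0 < m + 1 + 2 - α := by linarith
    rw [div_le_iff₀ (secondMoment_pos (by linarith) hα0)]
    refine le_trans ?_ (mul_le_mul_of_nonneg_left h1 (by positivity))
    set X := β * (m + 1 + 2 - α) with hX
    have hX0 : 0 < X := by positivity
    have h2 : β ^ s * ((m + 1) * (m + 1 + 2 - α) ^ s) = (m + 1) * X ^ s := by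
      rw [hX, Real.mul_rpow hβ0.le hk.le]; ring
    rw [h2]
    -- After the Gamma bound the goal is `m ≤ (m + 1) X ^ s`. Bernoulli's inequality for `(1 / X) ^
    -- s` reduces it to `s m (1 / X - 1) ≤ 1`, which is this.
    have h3 : s * m ≤ X * (1 + s * m) := by
      have e1 : X = (N - s) * (m + 1 + 2 - α) / N ^ 2 := by rw [hX, hβ, hb]; field_simp
      -- With `k = 2 α - 2 + s`, the two facts `k s ≤ 1` and `k ≤ 1 + α` give `k + k s m ≤ 1 + α + m
      -- = N`.
      have e2 : (2 * α - 2 + s) * (1 + s * m) ≤ N := by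
        have p1 : (2 * α - 2 + s) * s ≤ 1 := by
          have : α = 2 / (1 + s) := by rw [hs]; field_simp; ring
          rw [this, ← sub_nonneg]
          have : 1 - (2 * (2 / (1 + s)) - 2 + s) * s = (1 - s) * (1 + s ^ 2) / (1 + s) := by
            field_simp; ring
          rw [this]
          have : 0 ≤ 1 - s := by linarith
          positivity
        have p2 : 2 * α - 2 + s ≤ 1 + α := by linarith
        nlinarith
      rw [e1, div_mul_eq_mul_div, le_div_iff₀ (by positivity)]
      have e3 : (N - s) * (m + 1 + 2 - α) = N ^ 2 - (2 * α - 2 + s) * N + s * (2 * α - 2) := by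
        rw [hN]; ring
      rw [e3]
      have e4 : 0 ≤ s * (2 * α - 2) * (1 + s * m) := by
        have : 0 ≤ 2 * α - 2 := by linarith
        positivity
      nlinarith
    have h4 := rpow_one_add_le_one_add_mul_self (s := 1 / X - 1)
      (by have : 0 ≤ 1 / X := by positivity
          linarith) hs0 hs1
    rw [add_sub_cancel, Real.div_rpow one_pos.le hX0.le, Real.one_rpow,
      div_le_iff₀ (Real.rpow_pos_of_pos hX0 s)] at h4
    have h5 : (1 + s * (1 / X - 1)) * m ≤ m + 1 := by
      have : (1 + s * (1 / X - 1)) * m = m + (s * m - s * m * X) / X := by field_simp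
      rw [this]
      gcongr
      rw [div_le_one hX0]
      linarith
    have hXs := Real.rpow_pos_of_pos hX0 s
    nlinarith
  intro h hh
  refine hh.barta hm hα (b := b) fun r hr => hc.trans ?_
  rw [← hN]
  have e1 : 1 - N * b = 1 - s := by rw [hb]; field_simp
  have e2 : b - b ^ 2 = s * β := by rw [hβ, hb]; field_simp
  rw [e1, e2]
  -- The powers of `r` cancel in the geometric mean because `(α - 2)(1 - s) + 2 (α - 1) s = α s - (2
  -- - α) = 0`.
  have h1 := Real.geom_mean_le_arith_mean2_weighted (sub_nonneg.2 hs1) hs0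
    (Real.rpow_pos_of_pos hr (α - 2)).le
    (mul_pos hβ0 (pow_pos (Real.rpow_pos_of_pos hr (α - 1)) 2)).le (by ring)
  have e3 : (r ^ (α - 2)) ^ (1 - s) * (β * (r ^ (α - 1)) ^ 2) ^ s = β ^ s := by
    have hr2 : (r ^ (α - 1)) ^ 2 = r ^ (2 * (α - 1)) := by
      rw [← Real.rpow_natCast, ← Real.rpow_mul hr.le]; congr 1; push_cast; ring
    rw [hr2, Real.mul_rpow hβ0.le (Real.rpow_pos_of_pos hr _).le, ← Real.rpow_mul hr.le,
      ← Real.rpow_mul hr.le, mul_left_comm, ← Real.rpow_add hr]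
    have : (α - 2) * (1 - s) + 2 * (α - 1) * s = 0 := by linear_combination hsα
    rw [this, Real.rpow_zero, mul_one]
  rw [e3] at h1
  linarith

end Moments

/-! ### Cauchy-Schwarz, the bootstrap for `α ≥ 2`, and the radial inequalities for all `α ≥ 1` -/

section Bootstrap

open Set

variable {m α : ℝ}

theorem IsBoundedLipZero.integrableOn_potential (hm : 1 ≤ m) (hα : 1 ≤ α) {h : ℝ → ℝ}
    (hh : IsBoundedLipZero h) :
    IntegrableOn (fun r => h r ^ 2 * (m / r ^ 2) * radialWeight m α r) (Ioi 0) ∧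
    IntegrableOn (fun r => h r ^ 2 * (m / r ^ 2 + (α - 1) * r ^ (α - 2)) * radialWeight m α r)
      (Ioi 0) := by
  constructor
  · simpa using (hh.integrableOn_vec hm hα (-m) 0).2.1
  · simpa using (hh.integrableOn_vec hm hα (-m) 1).2.1

/-- The Cauchy-Schwarz inequality for `h = (h / r) r`. -/
theorem IsBoundedLipZero.sq_integral_le (hm : 1 ≤ m) (hα : 1 ≤ α) {h : ℝ → ℝ}
    (hh : IsBoundedLipZero h) :
    m / secondMoment (m + 1) α * (∫ r in Ioi 0, h r * radialWeight m α r) ^ 2 ≤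
      (∫ r in Ioi 0, radialWeight m α r) *
        ∫ r in Ioi 0, h r ^ 2 * (m / r ^ 2) * radialWeight m α r := by
  have hα0 : 0 < α := by linarith
  have iw := integrableOn_radialWeight (m := m) (α := α) (by linarith) hα0
  have hM := integral_radialWeight_pos (m := m) (α := α) (by linarith) hα0
  have hsm := secondMoment_pos (n := m + 1) (by linarith) hα0
  have i1 := hh.1.integrableOn_mul iw
  have i2 := (hh.integrableOn_potential hm hα).1
  have i3 : IntegrableOn (fun r => r ^ 2 * radialWeight m α r) (Ioi 0) := by
    have := integrableOn_rpow_mul_radialWeight (m := m) (p := 2) (by linarith) hα0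
    simpa using this
  have key : ∀ t : ℝ, 0 ≤ (∫ r in Ioi 0, h r ^ 2 * (m / r ^ 2) * radialWeight m α r) +
      ((-2 * m * t) * (∫ r in Ioi 0, h r * radialWeight m α r) +
        (m * t ^ 2) * ∫ r in Ioi 0, r ^ 2 * radialWeight m α r) := by
    intro t
    rw [← integral_const_mul, ← integral_const_mul, ← integral_add (i1.const_mul _)
      (i3.const_mul _), ← integral_add i2 (IntegrableOn.fun_add (i1.const_mul _) (i3.const_mul _))]
    refine setIntegral_nonneg measurableSet_Ioi fun r hr => ?_
    have hr0 : (0 : ℝ) < r := hr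
    have hw := (radialWeight_pos (m := m) (α := α) hr0).le
    have e : 0 ≤ m * (h r / r - t * r) ^ 2 * radialWeight m α r := by positivity
    convert e using 1
    field_simp
    ring
  rw [integral_sq_mul_radialWeight (by linarith) hα0] at key
  set M := ∫ r in Ioi 0, radialWeight m α r
  set H := ∫ r in Ioi 0, h r * radialWeight m α r
  set X := ∫ r in Ioi 0, h r ^ 2 * (m / r ^ 2) * radialWeight m α r
  set S := secondMoment (m + 1) α
  -- The minimizer of the quadratic polynomial in `t`, where `S M` is the integral of `r ^ 2 w`.
  have h1 := key (H / (S * M))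
  have h2 : X + (-2 * m * (H / (S * M)) * H + m * (H / (S * M)) ^ 2 * (S * M)) =
      X - m / S * H ^ 2 / M := by
    field_simp; ring
  rw [h2, sub_nonneg, div_le_iff₀ hM] at h1
  linarith

/-- The Poincaré inequality applied to `h` itself controls `∫ h ^ 2 w` up to the square of the mean
of `h`, and Cauchy-Schwarz pays for this mean with the potential `m / r ^ 2`. Only the fraction `l /
c` of that potential is used, where `c = m / secondMoment (m + 1) α`; the unused part drives the
bootstrap. -/
theorem RadialPoincare.hardy_aux (hm : 1 ≤ m) (hα : 1 ≤ α) {l : ℝ} (hl : 0 ≤ l)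
    (hP : RadialPoincare m α l) {h : ℝ → ℝ} (hh : IsBoundedLipZero h) :
    l * (∫ r in Ioi 0, h r ^ 2 * radialWeight m α r) ≤
    (∫ r in Ioi 0, deriv h r ^ 2 * radialWeight m α r) + l / (m / secondMoment (m + 1) α) *
      ∫ r in Ioi 0, h r ^ 2 * (m / r ^ 2) * radialWeight m α r := by
  have hα0 : 0 < α := by linarith
  have hM := integral_radialWeight_pos (m := m) (α := α) (by linarith) hα0
  have hc : 0 < m / secondMoment (m + 1) α :=
    div_pos (by linarith) (secondMoment_pos (by linarith) hα0)
  have h1 := hP h hh.1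
  have h2 := mul_le_mul_of_nonneg_left (hh.sq_integral_le hm hα) (div_nonneg hl hc.le)
  rw [← mul_assoc, div_mul_cancel₀ _ hc.ne'] at h2
  refine le_of_mul_le_mul_left ?_ hM
  linarith

theorem RadialPoincare.radialHardy (hm : 1 ≤ m) (hα : 1 ≤ α)
    (hP : RadialPoincare m α (m / secondMoment (m + 1) α)) :
    RadialHardy m α (m / secondMoment (m + 1) α) := by
  intro h hh
  have hα0 : 0 < α := by linarith
  have hc : 0 < m / secondMoment (m + 1) α :=
    div_pos (by linarith) (secondMoment_pos (by linarith) hα0)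
  have := hP.hardy_aux hm hα hc.le hh
  rwa [div_self hc.ne', one_mul] at this

theorem RadialHardy.radialSchrodinger (hm : 1 ≤ m) (hα : 1 ≤ α) {l : ℝ}
    (hH : RadialHardy m α l) : RadialSchrodinger m α l := by
  intro h hh
  obtain ⟨i1, i2⟩ := hh.integrableOn_potential hm hα
  refine (hH h hh).trans (add_le_add le_rfl (setIntegral_mono_on i1 i2 measurableSet_Ioi
    fun r hr => ?_))
  have hr0 : (0 : ℝ) < r := hr
  have hw := (radialWeight_pos (m := m) (α := α) hr0).le
  have : 0 ≤ (α - 1) * r ^ (α - 2) := mul_nonneg (by linarith) (Real.rpow_pos_of_pos hr0 _).le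
  gcongr
  linarith

/-- A Poincaré constant improves as long as it is less than `m / secondMoment (m + 1) α`. -/
theorem RadialPoincare.improve (hm : 1 ≤ m) (hα : 2 ≤ α) {l δ : ℝ} (hl : 0 ≤ l)
    (hlc : l < m / secondMoment (m + 1) α) (hδ : δ ≤ 1) (hδ0 : 0 < δ)
    (hP : RadialPoincare m α l) :
    RadialPoincare m α (l + (1 - l / (m / secondMoment (m + 1) α)) * δ) := by
  have hα1 : 1 ≤ α := by linarith
  have hc : 0 < m / secondMoment (m + 1) α := hl.trans_lt hlc
  set c := m / secondMoment (m + 1) α with hcdef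
  have h0 : 0 < 1 - l / c := by rw [sub_pos, div_lt_one hc]; exact hlc
  refine RadialSchrodinger.radialPoincare hm hα1 (by positivity) fun h hh => ?_
  have h1 := hP.hardy_aux hm hα1 hl hh
  rw [← hcdef] at h1
  obtain ⟨i1, i2⟩ := hh.integrableOn_potential hm hα1
  have i3 := hh.1.integrableOn_sq_mul
    (integrableOn_radialWeight (m := m) (α := α) (by linarith) (by linarith))
  have h2 : ∫ r in Ioi 0, h r ^ 2 * (m / r ^ 2) * radialWeight m α r ≤
      ∫ r in Ioi 0, h r ^ 2 * (m / r ^ 2 + (α - 1) * r ^ (α - 2)) * radialWeight m α r := by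
    refine setIntegral_mono_on i1 i2 measurableSet_Ioi fun r hr => ?_
    have hr0 : (0 : ℝ) < r := hr
    have hw := (radialWeight_pos (m := m) (α := α) hr0).le
    have : 0 ≤ (α - 1) * r ^ (α - 2) := mul_nonneg (by linarith) (Real.rpow_pos_of_pos hr0 _).le
    gcongr
    linarith
  have h3 : ∫ r in Ioi 0, h r ^ 2 * radialWeight m α r ≤
      ∫ r in Ioi 0, h r ^ 2 * (m / r ^ 2 + (α - 1) * r ^ (α - 2)) * radialWeight m α r := by
    refine setIntegral_mono_on i3 i2 measurableSet_Ioi fun r hr => ?_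
    have hr0 : (0 : ℝ) < r := hr
    have hw := (radialWeight_pos (m := m) (α := α) hr0).le
    -- This is where `α ≥ 2` matters: `m / r ^ 2` is at least `1` for `r ≤ 1`, and `(α - 1) r ^ (α -
    -- 2)` is at least `1` for `r ≥ 1`.
    have h4 : 1 ≤ m / r ^ 2 + (α - 1) * r ^ (α - 2) := by
      have p1 : 0 ≤ m / r ^ 2 := by positivity
      have p2 : 0 ≤ (α - 1) * r ^ (α - 2) :=
        mul_nonneg (by linarith) (Real.rpow_pos_of_pos hr0 _).le
      rcases le_total r 1 with h5 | h5
      · have : 1 ≤ m / r ^ 2 := by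
          rw [le_div_iff₀ (by positivity)]; nlinarith
        linarith
      · have := Real.one_le_rpow h5 (by linarith : 0 ≤ α - 2)
        nlinarith
    calc h r ^ 2 * radialWeight m α r = h r ^ 2 * 1 * radialWeight m α r := by ring
      _ ≤ _ := by gcongr
  have h4 : 0 ≤ ∫ r in Ioi 0, h r ^ 2 * radialWeight m α r :=
    setIntegral_nonneg measurableSet_Ioi fun r hr => by
      have hw := (radialWeight_pos (m := m) (α := α) hr).le
      positivity
  have h5 : l / c * ∫ r in Ioi 0, h r ^ 2 * (m / r ^ 2) * radialWeight m α r ≤ l / c *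
      ∫ r in Ioi 0, h r ^ 2 * (m / r ^ 2 + (α - 1) * r ^ (α - 2)) * radialWeight m α r := by
    gcongr
  have h6 := mul_le_mul_of_nonneg_left h3 h0.le
  -- The fraction `l / c` of the potential gives back `l` by `hardy_aux`; the remaining fraction `1
  -- - l / c` of a potential that is at least `1` gives the gain.
  have h7 : (1 - l / c) * δ * (∫ r in Ioi 0, h r ^ 2 * radialWeight m α r) ≤
      (1 - l / c) * ∫ r in Ioi 0, h r ^ 2 * radialWeight m α r := by
    gcongr
    nlinarith
  linarith

theorem radialPoincare_zero : RadialPoincare m α 0 := by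
  intro f _
  rw [zero_mul]
  have hw : ∀ r ∈ Ioi (0 : ℝ), 0 ≤ radialWeight m α r := fun r hr => (radialWeight_pos hr).le
  refine mul_nonneg (setIntegral_nonneg measurableSet_Ioi hw)
    (setIntegral_nonneg measurableSet_Ioi fun r hr => mul_nonneg (sq_nonneg _) (hw r hr))

/-- A continuity argument: the admissible constants in `[0, c]` form a closed set containing `0`,
and its maximum cannot be below `c` since `RadialPoincare.improve` would exceed it. -/
theorem radialPoincare_of_two_le (hm : 1 ≤ m) (hα : 2 ≤ α) :
    RadialPoincare m α (m / secondMoment (m + 1) α) := by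
  set c := m / secondMoment (m + 1) α with hcdef
  have hc : 0 < c := div_pos (by linarith) (secondMoment_pos (by linarith) (by linarith))
  let S : Set ℝ := {l | RadialPoincare m α l} ∩ Icc 0 c
  have hS : IsClosed S := by
    refine IsClosed.inter ?_ isClosed_Icc
    simp only [RadialPoincare, ofPred_forall]
    exact isClosed_iInter fun f => isClosed_iInter fun _ =>
      isClosed_le (by fun_prop) continuous_const
  have hbdd : BddAbove S := ⟨c, fun l hl => hl.2.2⟩
  have hmem : sSup S ∈ S := hS.csSup_mem ⟨0, radialPoincare_zero, le_rfl, hc.le⟩ hbdd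
  rcases hmem.2.2.eq_or_lt with h | h
  · rw [← h]; exact hmem.1
  · exfalso
    -- The gain `δ = min 1 c` keeps the improved constant in `[0, c]`, because `(1 - l / c) c = c -
    -- l`.
    have h1 := hmem.1.improve hm hα hmem.2.1 h (min_le_left 1 c) (lt_min one_pos hc)
    rw [← hcdef] at h1
    set l := sSup S with hl
    have h0 : 0 < 1 - l / c := by rw [sub_pos, div_lt_one hc]; exact h
    have h2 : 0 < (1 - l / c) * min 1 c := mul_pos h0 (lt_min one_pos hc)
    have h3 : (1 - l / c) * min 1 c ≤ c - l := by
      calc _ ≤ (1 - l / c) * c := by gcongr; exact min_le_right _ _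
        _ = c - l := by field_simp
    have h4 := le_csSup hbdd (show l + (1 - l / c) * min 1 c ∈ S from
      ⟨h1, by linarith [hmem.2.1], by linarith⟩)
    rw [← hl] at h4
    linarith

/-- The order of deduction depends on `α`: Hardy gives Poincaré for `α ≤ 2`, and Poincaré gives
Hardy for `α ≥ 2`. -/
theorem radialHardy_radialPoincare (hm : 1 ≤ m) (hα : 1 ≤ α) :
    RadialHardy m α (m / secondMoment (m + 1) α) ∧
      RadialPoincare m α (m / secondMoment (m + 1) α) := by
  rcases le_total α 2 with h2 | h2
  · have h := radialHardy_of_le_two hm hα h2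
    exact ⟨h, (h.radialSchrodinger hm hα).radialPoincare hm hα
      (div_pos (by linarith) (secondMoment_pos (by linarith) (by linarith)))⟩
  · have h := radialPoincare_of_two_le hm h2
    exact ⟨h.radialHardy hm hα, h⟩

end Bootstrap

/-! ### The Gaussian Poincaré inequality -/

section GaussianLine

open Set Real

theorem integrable_gaussianWeight : Integrable fun t : ℝ => exp (-t ^ 2 / 2) := by
  have := integrable_exp_neg_mul_sq (b := 1 / 2) (by norm_num)
  refine this.congr (.of_forall fun t => ?_)
  simp only []; congr 1; ring

theorem integrable_mul_gaussianWeight : Integrable fun t : ℝ => t * exp (-t ^ 2 / 2) := by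
  have := integrable_mul_exp_neg_mul_sq (b := 1 / 2) (by norm_num)
  refine this.congr (.of_forall fun t => ?_)
  simp only []; congr 2; ring

theorem integrable_sq_mul_gaussianWeight : Integrable fun t : ℝ => t ^ 2 * exp (-t ^ 2 / 2) := by
  have := integrable_rpow_mul_exp_neg_mul_sq (b := 1 / 2) (s := 2) (by norm_num) (by norm_num)
  refine this.congr (.of_forall fun t => ?_)
  simp only [Real.rpow_two]; congr 2; ring

theorem hasDerivAt_gaussianWeight (t : ℝ) :
    HasDerivAt (fun t : ℝ => exp (-t ^ 2 / 2)) (-(t * exp (-t ^ 2 / 2))) t := by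
  have h : HasDerivAt (fun t : ℝ => -t ^ 2 / 2) (-t) t := by
    refine ((hasDerivAt_pow 2 t).neg.div_const 2).congr_deriv ?_
    norm_num
    ring
  refine h.exp.congr_deriv ?_
  ring

theorem tendsto_gaussianWeight_atTop : Tendsto (fun t : ℝ => exp (-t ^ 2 / 2)) atTop (𝓝 0) := by
  refine tendsto_exp_atBot.comp ?_
  have := (tendsto_pow_atTop (α := ℝ) (n := 2) (by norm_num)).atTop_div_const
    (by norm_num : (0 : ℝ) < 2)
  refine (tendsto_neg_atTop_atBot.comp this).congr fun t => ?_
  simp only [Function.comp]; ring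

theorem tendsto_gaussianWeight_atBot : Tendsto (fun t : ℝ => exp (-t ^ 2 / 2)) atBot (𝓝 0) := by
  refine (tendsto_gaussianWeight_atTop.comp tendsto_neg_atBot_atTop).congr fun t => ?_
  simp

theorem integral_Ioi_mul_gaussianWeight (t : ℝ) :
    ∫ s in Ioi t, s * exp (-s ^ 2 / 2) = exp (-t ^ 2 / 2) := by
  have h0 : Tendsto (fun t : ℝ => -exp (-t ^ 2 / 2)) atTop (𝓝 0) := by
    simpa using tendsto_gaussianWeight_atTop.neg
  have := integral_Ioi_of_hasDerivAt_of_tendsto' (a := t)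
    (fun x _ => (hasDerivAt_gaussianWeight x).neg)
    (by simpa using integrable_mul_gaussianWeight.integrableOn) h0
  simpa using this

theorem integral_Iic_mul_gaussianWeight (t : ℝ) :
    ∫ s in Iic t, s * exp (-s ^ 2 / 2) = -exp (-t ^ 2 / 2) := by
  have h0 : Tendsto (fun t : ℝ => -exp (-t ^ 2 / 2)) atBot (𝓝 0) := by
    simpa using tendsto_gaussianWeight_atBot.neg
  have := integral_Iic_of_hasDerivAt_of_tendsto' (a := t)
    (fun x _ => (hasDerivAt_gaussianWeight x).neg)
    (by simpa using integrable_mul_gaussianWeight.integrableOn) h0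
  simpa using this

theorem integrable_bdd_mul {X : Type*} [MeasurableSpace X] {μ : Measure X} {g k : X → ℝ}
    (hk : Integrable k μ) (hg : Measurable g) {C : ℝ} (hb : ∀ x, |g x| ≤ C) :
    Integrable (fun x => g x * k x) μ :=
  Integrable.bdd_mul hk hg.aestronglyMeasurable (.of_forall hb)

/-- The Gaussian analogue of `abs_drift_mul_integral_le`, with drift `t`: on the tail beyond `t`,
away from the origin, `|t| ≤ |s|`, and `s exp (-s ^ 2 / 2)` integrates exactly. The zero mean allows
the choice of tail. -/
theorem abs_mul_integral_Iic_le {g : ℝ → ℝ} (hgm : Measurable g) {C : ℝ} (hg : ∀ t, |g t| ≤ C)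
    (hg0 : ∫ t, g t * exp (-t ^ 2 / 2) = 0) (t : ℝ) :
    |t| * |∫ s in Iic t, g s * exp (-s ^ 2 / 2)| ≤ C * exp (-t ^ 2 / 2) := by
  have hC : 0 ≤ C := (abs_nonneg _).trans (hg 0)
  have hi := integrable_mul_gaussianWeight
  have hiw := integrable_gaussianWeight
  have hgi := integrable_bdd_mul hiw hgm hg
  have hgen : ∀ S : Set ℝ, MeasurableSet S →
      |∫ s in S, g s * exp (-s ^ 2 / 2)| ≤ ∫ s in S, C * exp (-s ^ 2 / 2) := by
    intro S hSm
    refine (abs_integral_le_integral_abs).trans ?_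
    refine setIntegral_mono_on hgi.integrableOn.abs (hiw.integrableOn.const_mul C) hSm
      fun s hs => ?_
    rw [abs_mul, abs_of_pos (exp_pos _)]
    exact mul_le_mul_of_nonneg_right (hg s) (exp_pos _).le
  rcases le_total t 0 with hu | hu
  · calc |t| * |∫ s in Iic t, g s * exp (-s ^ 2 / 2)|
        ≤ |t| * ∫ s in Iic t, C * exp (-s ^ 2 / 2) := by
          gcongr; exact hgen _ measurableSet_Iic
      _ = ∫ s in Iic t, C * (-t * exp (-s ^ 2 / 2)) := by
          rw [← integral_const_mul, abs_of_nonpos hu]; congr 1; ext s; ring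
      _ ≤ ∫ s in Iic t, C * (-(s * exp (-s ^ 2 / 2))) := by
          refine setIntegral_mono_on ((hiw.integrableOn.const_mul _).const_mul C)
            (hi.neg.integrableOn.const_mul C) measurableSet_Iic fun s hs => ?_
          have h1 : s ≤ t := hs
          rw [← neg_mul]
          gcongr
      _ = C * exp (-t ^ 2 / 2) := by
          rw [integral_const_mul, integral_neg, integral_Iic_mul_gaussianWeight, neg_neg]
  · have h0 : |∫ s in Iic t, g s * exp (-s ^ 2 / 2)| = |∫ s in Ioi t, g s * exp (-s ^ 2 / 2)| := by
      have := intervalIntegral.integral_Iic_add_Ioi (b := t) hgi.integrableOn hgi.integrableOn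
      rw [hg0] at this
      rw [eq_neg_of_add_eq_zero_left this, abs_neg]
    rw [h0]
    calc |t| * |∫ s in Ioi t, g s * exp (-s ^ 2 / 2)|
        ≤ |t| * ∫ s in Ioi t, C * exp (-s ^ 2 / 2) := by
          gcongr; exact hgen _ measurableSet_Ioi
      _ = ∫ s in Ioi t, C * (t * exp (-s ^ 2 / 2)) := by
          rw [← integral_const_mul, abs_of_nonneg hu]; congr 1; ext s; ring
      _ ≤ ∫ s in Ioi t, C * (s * exp (-s ^ 2 / 2)) := by
          refine setIntegral_mono_on ((hiw.integrableOn.const_mul _).const_mul C)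
            (hi.integrableOn.const_mul C) measurableSet_Ioi fun s hs => ?_
          have h1 : t ≤ s := le_of_lt hs
          gcongr
      _ = C * exp (-t ^ 2 / 2) := by
          rw [integral_const_mul, integral_Ioi_mul_gaussianWeight]

/-- The Poincaré inequality for the Gaussian weight on the line, for bounded functions with bounded
derivative. -/
theorem gaussianWeight_poincare {f : ℝ → ℝ} (hf : Differentiable ℝ f) {C : ℝ}
    (hC : ∀ t, |f t| ≤ C) (hC' : ∀ t, |deriv f t| ≤ C) {a : ℝ}
    (ha : ∫ t, f t * exp (-t ^ 2 / 2) = a * ∫ t : ℝ, exp (-t ^ 2 / 2)) :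
    ∫ t, (f t - a) ^ 2 * exp (-t ^ 2 / 2) ≤ ∫ t, deriv f t ^ 2 * exp (-t ^ 2 / 2) := by
  have iw := integrable_gaussianWeight
  have hfm := hf.continuous.measurable
  have hgm : Measurable fun t => f t - a := hfm.sub_const a
  have hgb : ∀ t, |f t - a| ≤ C + |a| := fun t =>
    (abs_sub _ _).trans (add_le_add (hC t) le_rfl)
  have hg0 : ∫ t, (f t - a) * exp (-t ^ 2 / 2) = 0 := by
    have : ∀ t, (f t - a) * exp (-t ^ 2 / 2) = f t * exp (-t ^ 2 / 2) - a * exp (-t ^ 2 / 2) :=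
      fun t => by ring
    simp_rw [this]
    rw [integral_sub (integrable_bdd_mul iw hfm hC) (iw.const_mul a), integral_const_mul, ha,
      sub_self]
  have hgi := integrable_bdd_mul iw hgm hgb
  -- As for the radial weight, `h` solves `h' - t h = f - a`, and the Bochner argument applies with
  -- potential equal to `1`.
  set h : ℝ → ℝ := fun t => (∫ s in Iic t, (f s - a) * exp (-s ^ 2 / 2)) / exp (-t ^ 2 / 2) with hh
  have hd : ∀ t, HasDerivAt h (f t - a + t * h t) t := by
    intro t
    have hcont : Continuous fun t => (f t - a) * exp (-t ^ 2 / 2) := by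
      have := hf.continuous; fun_prop
    have h1 : HasDerivAt (fun t => ∫ s in Iic t, (f s - a) * exp (-s ^ 2 / 2))
        ((f t - a) * exp (-t ^ 2 / 2)) t := by
      have e : (fun t => ∫ s in Iic t, (f s - a) * exp (-s ^ 2 / 2)) = fun t =>
          (∫ s in Iic 0, (f s - a) * exp (-s ^ 2 / 2)) +
            ∫ s in (0 : ℝ)..t, (f s - a) * exp (-s ^ 2 / 2) := by
        ext t
        rw [← intervalIntegral.integral_Iic_sub_Iic hgi.integrableOn hgi.integrableOn]
        ring
      rw [e]
      exact (hcont.integral_hasStrictDerivAt 0 t).hasDerivAt.const_add _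
    refine (h1.div (hasDerivAt_gaussianWeight t) (exp_pos _).ne').congr_deriv ?_
    simp only [hh]
    field_simp
    ring
  have hu : ∀ t, |t * h t| ≤ C + |a| := by
    intro t
    simp only [hh]
    rw [abs_mul, abs_div, abs_of_pos (exp_pos _), ← mul_div_assoc, div_le_iff₀ (exp_pos _)]
    exact abs_mul_integral_Iic_le hgm hgb hg0 t
  have hhd : Differentiable ℝ h := fun t => (hd t).differentiableAt
  have hhm := hhd.continuous.measurable
  obtain ⟨K, hK⟩ := (isCompact_Icc (a := (-1 : ℝ)) (b := 1)).exists_bound_of_continuousOn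
    hhd.continuous.continuousOn
  have hhb : ∀ t, |h t| ≤ max K (C + |a|) := by
    intro t
    by_cases ht : |t| ≤ 1
    · exact (hK t (abs_le.1 ht)).trans (le_max_left _ _)
    · refine le_trans ?_ ((hu t).trans (le_max_right _ _))
      rw [abs_mul]
      exact le_mul_of_one_le_left (abs_nonneg _) (not_le.1 ht).le
  have hdb : ∀ t, |deriv h t| ≤ 2 * (C + |a|) := by
    intro t
    rw [(hd t).deriv]
    calc _ ≤ |f t - a| + |t * h t| := abs_add_le _ _
      _ ≤ _ := by linarith [hgb t, hu t]
  have hdm : Measurable (deriv h) := measurable_deriv h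
  have i_h2 : Integrable fun t => h t ^ 2 * exp (-t ^ 2 / 2) := by
    simpa [sq, mul_assoc] using integrable_bdd_mul (integrable_bdd_mul iw hhm hhb) hhm hhb
  have i_dh2 : Integrable fun t => deriv h t ^ 2 * exp (-t ^ 2 / 2) := by
    simpa [sq, mul_assoc] using integrable_bdd_mul (integrable_bdd_mul iw hdm hdb) hdm hdb
  have i_df2 : Integrable fun t => deriv f t ^ 2 * exp (-t ^ 2 / 2) := by
    simpa [sq, mul_assoc] using integrable_bdd_mul
      (integrable_bdd_mul iw (measurable_deriv f) hC') (measurable_deriv f) hC'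
  have i_g2 : Integrable fun t => (f t - a) ^ 2 * exp (-t ^ 2 / 2) := by
    simpa [sq, mul_assoc] using integrable_bdd_mul (integrable_bdd_mul iw hgm hgb) hgm hgb
  have i_hth : Integrable fun t => h t * (h t * (t * exp (-t ^ 2 / 2))) :=
    integrable_bdd_mul (integrable_bdd_mul integrable_mul_gaussianWeight hhm hhb) hhm hhb
  have i_htht : Integrable fun t => h t * (h t * (t ^ 2 * exp (-t ^ 2 / 2))) :=
    integrable_bdd_mul (integrable_bdd_mul integrable_sq_mul_gaussianWeight hhm hhb) hhm hhb
  have i_hdh : Integrable fun t => deriv h t * (h t * (t * exp (-t ^ 2 / 2))) :=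
    integrable_bdd_mul (integrable_bdd_mul integrable_mul_gaussianWeight hhm hhb) hdm hdb
  have i_hg : Integrable fun t => (f t - a) * (h t * exp (-t ^ 2 / 2)) :=
    integrable_bdd_mul (integrable_bdd_mul iw hhm hhb) hgm hgb
  have i_hdf : Integrable fun t => deriv f t * (h t * exp (-t ^ 2 / 2)) :=
    integrable_bdd_mul (integrable_bdd_mul iw hhm hhb) (measurable_deriv f) hC'
  -- Bochner
  have h1 := integral_eq_zero_of_hasDerivAt_of_integrable
    (f := fun t => h t * (h t * (t * exp (-t ^ 2 / 2))))
    (f' := fun t => 2 * (deriv h t * (h t * (t * exp (-t ^ 2 / 2)))) +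
      (h t ^ 2 * exp (-t ^ 2 / 2) - h t * (h t * (t ^ 2 * exp (-t ^ 2 / 2))))) (fun t => by
      have hdt := (hhd t).hasDerivAt
      refine (hdt.mul (hdt.mul ((hasDerivAt_id t).mul (hasDerivAt_gaussianWeight t)))).congr_deriv ?_
      simp only [Pi.mul_apply, id]
      ring) ((i_hdh.const_mul 2).add (i_h2.sub i_htht)) i_hth
  have h1' : 2 * (∫ t, deriv h t * (h t * (t * exp (-t ^ 2 / 2)))) +
      ((∫ t, h t ^ 2 * exp (-t ^ 2 / 2)) - ∫ t, h t * (h t * (t ^ 2 * exp (-t ^ 2 / 2)))) = 0 := by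
    rw [← integral_const_mul, ← integral_sub i_h2 i_htht]
    rw [← integral_add (i_hdh.const_mul 2) (by exact i_h2.sub i_htht)]
    exact h1
  have h2 : ∫ t, (f t - a) ^ 2 * exp (-t ^ 2 / 2) =
      (∫ t, deriv h t ^ 2 * exp (-t ^ 2 / 2)) + ((∫ t, h t * (h t * (t ^ 2 * exp (-t ^ 2 / 2)))) -
        2 * ∫ t, deriv h t * (h t * (t * exp (-t ^ 2 / 2)))) := by
    rw [← integral_const_mul, ← integral_sub i_htht (i_hdh.const_mul 2),
      ← integral_add i_dh2 (by exact i_htht.sub (i_hdh.const_mul 2))]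
    congr 1; ext t
    rw [(hd t).deriv]; ring
  have h3 : ∫ t, h t ^ 2 * exp (-t ^ 2 / 2) ≤ ∫ t, (f t - a) ^ 2 * exp (-t ^ 2 / 2) := by
    have : 0 ≤ ∫ t, deriv h t ^ 2 * exp (-t ^ 2 / 2) := integral_nonneg fun t => by positivity
    linarith
  -- integration by parts
  have h4 := integral_eq_zero_of_hasDerivAt_of_integrable
    (f := fun t => (f t - a) * (h t * exp (-t ^ 2 / 2)))
    (f' := fun t => deriv f t * (h t * exp (-t ^ 2 / 2)) + (f t - a) ^ 2 * exp (-t ^ 2 / 2))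
    (fun t => by
      refine (((hf t).hasDerivAt.sub_const a).mul
        ((hd t).mul (hasDerivAt_gaussianWeight t))).congr_deriv ?_
      simp only [Pi.mul_apply]
      ring) (i_hdf.add i_g2) i_hg
  rw [integral_add i_hdf i_g2] at h4
  -- The square of `f' + h`, as in the radial case with `l = 1`.
  have h5 : 0 ≤ ∫ t, (deriv f t ^ 2 * exp (-t ^ 2 / 2) +
      (2 * (deriv f t * (h t * exp (-t ^ 2 / 2))) + h t ^ 2 * exp (-t ^ 2 / 2))) := by
    refine integral_nonneg fun t => ?_
    have : 0 ≤ (deriv f t + h t) ^ 2 * exp (-t ^ 2 / 2) := by positivity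
    simp only [Pi.zero_apply]
    linarith
  rw [integral_add i_df2 (by exact (i_hdf.const_mul 2).add i_h2),
    integral_add (i_hdf.const_mul 2) i_h2, integral_const_mul] at h5
  linarith

end GaussianLine

/-! ### Tensorization of the variance -/

section Tensorization

/-- The variance of a bounded function. -/
noncomputable def bvar {X : Type*} [MeasurableSpace X] (μ : Measure X) (g : X → ℝ) : ℝ :=
  ∫ x, g x ^ 2 ∂μ - (∫ x, g x ∂μ) ^ 2

variable {X Y : Type*} [MeasurableSpace X] [MeasurableSpace Y]

theorem integrable_of_bdd {μ : Measure X} [IsFiniteMeasure μ] {g : X → ℝ} (hg : Measurable g)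
    {C : ℝ} (hC : ∀ x, |g x| ≤ C) : Integrable g μ :=
  Integrable.of_bound hg.aestronglyMeasurable C (.of_forall hC)

theorem abs_sq_le_of_abs_le {a C : ℝ} (h : |a| ≤ C) : |a ^ 2| ≤ C ^ 2 := by
  rw [abs_pow]; exact pow_le_pow_left₀ (abs_nonneg _) h 2

theorem abs_integral_le_of_bdd {μ : Measure X} [IsProbabilityMeasure μ] {g : X → ℝ}
    {C : ℝ} (hC : ∀ x, |g x| ≤ C) : |∫ x, g x ∂μ| ≤ C := by
  simpa using norm_integral_le_of_norm_le_const (μ := μ) (f := g) (.of_forall hC)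

theorem sq_integral_le_integral_sq {μ : Measure X} [IsProbabilityMeasure μ] {g : X → ℝ}
    (hg : Measurable g) {C : ℝ} (hC : ∀ x, |g x| ≤ C) :
    (∫ x, g x ∂μ) ^ 2 ≤ ∫ x, g x ^ 2 ∂μ := by
  set a := ∫ x, g x ∂μ with ha
  have i1 := integrable_of_bdd (μ := μ) hg hC
  have i2 := integrable_of_bdd (μ := μ) (hg.pow_const 2) fun x => abs_sq_le_of_abs_le (hC x)
  have h : 0 ≤ ∫ x, (g x ^ 2 - 2 * a * g x + a ^ 2) ∂μ := by
    refine integral_nonneg fun x => ?_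
    have : 0 ≤ (g x - a) ^ 2 := sq_nonneg _
    simp only [Pi.zero_apply]; linarith
  rw [integral_add (by exact i2.sub (i1.const_mul _)) (integrable_const _),
    integral_sub i2 (i1.const_mul _), integral_const_mul, ← ha] at h
  simp only [integral_const, probReal_univ, smul_eq_mul, one_mul] at h
  linarith

theorem abs_bvar_le {μ : Measure X} [IsProbabilityMeasure μ] {g : X → ℝ}
    {C : ℝ} (hC : ∀ x, |g x| ≤ C) : |bvar μ g| ≤ 2 * C ^ 2 := by
  have h1 := abs_integral_le_of_bdd (μ := μ) fun x => abs_sq_le_of_abs_le (hC x)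
  have h2 := abs_sq_le_of_abs_le (abs_integral_le_of_bdd (μ := μ) hC)
  exact (abs_sub _ _).trans (by linarith)

theorem measurable_integral_left {ν : Measure Y} [SFinite ν] {g : X × Y → ℝ} (hg : Measurable g) :
    Measurable fun x => ∫ y, g (x, y) ∂ν :=
  (hg.stronglyMeasurable.integral_prod_right' (ν := ν)).measurable

theorem measurable_bvar {ν : Measure Y} [SFinite ν] {g : X × Y → ℝ} (hg : Measurable g) :
    Measurable fun x => bvar ν fun y => g (x, y) :=
  (measurable_integral_left (g := fun p => g p ^ 2) (hg.pow_const 2)).sub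
    ((measurable_integral_left hg).pow_const 2)

/-- Tensorization of the variance. -/
theorem bvar_prod_le (μ : Measure X) (ν : Measure Y) [IsProbabilityMeasure μ]
    [IsProbabilityMeasure ν] {g : X × Y → ℝ} (hg : Measurable g) {C : ℝ} (hC : ∀ p, |g p| ≤ C) :
    bvar (μ.prod ν) g ≤ ∫ x, bvar ν (fun y => g (x, y)) ∂μ + ∫ y, bvar μ (fun x => g (x, y)) ∂ν := by
  set G : X → ℝ := fun x => ∫ y, g (x, y) ∂ν with hG
  set H : Y → ℝ := fun y => ∫ x, g (x, y) ∂μ with hH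
  have hGm : Measurable G := measurable_integral_left hg
  have hHm : Measurable H := measurable_integral_left (g := fun p => g p.swap)
    (hg.comp measurable_swap)
  have hGb : ∀ x, |G x| ≤ C := fun x => abs_integral_le_of_bdd fun y => hC _
  have hHb : ∀ y, |H y| ≤ C := fun y => abs_integral_le_of_bdd fun x => hC _
  have ig := integrable_of_bdd (μ := μ.prod ν) hg hC
  have ig2 := integrable_of_bdd (μ := μ.prod ν) (hg.pow_const 2) fun p => abs_sq_le_of_abs_le (hC p)
  have iG := integrable_of_bdd (μ := μ) hGm hGb
  have iH := integrable_of_bdd (μ := ν) hHm hHb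
  have iG2 := integrable_of_bdd (μ := μ) (hGm.pow_const 2) fun x => abs_sq_le_of_abs_le (hGb x)
  have iH2 := integrable_of_bdd (μ := ν) (hHm.pow_const 2) fun x => abs_sq_le_of_abs_le (hHb x)
  set m := ∫ p, g p ∂μ.prod ν with hm
  have hmG : m = ∫ x, G x ∂μ := integral_prod _ ig
  have hmH : m = ∫ y, H y ∂ν := integral_prod_symm _ ig
  have e1 : ∫ x, bvar ν (fun y => g (x, y)) ∂μ = (∫ p, g p ^ 2 ∂μ.prod ν) - ∫ x, G x ^ 2 ∂μ := by
    rw [integral_prod _ ig2, ← integral_sub ig2.integral_prod_left iG2]; rfl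
  have e2 : ∫ y, bvar μ (fun x => g (x, y)) ∂ν = (∫ p, g p ^ 2 ∂μ.prod ν) - ∫ y, H y ^ 2 ∂ν := by
    rw [integral_prod_symm _ ig2, ← integral_sub ig2.integral_prod_right iH2]; rfl
  -- Jensen
  have hkm : Measurable fun p : X × Y => g p - H p.2 := hg.sub (hHm.comp measurable_snd)
  have hkb : ∀ p : X × Y, |g p - H p.2| ≤ C + C := fun p =>
    (abs_sub _ _).trans (add_le_add (hC p) (hHb _))
  have ik2 := integrable_of_bdd (μ := μ.prod ν) (hkm.pow_const 2)
    fun p => abs_sq_le_of_abs_le (hkb p)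
  have hJ : ∀ x, (G x - m) ^ 2 ≤ ∫ y, (g (x, y) - H y) ^ 2 ∂ν := by
    intro x
    have hgx : Measurable fun y => g (x, y) := hg.comp measurable_prodMk_left
    have h1 := sq_integral_le_integral_sq (μ := ν) (hgx.sub hHm) fun y => hkb (x, y)
    simp only [Pi.sub_apply] at h1
    rwa [integral_sub (integrable_of_bdd hgx fun y => hC (x, y)) iH, ← hmH] at h1
  have hJ2 : ∫ x, (G x - m) ^ 2 ∂μ ≤ ∫ p : X × Y, (g p - H p.2) ^ 2 ∂μ.prod ν := by
    rw [integral_prod _ ik2]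
    refine integral_mono (integrable_of_bdd ((hGm.sub_const m).pow_const 2) fun x =>
      abs_sq_le_of_abs_le ((abs_sub _ _).trans (add_le_add (hGb x) le_rfl)))
      ik2.integral_prod_left hJ
  have e3 : ∫ x, (G x - m) ^ 2 ∂μ = ∫ x, G x ^ 2 ∂μ - m ^ 2 := by
    have : ∀ x, (G x - m) ^ 2 = G x ^ 2 - 2 * m * G x + m ^ 2 := fun x => by ring
    simp_rw [this]
    rw [integral_add (by exact iG2.sub (iG.const_mul _)) (integrable_const _),
      integral_sub iG2 (iG.const_mul _), integral_const_mul, ← hmG]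
    simp only [integral_const, probReal_univ, smul_eq_mul, one_mul]
    ring
  have igH : Integrable (fun p : X × Y => g p * H p.2) (μ.prod ν) :=
    integrable_bdd_mul (integrable_of_bdd (hHm.comp measurable_snd) fun p => hHb p.2) hg hC
  have iH2' : Integrable (fun p : X × Y => H p.2 ^ 2) (μ.prod ν) :=
    integrable_of_bdd ((hHm.comp measurable_snd).pow_const 2) fun p => abs_sq_le_of_abs_le (hHb p.2)
  have e4 : ∫ p : X × Y, (g p - H p.2) ^ 2 ∂μ.prod ν =
      (∫ p, g p ^ 2 ∂μ.prod ν) - ∫ y, H y ^ 2 ∂ν := by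
    have : ∀ p : X × Y, (g p - H p.2) ^ 2 = g p ^ 2 - 2 * (g p * H p.2) + H p.2 ^ 2 :=
      fun p => by ring
    simp_rw [this]
    have h1 : ∫ p : X × Y, g p * H p.2 ∂μ.prod ν = ∫ y, H y ^ 2 ∂ν := by
      rw [integral_prod_symm _ igH]
      congr 1; ext y
      simp only [integral_mul_const, hH, sq]
    have h2 : ∫ p : X × Y, H p.2 ^ 2 ∂μ.prod ν = ∫ y, H y ^ 2 ∂ν := by
      rw [integral_prod_symm _ iH2']
      simp
    rw [integral_add (by exact ig2.sub (igH.const_mul 2)) iH2', integral_sub ig2 (igH.const_mul 2),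
      integral_const_mul, h1, h2]
    ring
  -- The claim has become `∫ G ^ 2 + ∫ H ^ 2 ≤ ∫ g ^ 2 + m ^ 2`, which is the Jensen bound `hJ2`
  -- rewritten by `e3` and `e4`.
  rw [e1, e2, bvar]
  linarith

variable {Ω : Type*} [MeasurableSpace Ω]

theorem integral_pi_insertNth {n : ℕ} (γ : Measure Ω) [IsProbabilityMeasure γ]
    (i : Fin (n + 1)) (g : (Fin (n + 1) → Ω) → ℝ) :
    ∫ x, g x ∂(Measure.pi fun _ => γ) =
      ∫ p : Ω × (Fin n → Ω), g (i.insertNth p.1 p.2) ∂(γ.prod (Measure.pi fun _ => γ)) := by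
  have h := (measurePreserving_piFinSuccAbove (fun _ : Fin (n + 1) => γ) i).symm
  rw [← h.integral_comp']
  rfl

theorem measurable_insertNth {n : ℕ} (i : Fin (n + 1)) :
    Measurable fun p : Ω × (Fin n → Ω) => (i.insertNth p.1 p.2 : Fin (n + 1) → Ω) :=
  (MeasurableEquiv.piFinSuccAbove (fun _ => Ω) i).symm.measurable

theorem bvar_pi_insertNth {n : ℕ} (γ : Measure Ω) [IsProbabilityMeasure γ]
    (i : Fin (n + 1)) (g : (Fin (n + 1) → Ω) → ℝ) :
    bvar (Measure.pi fun _ => γ) g =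
      bvar (γ.prod (Measure.pi fun _ => γ)) fun p : Ω × (Fin n → Ω) => g (i.insertNth p.1 p.2) := by
  rw [bvar, bvar, integral_pi_insertNth γ i, integral_pi_insertNth γ i]

/-- The Efron-Stein inequality. -/
theorem bvar_pi_le (γ : Measure Ω) [IsProbabilityMeasure γ] (n : ℕ) :
    ∀ (g : (Fin (n + 1) → Ω) → ℝ), Measurable g → ∀ C : ℝ, (∀ x, |g x| ≤ C) →
    bvar (Measure.pi fun _ => γ) g ≤
      ∑ i : Fin (n + 1), ∫ y, bvar γ (fun t => g (i.insertNth t y)) ∂(Measure.pi fun _ => γ) := by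
  induction n with
  | zero =>
    intro g hg C hC
    rw [bvar_pi_insertNth γ 0]
    refine (bvar_prod_le _ _ (hg.comp (measurable_insertNth 0)) fun p => hC _).trans_eq ?_
    have h0 : ∀ x : Ω, bvar (Measure.pi fun _ : Fin 0 => γ)
        (fun y => g (Fin.insertNth 0 x y)) = 0 := by
      intro x
      have : (fun y : Fin 0 → Ω => g (Fin.insertNth 0 x y)) =
          fun _ => g (Fin.insertNth 0 x default) :=
        funext fun y => by rw [Subsingleton.elim y default]
      rw [this]
      simp [bvar]
    have h1 : ∫ x, bvar (Measure.pi fun _ : Fin 0 => γ)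
        (fun y => g (Fin.insertNth 0 x y)) ∂γ = 0 := by
      rw [integral_congr_ae (.of_forall h0), integral_zero]
    simpa [Function.comp_def] using h1
  | succ n ih =>
    intro g hg C hC
    rw [bvar_pi_insertNth γ 0, Fin.sum_univ_succ]
    refine (bvar_prod_le _ _ (hg.comp (measurable_insertNth 0)) fun p => hC _).trans ?_
    refine (add_comm _ _).trans_le (add_le_add le_rfl ?_)
    have hm : ∀ x : Ω, Measurable fun y : Fin (n + 1) → Ω =>
        g ((0 : Fin (n + 2)).insertNth x y) := fun x =>
      (hg.comp (measurable_insertNth 0)).comp measurable_prodMk_left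
    have hm2 : ∀ i : Fin (n + 1), Measurable fun q : (Ω × (Fin n → Ω)) × Ω =>
        g ((0 : Fin (n + 2)).insertNth q.1.1 (i.insertNth q.2 q.1.2)) := fun i => by
      refine (hg.comp (measurable_insertNth 0)).comp
        ((measurable_fst.comp measurable_fst).prodMk ?_)
      exact (measurable_insertNth i).comp
        (measurable_snd.prodMk (measurable_snd.comp measurable_fst))
    have hm3 := fun i => measurable_bvar (ν := γ) (hm2 i)
    have hi : ∀ i : Fin (n + 1), Integrable (fun p : Ω × (Fin n → Ω) =>
        bvar γ fun t => g ((0 : Fin (n + 2)).insertNth p.1 (i.insertNth t p.2)))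
        (γ.prod (Measure.pi fun _ => γ)) := fun i =>
      integrable_of_bdd (hm3 i) fun p => abs_bvar_le fun t => hC _
    calc ∫ x, bvar (Measure.pi fun _ => γ) (fun y => g ((0 : Fin (n + 2)).insertNth x y)) ∂γ
        ≤ ∫ x, ∑ i : Fin (n + 1), ∫ y, bvar γ (fun t =>
            g ((0 : Fin (n + 2)).insertNth x (i.insertNth t y))) ∂(Measure.pi fun _ => γ) ∂γ := by
          refine integral_mono ?_ ?_ fun x => ih _ (hm x) C fun y => hC _
          · exact integrable_of_bdd (measurable_bvar (hg.comp (measurable_insertNth 0)))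
              fun x => abs_bvar_le fun y => hC _
          · exact integrable_finsetSum _ fun i _ => (hi i).integral_prod_left
      _ = ∑ i : Fin (n + 1), ∫ x, ∫ y, bvar γ (fun t =>
            g ((0 : Fin (n + 2)).insertNth x (i.insertNth t y))) ∂(Measure.pi fun _ => γ) ∂γ :=
          integral_finsetSum _ fun i _ => (hi i).integral_prod_left
      _ = _ := by
          refine Finset.sum_congr rfl fun i _ => ?_
          rw [integral_pi_insertNth γ 0, ← integral_prod _ (hi i)]
          congr 1; ext p
          congr 1; ext t
          rw [Fin.insertNth_zero', Fin.insertNth_zero', Fin.insertNth_succ_cons]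

end Tensorization

/-! ### The Gaussian Poincaré inequality on products -/

section GaussianPi

open ProbabilityTheory

theorem integral_gaussianReal_std (f : ℝ → ℝ) :
    ∫ t, f t ∂(gaussianReal 0 1) =
      (√(2 * Real.pi))⁻¹ * ∫ t, f t * Real.exp (-t ^ 2 / 2) := by
  rw [integral_gaussianReal_eq_integral_smul one_ne_zero, ← integral_const_mul]
  congr 1; ext t
  simp [gaussianPDFReal_def]
  ring

theorem bvar_gaussianReal_le {f : ℝ → ℝ} (hf : Differentiable ℝ f) {C : ℝ}
    (hC : ∀ t, |f t| ≤ C) (hC' : ∀ t, |deriv f t| ≤ C) :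
    bvar (gaussianReal 0 1) f ≤ ∫ t, deriv f t ^ 2 ∂(gaussianReal 0 1) := by
  set a := ∫ t, f t ∂(gaussianReal 0 1) with ha
  have hK : (√(2 * Real.pi))⁻¹ * ∫ t : ℝ, Real.exp (-t ^ 2 / 2) = 1 := by
    have := integral_gaussianReal_std fun _ => 1
    simpa using this.symm
  have hK0 : 0 < (√(2 * Real.pi))⁻¹ := by positivity
  have ha' : ∫ t, f t * Real.exp (-t ^ 2 / 2) = a * ∫ t : ℝ, Real.exp (-t ^ 2 / 2) := by
    rw [integral_gaussianReal_std] at ha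
    rw [ha, mul_right_comm, hK, one_mul]
  have h1 := mul_le_mul_of_nonneg_left (gaussianWeight_poincare hf hC hC' ha') hK0.le
  rw [← integral_gaussianReal_std (fun t => (f t - a) ^ 2),
    ← integral_gaussianReal_std (fun t => deriv f t ^ 2)] at h1
  refine le_trans (le_of_eq ?_) h1
  have hfm := hf.continuous.measurable
  have i1 := integrable_of_bdd (μ := gaussianReal 0 1) hfm hC
  have i2 := integrable_of_bdd (μ := gaussianReal 0 1) (hfm.pow_const 2)
    fun x => abs_sq_le_of_abs_le (hC x)
  have : ∀ x, (f x - a) ^ 2 = f x ^ 2 - 2 * a * f x + a ^ 2 := fun x => by ring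
  simp_rw [this]
  rw [integral_add (by exact i2.sub (i1.const_mul _)) (integrable_const _),
    integral_sub i2 (i1.const_mul _), integral_const_mul, ← ha, bvar, ← ha]
  simp only [integral_const, probReal_univ, smul_eq_mul, one_mul]
  ring

/-- The Gaussian Poincaré inequality, for bounded functions with bounded partial derivatives away
from the origin. -/
theorem bvar_pi_gaussianReal_le {n : ℕ} {g : (Fin (n + 2) → ℝ) → ℝ} (hg : Measurable g) {C : ℝ}
    (hC : ∀ x, |g x| ≤ C) {D : Fin (n + 2) → (Fin (n + 2) → ℝ) → ℝ} (hD : ∀ i, Measurable (D i))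
    (hDC : ∀ i x, |D i x| ≤ C)
    (hgD : ∀ i (y : Fin (n + 1) → ℝ), y ≠ 0 → ∀ t,
      HasDerivAt (fun t => g (i.insertNth t y)) (D i (i.insertNth t y)) t) :
    bvar (Measure.pi fun _ => gaussianReal 0 1) g ≤
      ∑ i, ∫ x, D i x ^ 2 ∂(Measure.pi fun _ => gaussianReal 0 1) := by
  refine (bvar_pi_le (gaussianReal 0 1) (n + 1) g hg C hC).trans
    (Finset.sum_le_sum fun i _ => ?_)
  have hDm : Measurable fun p : ℝ × (Fin (n + 1) → ℝ) => D i (i.insertNth p.1 p.2) ^ 2 :=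
    ((hD i).comp (measurable_insertNth i)).pow_const 2
  have hDi : Integrable (fun p : ℝ × (Fin (n + 1) → ℝ) => D i (i.insertNth p.1 p.2) ^ 2)
      ((gaussianReal 0 1).prod (Measure.pi fun _ => gaussianReal 0 1)) :=
    integrable_of_bdd hDm fun p => abs_sq_le_of_abs_le (hDC i _)
  have hgm : Measurable fun p : (Fin (n + 1) → ℝ) × ℝ => g (i.insertNth p.2 p.1) :=
    hg.comp ((measurable_insertNth i).comp measurable_swap)
  rw [integral_pi_insertNth _ i, integral_prod_symm _ hDi]
  refine integral_mono_ae (integrable_of_bdd (measurable_bvar hgm)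
    fun y => abs_bvar_le fun t => hC _) hDi.integral_prod_right ?_
  -- The lines parallel to a coordinate axis that meet the origin have `y = 0`. Since `y` has at
  -- least one coordinate, which is why the dimension is `n + 2`, almost every line avoids the
  -- singularity.
  have hne : ∀ᵐ y ∂(Measure.pi fun _ : Fin (n + 1) => gaussianReal 0 1), y ≠ 0 := by
    rw [ae_iff]
    have := nullSingletonClass_gaussianReal (μ := 0) (v := 1) one_ne_zero
    simp
  filter_upwards [hne] with y hy
  have hd := hgD i y hy
  refine (bvar_gaussianReal_le (C := C) (fun t => (hd t).differentiableAt) (fun t => hC _)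
    fun t => ?_).trans_eq ?_
  · rw [(hd t).deriv]; exact hDC _ _
  · congr 1; ext t; rw [(hd t).deriv]

end GaussianPi

/-! ### The Gaussian product measure as a density on Euclidean space -/

section GaussianSpace

open ProbabilityTheory

theorem pi_gaussianReal_eq_withDensity (n : ℕ) :
    Measure.pi (fun _ : Fin n => gaussianReal 0 1) =
      (volume : Measure (Fin n → ℝ)).withDensity
        fun x => ENNReal.ofReal (∏ i, gaussianPDFReal 0 1 (x i)) := by
  refine Measure.pi_eq fun s hs => ?_
  have hi : Integrable (fun x : Fin n → ℝ => ∏ i, gaussianPDFReal 0 1 (x i))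
      (Measure.pi fun i => volume.restrict (s i)) :=
    Integrable.fintype_prod fun i => (integrable_gaussianPDFReal 0 1).restrict
  rw [withDensity_apply _ (MeasurableSet.univ_pi hs), volume_pi, Measure.restrict_pi_pi,
    ← ofReal_integral_eq_lintegral_ofReal hi
      (.of_forall fun x => Finset.prod_nonneg fun i _ => gaussianPDFReal_nonneg 0 1 _),
    integral_fintype_prod_eq_prod (fun _ => gaussianPDFReal 0 1),
    ENNReal.ofReal_prod_of_nonneg fun i _ =>
      integral_nonneg fun x => gaussianPDFReal_nonneg 0 1 x]
  exact Finset.prod_congr rfl fun i _ => (gaussianReal_apply_eq_integral 0 one_ne_zero _).symm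

/-- Integration against the standard Gaussian product measure, in terms of the density. -/
theorem integral_pi_gaussianReal (n : ℕ) :
    ∃ c : ℝ, 0 < c ∧ ∀ f : EuclideanSpace ℝ (Fin n) → ℝ,
      ∫ x, f (WithLp.toLp 2 x) ∂(Measure.pi fun _ : Fin n => gaussianReal 0 1) =
        c * ∫ x, f x * Real.exp (-(‖x‖ ^ (2 : ℝ)) / 2) := by
  refine ⟨((√(2 * Real.pi))⁻¹) ^ n, by positivity, fun f => ?_⟩
  have hp : Measurable fun x : Fin n → ℝ => ∏ i, gaussianPDFReal 0 1 (x i) :=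
    Finset.measurable_prod _ fun i _ => (measurable_gaussianPDFReal 0 1).comp (measurable_pi_apply i)
  rw [pi_gaussianReal_eq_withDensity, ← integral_const_mul,
    integral_withDensity_eq_integral_toReal_smul hp.ennreal_ofReal (.of_forall fun x => by simp),
    ← (PiLp.volume_preserving_toLp (Fin n)).integral_comp
      (MeasurableEquiv.toLp 2 (Fin n → ℝ)).measurableEmbedding]
  refine integral_congr_ae (.of_forall fun x => ?_)
  have h0 : 0 ≤ ∏ i, gaussianPDFReal 0 1 (x i) :=
    Finset.prod_nonneg fun i _ => gaussianPDFReal_nonneg 0 1 _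
  have h1 : ∏ i, gaussianPDFReal 0 1 (x i) =
      ((√(2 * Real.pi))⁻¹) ^ n * Real.exp (-(‖WithLp.toLp 2 x‖ ^ (2 : ℝ)) / 2) := by
    rw [Real.rpow_two, EuclideanSpace.norm_sq_eq]
    simp only [gaussianPDFReal_def, Finset.prod_mul_distrib, Finset.prod_const,
      ← Real.exp_sum, Finset.card_univ, Fintype.card_fin, NNReal.coe_one, mul_one, sub_zero,
      Real.norm_eq_abs, sq_abs]
    rw [← Finset.sum_div, Finset.sum_neg_distrib]
  simp only [ENNReal.toReal_ofReal h0, smul_eq_mul]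
  rw [h1]
  ring

end GaussianSpace

/-! ### Polar coordinates -/

section Polar

variable {n : ℕ}

/-- Restriction of the Lebesgue measure to rays. -/
theorem integral_volumeIoiPow (k : ℕ) (f : ℝ → ℝ) :
    ∫ r : Set.Ioi (0 : ℝ), f r ∂(Measure.volumeIoiPow k) = ∫ r in Set.Ioi (0 : ℝ), f r * r ^ k := by
  simp only [Measure.volumeIoiPow, ENNReal.ofReal]
  rw [integral_withDensity_eq_integral_smul (measurable_subtype_coe.pow_const _).real_toNNReal,
    integral_subtype_comap measurableSet_Ioi fun a => Real.toNNReal (a ^ k) • f a,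
    setIntegral_congr_fun measurableSet_Ioi fun x hx => ?_]
  rw [NNReal.smul_def, Real.coe_toNNReal _ (pow_nonneg (le_of_lt hx) _), smul_eq_mul, mul_comm]

/-- Integration in polar coordinates. -/
theorem integral_polar [NeZero n] (f : EuclideanSpace ℝ (Fin n) → ℝ) :
    ∫ x, f x = ∫ p : Metric.sphere (0 : EuclideanSpace ℝ (Fin n)) 1 × Set.Ioi (0 : ℝ),
      f ((p.2 : ℝ) • (p.1 : EuclideanSpace ℝ (Fin n)))
        ∂((volume : Measure (EuclideanSpace ℝ (Fin n))).toSphere.prod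
          (Measure.volumeIoiPow (n - 1))) := by
  have hn : Module.finrank ℝ (EuclideanSpace ℝ (Fin n)) = n := finrank_euclideanSpace_fin
  have h := (volume : Measure (EuclideanSpace ℝ
    (Fin n))).measurePreserving_homeomorphUnitSphereProd.integral_comp
    (Homeomorph.measurableEmbedding _)
    (fun p => f ((p.2 : ℝ) • (p.1 : EuclideanSpace ℝ (Fin n))))
  rw [hn] at h
  have h0 : ∫ x : ({0}ᶜ : Set (EuclideanSpace ℝ (Fin n))), 
      f x ∂((volume : Measure (EuclideanSpace ℝ (Fin n))).comap (↑)) = ∫ x, f x := by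
    rw [integral_subtype_comap (measurableSet_singleton _).compl f, restrict_compl_singleton]
  rw [← h, ← h0]
  refine integral_congr_ae (.of_forall fun x => ?_)
  have hx : ‖(x : EuclideanSpace ℝ (Fin n))‖ ≠ 0 := norm_ne_zero_iff.2 x.2
  simp [smul_smul, hx]

theorem integrable_polar [NeZero n] {f : EuclideanSpace ℝ (Fin n) → ℝ} (hf : Integrable f) :
    Integrable (fun p : Metric.sphere (0 : EuclideanSpace ℝ (Fin n)) 1 × Set.Ioi (0 : ℝ) =>
      f ((p.2 : ℝ) • (p.1 : EuclideanSpace ℝ (Fin n))))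
        ((volume : Measure (EuclideanSpace ℝ (Fin n))).toSphere.prod
          (Measure.volumeIoiPow (n - 1))) := by
  have hn : Module.finrank ℝ (EuclideanSpace ℝ (Fin n)) = n := finrank_euclideanSpace_fin
  have h := (volume : Measure (EuclideanSpace ℝ
    (Fin n))).measurePreserving_homeomorphUnitSphereProd.integrable_comp_emb
    (Homeomorph.measurableEmbedding _)
    (g := fun p => f ((p.2 : ℝ) • (p.1 : EuclideanSpace ℝ (Fin n))))
  rw [hn] at h
  rw [← h]
  have h2 := (integrableOn_iff_comap_subtypeVal
    (measurableSet_singleton (0 : EuclideanSpace ℝ (Fin n))).compl).1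
    (hf.integrableOn (s := {0}ᶜ))
  refine h2.congr (.of_forall fun x => ?_)
  have hx : ‖(x : EuclideanSpace ℝ (Fin n))‖ ≠ 0 := norm_ne_zero_iff.2 x.2
  simp [smul_smul, hx]

end Polar

/-! ### The Gaussian Poincaré inequality on Euclidean space -/

section GaussianSpace

open ProbabilityTheory

theorem gradient_apply_eq_fderiv {n : ℕ} (g : EuclideanSpace ℝ (Fin n) → ℝ)
    (x : EuclideanSpace ℝ (Fin n)) (i : Fin n) :
    (∇ g x) i = fderiv ℝ g x (EuclideanSpace.single i 1) := by
  rw [← inner_gradient_left, EuclideanSpace.inner_single_right]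
  simp

/-- The Gaussian Poincaré inequality on `ℝⁿ`, for functions which may be singular at the origin. -/
theorem gaussian_poincare {n : ℕ} (hn : 2 ≤ n) {g : EuclideanSpace ℝ (Fin n) → ℝ}
    (hg : Measurable g) {C : ℝ} (hC : ∀ x, |g x| ≤ C)
    (hd : ∀ x ≠ 0, DifferentiableAt ℝ g x) (hgr : ∀ x ≠ 0, ‖∇ g x‖ ≤ C) :
    (∫ x : EuclideanSpace ℝ (Fin n), Real.exp (-(‖x‖ ^ (2 : ℝ)) / 2)) *
        (∫ x, g x ^ 2 * Real.exp (-(‖x‖ ^ (2 : ℝ)) / 2)) -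
      (∫ x, g x * Real.exp (-(‖x‖ ^ (2 : ℝ)) / 2)) ^ 2 ≤
    (∫ x : EuclideanSpace ℝ (Fin n), Real.exp (-(‖x‖ ^ (2 : ℝ)) / 2)) *
      ∫ x, ‖∇ g x‖ ^ 2 * Real.exp (-(‖x‖ ^ (2 : ℝ)) / 2) := by
  obtain ⟨k, rfl⟩ : ∃ k, n = k + 2 := ⟨n - 2, by omega⟩
  obtain ⟨c, hc, hint⟩ := integral_pi_gaussianReal (k + 2)
  have hC0 : 0 ≤ C := (abs_nonneg _).trans (hC 0)
  let e := WithLp.toLp 2 (V := Fin (k + 2) → ℝ)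
  have he : Measurable e := (MeasurableEquiv.toLp 2 (Fin (k + 2) → ℝ)).measurable
  -- The partial derivatives are set to `0` at the origin, where nothing is assumed on `g`; this
  -- keeps them bounded everywhere and changes no integral.
  let D : Fin (k + 2) → EuclideanSpace ℝ (Fin (k + 2)) → ℝ := fun i =>
    ({0}ᶜ : Set (EuclideanSpace ℝ (Fin (k + 2)))).indicator
      fun x => fderiv ℝ g x (EuclideanSpace.single i 1)
  have hD : ∀ i, Measurable (D i) := fun i =>
    (measurable_fderiv_apply_const ℝ g _).indicator (measurableSet_singleton _).compl
  have hDC : ∀ i x, |D i x| ≤ C := by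
    intro i x
    by_cases hx : x = 0
    · simp [D, hx, hC0]
    · have h1 : D i x = (∇ g x) i := by
        simp [D, hx, gradient_apply_eq_fderiv]
      rw [h1, ← Real.norm_eq_abs]
      exact (PiLp.norm_apply_le _ i).trans (hgr x hx)
  have key := bvar_pi_gaussianReal_le (g := fun x => g (e x)) (hg.comp he) (fun x => hC _)
    (D := fun i x => D i (e x)) (fun i => (hD i).comp he) (fun i x => hDC i _) (by
      intro i y hy t
      have hne : e (i.insertNth t y) ≠ 0 := by
        intro h0
        apply hy
        ext j
        have := congrArg (fun z : EuclideanSpace ℝ (Fin (k + 2)) => z (i.succAbove j)) h0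
        simpa [e] using this
      have h1 : D i (e (i.insertNth t y)) =
          fderiv ℝ g (e (i.insertNth t y)) (EuclideanSpace.single i 1) := by
        simp [D, hne]
      have h2 : HasDerivAt (fun t => e (i.insertNth t y)) (EuclideanSpace.single i 1) t := by
        have h3 : HasDerivAt (fun t => Function.update
            (i.insertNth (0 : ℝ) y : Fin (k + 2) → ℝ) i t) (Pi.single i 1) t :=
          hasDerivAt_update _ i t
        simp only [Fin.update_insertNth] at h3
        exact ((PiLp.continuousLinearEquiv 2 ℝ
          (fun _ : Fin (k + 2) => ℝ)).symm.hasFDerivAt.comp_hasDerivAt t h3)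
      rw [h1]
      exact (hd _ hne).hasFDerivAt.comp_hasDerivAt t h2)
  have hsum : ∑ i, ∫ x, D i (e x) ^ 2 ∂(Measure.pi fun _ : Fin (k + 2) => gaussianReal 0 1) =
      c * ∫ x, ‖∇ g x‖ ^ 2 * Real.exp (-(‖x‖ ^ (2 : ℝ)) / 2) := by
    rw [← integral_finsetSum Finset.univ fun i _ => (integrable_of_bdd
      (((hD i).comp he).pow_const 2) (C := C ^ 2) fun x => abs_sq_le_of_abs_le (hDC i _) :
        Integrable (fun x => D i (e x) ^ 2) (Measure.pi fun _ => gaussianReal 0 1))]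
    rw [hint fun x => ∑ i, D i x ^ 2]
    congr 1
    refine integral_congr_ae ?_
    filter_upwards [compl_mem_ae_iff.2
      (measure_singleton (μ := volume) (0 : EuclideanSpace ℝ (Fin (k + 2))))] with x hx
    have hx : x ≠ 0 := hx
    rw [EuclideanSpace.norm_sq_eq]
    congr 1
    refine Finset.sum_congr rfl fun i _ => ?_
    simp [D, hx, gradient_apply_eq_fderiv]
  rw [hsum, bvar, hint fun x => g x ^ 2, hint g] at key
  have h1 := hint fun _ => 1
  simp only [integral_const, probReal_univ, smul_eq_mul, mul_one, one_mul] at h1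
  set I := ∫ x : EuclideanSpace ℝ (Fin (k + 2)), Real.exp (-(‖x‖ ^ (2 : ℝ)) / 2)
  have hI : I = c⁻¹ := eq_inv_of_mul_eq_one_right h1.symm
  rw [hI]
  have h4 := mul_le_mul_of_nonneg_left key (sq_nonneg c⁻¹)
  field_simp at h4 ⊢
  nlinarith [h4]

end GaussianSpace

/-! ### Gradients in polar coordinates -/

section PolarGradient

variable {n : ℕ}

theorem hasFDerivAt_norm_of_ne {x : EuclideanSpace ℝ (Fin n)} (hx : x ≠ 0) :
    HasFDerivAt (fun y : EuclideanSpace ℝ (Fin n) => ‖y‖) (‖x‖⁻¹ • innerSL ℝ x) x := by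
  have h := (hasStrictFDerivAt_norm_sq x).hasFDerivAt.sqrt (by positivity)
  simp only [Real.sqrt_sq (norm_nonneg _)] at h
  refine h.congr_fderiv ?_
  ext v
  simp
  ring

/-- The gradient of `x ↦ R ‖x‖ * F (x / ‖x‖)`. -/
theorem hasGradientAt_radial_mul {F : EuclideanSpace ℝ (Fin n) → ℝ} (hF : Differentiable ℝ F)
    {R : ℝ → ℝ} {R' : ℝ} {x θ : EuclideanSpace ℝ (Fin n)} (hx : x ≠ 0) (hθ : θ = ‖x‖⁻¹ • x)
    (hR : HasDerivAt R R' ‖x‖) :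
    HasGradientAt (fun y => R ‖y‖ * F (‖y‖⁻¹ • y))
      ((R' * F θ) • θ + (R ‖x‖ / ‖x‖) • (∇ F θ - inner ℝ θ (∇ F θ) • θ)) x := by
  have hx0 : ‖x‖ ≠ 0 := norm_ne_zero_iff.2 hx
  have h1 := hasFDerivAt_norm_of_ne hx
  have h2 := hR.comp_hasFDerivAt x h1
  have h3 : HasFDerivAt (fun y : EuclideanSpace ℝ (Fin n) => ‖y‖⁻¹ • y) _ x :=
    ((hasDerivAt_inv hx0).comp_hasFDerivAt x h1).smul (hasFDerivAt_id x)
  have h4 : HasFDerivAt F (InnerProductSpace.toDual ℝ _ (∇ F θ)) ((fun y : EuclideanSpace ℝ (Fin n) => ‖y‖⁻¹ • y) x) :=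
    hθ ▸ (hF _).hasGradientAt.hasFDerivAt
  have h5 := h2.mul (HasFDerivAt.comp (g := F)
    (f := fun y : EuclideanSpace ℝ (Fin n) => ‖y‖⁻¹ • y) x h4 h3)
  rw [hasGradientAt_iff_hasFDerivAt]
  refine h5.congr_fderiv ?_
  have hxθ : x = ‖x‖ • θ := by rw [hθ, smul_smul, mul_inv_cancel₀ hx0, one_smul]
  clear h5 h4
  generalize ∇ F θ = G
  ext v
  have hin : inner ℝ x v = ‖x‖ * inner ℝ θ v := by
    conv_lhs => rw [hxθ]
    rw [real_inner_smul_left]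
  have hgx : inner ℝ G x = ‖x‖ * inner ℝ θ G := by
    conv_lhs => rw [hxθ]
    rw [real_inner_smul_right, real_inner_comm]
  have hFx : F (‖x‖⁻¹ • x) = F θ := by rw [hθ]
  simp [real_inner_smul_right, hin, hgx, hFx]
  field_simp
  ring

theorem norm_sq_radial_tangential {θ G : EuclideanSpace ℝ (Fin n)} (hθ : ‖θ‖ = 1) (a b : ℝ) :
    ‖a • θ + b • (G - inner ℝ θ G • θ)‖ ^ 2 =
      a ^ 2 + b ^ 2 * (‖G‖ ^ 2 - inner ℝ θ G ^ 2) := by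
  have h1 : inner ℝ θ θ = (1 : ℝ) := by rw [real_inner_self_eq_norm_sq, hθ, one_pow]
  rw [← real_inner_self_eq_norm_sq, ← real_inner_self_eq_norm_sq]
  simp only [inner_add_left, inner_add_right, inner_sub_left, inner_sub_right,
    real_inner_smul_left, real_inner_smul_right, h1, real_inner_comm θ G]
  ring

end PolarGradient

/-! ### The Poincaré inequality on the sphere -/

section SpherePoincare

variable {n : ℕ}

/-- The surface measure of the unit sphere of `ℝⁿ`. -/
noncomputable abbrev sphereMeasure (n : ℕ) :
    Measure (Metric.sphere (0 : EuclideanSpace ℝ (Fin n)) 1) :=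
  (volume : Measure (EuclideanSpace ℝ (Fin n))).toSphere

theorem sphereMeasure_real_univ_pos [NeZero n] : 0 < (sphereMeasure n).real Set.univ := by
  have : NeZero (sphereMeasure n) := ⟨Measure.toSphere_ne_zero _⟩
  exact measureReal_univ_pos

theorem integrable_sphere {f : EuclideanSpace ℝ (Fin n) → ℝ} (hf : Continuous f) :
    Integrable (fun θ : Metric.sphere (0 : EuclideanSpace ℝ (Fin n)) 1 => f θ)
      (sphereMeasure n) :=
  (hf.comp continuous_subtype_val).integrable_of_hasCompactSupport
    (HasCompactSupport.of_compactSpace _)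

/-- No integrability is required. Thus, when the right side is nonzero, the integrand on the left
must be integrable, since otherwise its integral would be `0`; integrability of the density and of
`‖x‖ ^ 2` is obtained in this way. -/
theorem integral_radial_prod [NeZero n] (α : ℝ) (u : EuclideanSpace ℝ (Fin n) → ℝ) (v : ℝ → ℝ) :
    ∫ x, u (‖x‖⁻¹ • x) * v ‖x‖ * Real.exp (-(‖x‖ ^ α) / α) =
      (∫ θ : Metric.sphere (0 : EuclideanSpace ℝ (Fin n)) 1, u θ ∂(sphereMeasure n)) *
        ∫ r in Set.Ioi 0, v r * radialWeight (n - 1) α r := by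
  have hn : 1 ≤ n := NeZero.one_le
  rw [integral_polar]
  have h1 : ∫ r in Set.Ioi 0, v r * radialWeight (n - 1) α r =
      ∫ r : Set.Ioi (0 : ℝ), v r * Real.exp (-((r : ℝ) ^ α) / α)
        ∂(Measure.volumeIoiPow (n - 1)) := by
    rw [integral_volumeIoiPow (n - 1) fun r => v r * Real.exp (-(r ^ α) / α)]
    refine integral_congr_ae (.of_forall fun r => ?_)
    have h2 : ((n : ℝ) - 1) = ((n - 1 : ℕ) : ℝ) := by push_cast [hn]; ring
    simp only [radialWeight, h2, Real.rpow_natCast]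
    ring
  rw [h1, ← integral_prod_mul]
  refine integral_congr_ae (.of_forall fun p => ?_)
  have hp : 0 < (p.2 : ℝ) := p.2.2
  have hθ : ‖(p.1 : EuclideanSpace ℝ (Fin n))‖ = 1 := by simp
  have hnorm : ‖(p.2 : ℝ) • (p.1 : EuclideanSpace ℝ (Fin n))‖ = p.2 := by
    rw [norm_smul, hθ, mul_one, Real.norm_of_nonneg hp.le]
  simp only [hnorm, smul_smul, inv_mul_cancel₀ hp.ne', one_smul]
  ring

/-- The function `r` is unbounded, so the Gaussian inequality is first applied with the bounded `r /
(1 + ε r)`. This lemma lets `ε` tend to `0`, with domination by `r ^ 2`. -/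
theorem tendsto_integral_regularized {m α : ℝ} (hm : -1 < m) (hα : 0 < α) :
    Tendsto (fun k : ℕ => ∫ r in Set.Ioi 0, (r / (1 + 1 / ((k : ℝ) + 1) * r)) ^ 2 *
      radialWeight m α r) atTop (𝓝 (∫ r in Set.Ioi 0, r ^ 2 * radialWeight m α r)) := by
  have hw : ContinuousOn (radialWeight m α) (Set.Ioi 0) := by
    intro r hr
    have hr : (0 : ℝ) < r := hr
    unfold radialWeight
    exact ((Real.continuousAt_rpow_const _ _ (Or.inl hr.ne')).mul
      (((Real.continuousAt_rpow_const _ _ (Or.inl hr.ne')).neg.div_const _).rexp)).continuousWithinAt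
  have hi : IntegrableOn (fun r => r ^ 2 * radialWeight m α r) (Set.Ioi 0) := by
    have := integrableOn_rpow_mul_radialWeight (p := 2) (m := m) (by linarith) hα
    simpa using this
  refine tendsto_integral_of_dominated_convergence (fun r => r ^ 2 * radialWeight m α r)
    (fun k => ?_) hi (fun k => ?_) ?_
  · refine ContinuousOn.aestronglyMeasurable ?_ measurableSet_Ioi
    refine ContinuousOn.mul (ContinuousOn.pow (continuousOn_id.div (by fun_prop) ?_) 2) hw
    intro r hr
    have hr : (0 : ℝ) < r := hr
    positivity
  · filter_upwards [ae_restrict_mem measurableSet_Ioi] with r hr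
    have hr : (0 : ℝ) < r := hr
    rw [Real.norm_of_nonneg (mul_nonneg (sq_nonneg _) (radialWeight_pos hr).le)]
    refine mul_le_mul_of_nonneg_right ?_ (radialWeight_pos hr).le
    refine pow_le_pow_left₀ (by positivity) (div_le_self hr.le ?_) 2
    have : 0 ≤ 1 / ((k : ℝ) + 1) * r := by positivity
    linarith
  · filter_upwards [ae_restrict_mem measurableSet_Ioi] with r hr
    have h1 : Tendsto (fun k : ℕ => 1 + 1 / ((k : ℝ) + 1) * r) atTop (𝓝 (1 + 0 * r)) :=
      (tendsto_one_div_add_atTop_nhds_zero_nat.mul_const r).const_add 1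
    have h2 := ((tendsto_const_nhds (x := r)).div h1 (by simp)).pow 2
    simpa using h2.mul_const (radialWeight m α r)

theorem secondMoment_two {n : ℝ} (hn : 0 < n) : secondMoment n 2 = n := by
  have h : (n + 2) / 2 = n / 2 + 1 := by ring
  have h2 : Real.Gamma (n / 2) ≠ 0 := (Real.Gamma_pos_of_pos (by positivity)).ne'
  rw [secondMoment, h, Real.Gamma_add_one (by positivity)]
  norm_num
  field_simp

theorem inner_sq_le_norm_sq {θ G : EuclideanSpace ℝ (Fin n)} (hθ : ‖θ‖ = 1) :
    inner ℝ θ G ^ 2 ≤ ‖G‖ ^ 2 := by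
  have := abs_real_inner_le_norm θ G
  rw [hθ, one_mul] at this
  exact sq_le_sq' (abs_le.1 this).1 (abs_le.1 this).2

/-- Spherical functions with zero mean, tested against a regularization of the norm in the
Gaussian Poincaré inequality. -/
theorem sphere_regularized (hn : 2 ≤ n) {F : EuclideanSpace ℝ (Fin n) → ℝ} (hF : ContDiff ℝ 1 F)
    (h0 : ∫ θ : Metric.sphere (0 : EuclideanSpace ℝ (Fin n)) 1, F θ ∂(sphereMeasure n) = 0)
    {ε : ℝ} (hε : 0 < ε) :
    (∫ θ : Metric.sphere (0 : EuclideanSpace ℝ (Fin n)) 1, F θ ^ 2 ∂(sphereMeasure n)) *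
      (∫ r in Set.Ioi 0, (r / (1 + ε * r)) ^ 2 * radialWeight (n - 1) 2 r) ≤
    (∫ θ : Metric.sphere (0 : EuclideanSpace ℝ (Fin n)) 1,
      (F θ ^ 2 + (‖∇ F θ‖ ^ 2 - inner ℝ (θ : EuclideanSpace ℝ (Fin n)) (∇ F θ) ^ 2))
        ∂(sphereMeasure n)) * ∫ r in Set.Ioi 0, radialWeight (n - 1) 2 r := by
  have : NeZero n := ⟨by omega⟩
  have hFd : Differentiable ℝ F := hF.differentiable (by simp)
  have hgc : Continuous (∇ F) := by
    have := (InnerProductSpace.toDual ℝ (EuclideanSpace ℝ (Fin n))).symm.continuous.comp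
      (hF.continuous_fderiv (by simp))
    exact this
  obtain ⟨B, hB⟩ := (isCompact_closedBall (0 : EuclideanSpace ℝ (Fin n)) 1).exists_bound_of_continuousOn
    hF.continuous.continuousOn
  obtain ⟨B', hB'⟩ := (isCompact_closedBall (0 : EuclideanSpace ℝ (Fin n)) 1).exists_bound_of_continuousOn
    hgc.continuousOn
  have hu : ∀ x : EuclideanSpace ℝ (Fin n), ‖x‖⁻¹ • x ∈ Metric.closedBall 0 1 := by
    intro x
    rw [mem_closedBall_zero_iff, norm_smul, norm_inv, norm_norm]
    exact inv_mul_le_one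
  have hB0 : 0 ≤ B := (norm_nonneg _).trans (hB 0 (by simp))
  have hB0' : 0 ≤ B' := (norm_nonneg _).trans (hB' 0 (by simp))
  -- Both `R'` and `R r / r` lie in `[0, 1]` for `r > 0`, so the squared gradient of `R(r) F(θ)` is
  -- at most `F ^ 2` plus the squared tangential gradient of `F`, with no dependence on `r`.
  set R : ℝ → ℝ := fun r => r / (1 + ε * r) with hR
  have hpos : ∀ x : EuclideanSpace ℝ (Fin n), 0 < 1 + ε * ‖x‖ := fun x => by positivity
  have hRd : ∀ r, 0 < r → HasDerivAt R (1 / (1 + ε * r) ^ 2) r := by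
    intro r hr
    have h1 : 1 + ε * r ≠ 0 := by positivity
    have := (hasDerivAt_id r).div (((hasDerivAt_id r).const_mul ε).const_add 1) h1
    refine this.congr_deriv ?_
    simp
    ring
  have hR1 : ∀ r, 0 < r → (1 / (1 + ε * r) ^ 2) ^ 2 ≤ 1 := by
    intro r hr
    have h1 : 1 ≤ 1 + ε * r := by nlinarith
    refine pow_le_one₀ (by positivity) ((div_le_one (by positivity)).2 (one_le_pow₀ h1))
  have hR2 : ∀ r, 0 < r → (R r / r) ^ 2 ≤ 1 := by
    intro r hr
    have h1 : 1 ≤ 1 + ε * r := by nlinarith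
    have : R r / r = 1 / (1 + ε * r) := by simp only [hR]; field_simp
    rw [this]
    exact pow_le_one₀ (by positivity) ((div_le_one (by positivity)).2 h1)
  set g : EuclideanSpace ℝ (Fin n) → ℝ := fun y => R ‖y‖ * F (‖y‖⁻¹ • y) with hg
  have hgrad : ∀ x ≠ 0, HasGradientAt g _ x := fun x hx =>
    hasGradientAt_radial_mul hFd hx rfl (hRd ‖x‖ (norm_pos_iff.2 hx))
  set Q : EuclideanSpace ℝ (Fin n) → ℝ := fun θ =>
    F θ ^ 2 + (‖∇ F θ‖ ^ 2 - inner ℝ θ (∇ F θ) ^ 2) with hQ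
  have hgQ : ∀ x ≠ 0, ‖∇ g x‖ ^ 2 ≤ Q (‖x‖⁻¹ • x) := by
    intro x hx
    have hx0 := norm_pos_iff.2 hx
    have h1 : ‖‖x‖⁻¹ • x‖ = 1 := by
      rw [norm_smul, norm_inv, norm_norm, inv_mul_cancel₀ hx0.ne']
    rw [(hgrad x hx).gradient, norm_sq_radial_tangential h1, mul_pow]
    refine add_le_add (mul_le_of_le_one_left (sq_nonneg _) (hR1 _ hx0))
      (mul_le_of_le_one_left (sub_nonneg.2 (inner_sq_le_norm_sq h1)) (hR2 _ hx0))
  have hQB : ∀ x : EuclideanSpace ℝ (Fin n), Q (‖x‖⁻¹ • x) ≤ (B + B') ^ 2 := by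
    intro x
    have h1 := hB _ (hu x)
    have h2 := hB' _ (hu x)
    have h3 : F (‖x‖⁻¹ • x) ^ 2 ≤ B ^ 2 := sq_le_sq' (abs_le.1 h1).1 (abs_le.1 h1).2
    have h4 : ‖∇ F (‖x‖⁻¹ • x)‖ ^ 2 ≤ B' ^ 2 := pow_le_pow_left₀ (norm_nonneg _) h2 2
    simp only [hQ]
    nlinarith [sq_nonneg (inner ℝ (‖x‖⁻¹ • x) (∇ F (‖x‖⁻¹ • x)) : ℝ), mul_nonneg hB0 hB0']
  have hgm : Measurable g := by
    have h1 : Measurable R := measurable_id.div (measurable_const.add (measurable_id.const_mul ε))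
    exact (h1.comp measurable_norm).mul
      (hF.continuous.measurable.comp (measurable_norm.inv.smul measurable_id))
  have hgb : ∀ x, |g x| ≤ B / ε + (B + B') := by
    intro x
    have h1 : |R ‖x‖| ≤ 1 / ε := by
      rw [abs_of_nonneg (div_nonneg (norm_nonneg _) (hpos x).le), div_le_div_iff₀ (hpos x) hε]
      nlinarith [norm_nonneg x]
    calc |g x| = |R ‖x‖| * |F (‖x‖⁻¹ • x)| := abs_mul _ _
      _ ≤ 1 / ε * B := mul_le_mul h1 (hB _ (hu x)) (abs_nonneg _) (by positivity)
      _ = B / ε := by ring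
      _ ≤ _ := by linarith
  have key := gaussian_poincare hn hgm hgb (fun x hx => (hgrad x hx).differentiableAt)
    (fun x hx => by
      have h1 : ‖∇ g x‖ ≤ B + B' :=
        abs_le_of_sq_le_sq' ((hgQ x hx).trans (hQB x)) (by positivity) |>.2
      have : 0 ≤ B / ε := by positivity
      linarith)
  have hα : (0 : ℝ) < 2 := two_pos
  have hm : (-1 : ℝ) < (n : ℝ) - 1 := by
    have : (2 : ℝ) ≤ n := by exact_mod_cast hn
    linarith
  have e1 := integral_radial_prod (n := n) 2 (fun _ => 1) (fun _ => 1)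
  have e2 := integral_radial_prod (n := n) 2 (fun θ => F θ ^ 2) (fun r => R r ^ 2)
  have e3 := integral_radial_prod (n := n) 2 F R
  have e4 := integral_radial_prod (n := n) 2 Q (fun _ => 1)
  simp only [one_mul, mul_one, integral_const, smul_eq_mul] at e1 e4
  have hw := integral_radialWeight_pos (m := (n : ℝ) - 1) hm hα
  have hS := sphereMeasure_real_univ_pos (n := n)
  have hGi : Integrable fun x : EuclideanSpace ℝ (Fin n) => Real.exp (-(‖x‖ ^ (2 : ℝ)) / 2) := by
    by_contra hni
    rw [integral_undef hni] at e1
    exact (mul_pos hS hw).ne e1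
  have hle : ∫ x, ‖∇ g x‖ ^ 2 * Real.exp (-(‖x‖ ^ (2 : ℝ)) / 2) ≤
      ∫ x, Q (‖x‖⁻¹ • x) * Real.exp (-(‖x‖ ^ (2 : ℝ)) / 2) := by
    refine integral_mono_of_nonneg (.of_forall fun x => by positivity) ?_ ?_
    · refine hGi.bdd_mul (c := (B + B') ^ 2) ?_ (.of_forall fun x => ?_)
      · have hQc : Continuous Q := by
          have := hF.continuous
          fun_prop
        exact (hQc.measurable.comp
          (measurable_norm.inv.smul measurable_id)).aestronglyMeasurable
      · rw [Real.norm_of_nonneg]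
        · exact hQB x
        · by_cases hx : x = 0
          · simp only [hQ, hx, smul_zero, inner_zero_left, ne_eq, OfNat.ofNat_ne_zero,
              not_false_eq_true, zero_pow, sub_zero]
            positivity
          · exact (sq_nonneg _).trans (hgQ x hx)
    · filter_upwards [compl_mem_ae_iff.2
        (measure_singleton (μ := volume) (0 : EuclideanSpace ℝ (Fin n)))] with x hx
      exact mul_le_mul_of_nonneg_right (hgQ x hx) (Real.exp_pos _).le
  have e2' : ∫ x, g x ^ 2 * Real.exp (-(‖x‖ ^ (2 : ℝ)) / 2) =
      (∫ θ : Metric.sphere (0 : EuclideanSpace ℝ (Fin n)) 1, F θ ^ 2 ∂(sphereMeasure n)) *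
        ∫ r in Set.Ioi 0, R r ^ 2 * radialWeight (n - 1) 2 r := by
    rw [← e2]
    exact integral_congr_ae (.of_forall fun x => by simp only [hg]; ring)
  have e3' : ∫ x, g x * Real.exp (-(‖x‖ ^ (2 : ℝ)) / 2) = 0 := by
    rw [h0, zero_mul] at e3
    rw [← e3]
    exact integral_congr_ae (.of_forall fun x => by simp only [hg]; ring)
  rw [e2', e3', e1] at key
  have hI := mul_pos hS hw
  refine le_of_mul_le_mul_left ?_ hI
  rw [← e4]
  linarith [mul_le_mul_of_nonneg_left hle hI.le]

/-- The Poincaré inequality on the unit sphere. -/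
theorem sphere_poincare (hn : 2 ≤ n) {φ : EuclideanSpace ℝ (Fin n) → ℝ} (hφ : ContDiff ℝ 1 φ) :
    ((n : ℝ) - 1) * ((sphereMeasure n).real Set.univ *
      (∫ θ : Metric.sphere (0 : EuclideanSpace ℝ (Fin n)) 1, φ θ ^ 2 ∂(sphereMeasure n)) -
      (∫ θ : Metric.sphere (0 : EuclideanSpace ℝ (Fin n)) 1, φ θ ∂(sphereMeasure n)) ^ 2) ≤
    (sphereMeasure n).real Set.univ * ∫ θ : Metric.sphere (0 : EuclideanSpace ℝ (Fin n)) 1,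
      (‖∇ φ θ‖ ^ 2 - inner ℝ (θ : EuclideanSpace ℝ (Fin n)) (∇ φ θ) ^ 2) ∂(sphereMeasure n) := by
  have : NeZero n := ⟨by omega⟩
  have hn2 : (2 : ℝ) ≤ n := by exact_mod_cast hn
  have hS := sphereMeasure_real_univ_pos (n := n)
  set S := (sphereMeasure n).real Set.univ with hSdef
  set a := ∫ θ : Metric.sphere (0 : EuclideanSpace ℝ (Fin n)) 1, φ θ ∂(sphereMeasure n) with ha
  set F : EuclideanSpace ℝ (Fin n) → ℝ := fun x => φ x - a / S with hF
  have hFc : ContDiff ℝ 1 F := hφ.sub contDiff_const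
  have hgrad : ∇ F = ∇ φ := by
    ext x : 1
    simp only [gradient, hF, fderiv_sub_const]
  have hgc : Continuous (∇ φ) := by
    have := (InnerProductSpace.toDual ℝ (EuclideanSpace ℝ (Fin n))).symm.continuous.comp
      (hφ.continuous_fderiv (by simp))
    exact this
  have i1 := integrable_sphere hφ.continuous
  have i2 : Integrable (fun θ : Metric.sphere (0 : EuclideanSpace ℝ (Fin n)) 1 => φ θ ^ 2)
      (sphereMeasure n) := integrable_sphere (hφ.continuous.pow 2)
  have i3 : Integrable (fun θ : Metric.sphere (0 : EuclideanSpace ℝ (Fin n)) 1 => F θ ^ 2)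
      (sphereMeasure n) := integrable_sphere (hFc.continuous.pow 2)
  have i4 : Integrable (fun θ : Metric.sphere (0 : EuclideanSpace ℝ (Fin n)) 1 =>
      ‖∇ φ θ‖ ^ 2 - inner ℝ (θ : EuclideanSpace ℝ (Fin n)) (∇ φ θ) ^ 2) (sphereMeasure n) :=
    integrable_sphere (f := fun θ => ‖∇ φ θ‖ ^ 2 - inner ℝ θ (∇ φ θ) ^ 2) (by fun_prop)
  have h0 : ∫ θ : Metric.sphere (0 : EuclideanSpace ℝ (Fin n)) 1, F θ ∂(sphereMeasure n) = 0 := by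
    simp only [hF]
    rw [integral_sub i1 (integrable_const _), integral_const, smul_eq_mul, ← ha, ← hSdef]
    field_simp
    simp
  have h2 : ∫ θ : Metric.sphere (0 : EuclideanSpace ℝ (Fin n)) 1, F θ ^ 2 ∂(sphereMeasure n) =
      (∫ θ : Metric.sphere (0 : EuclideanSpace ℝ (Fin n)) 1, φ θ ^ 2 ∂(sphereMeasure n)) -
        a ^ 2 / S := by
    have : ∀ θ : Metric.sphere (0 : EuclideanSpace ℝ (Fin n)) 1,
        F θ ^ 2 = φ θ ^ 2 - a / S * F θ - a / S * φ θ := fun θ => by simp only [hF]; ring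
    simp only [this]
    have i5 : Integrable (fun θ : Metric.sphere (0 : EuclideanSpace ℝ (Fin n)) 1 =>
      a / S * F θ) (sphereMeasure n) := (integrable_sphere hFc.continuous).const_mul _
    have i6 : Integrable (fun θ : Metric.sphere (0 : EuclideanSpace ℝ (Fin n)) 1 =>
      φ θ ^ 2 - a / S * F θ) (sphereMeasure n) := i2.sub i5
    rw [integral_sub i6 (i1.const_mul _), integral_sub i2 i5, integral_const_mul,
      integral_const_mul, h0, ← ha]
    ring
  have hw := integral_radialWeight_pos (m := (n : ℝ) - 1) (α := 2) (by linarith) two_pos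
  -- In the limit `∫ r ^ 2 w = n ∫ w`, hence `n ∫ F ^ 2 ≤ ∫ F ^ 2 + ∫ |∇_tan F| ^ 2`. The radial
  -- derivative contributes the term `∫ F ^ 2`, which turns `n` into `n - 1`.
  have hlim := le_of_tendsto' ((tendsto_integral_regularized (m := (n : ℝ) - 1) (α := 2)
    (by linarith) two_pos).const_mul _) fun k : ℕ =>
      sphere_regularized hn hFc h0 (ε := 1 / ((k : ℝ) + 1)) (by positivity)
  rw [integral_sq_mul_radialWeight (by linarith) two_pos, sub_add_cancel,
    secondMoment_two (by linarith), ← mul_assoc] at hlim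
  have hlim := le_of_mul_le_mul_right hlim hw
  rw [hgrad, integral_add i3 i4, h2] at hlim
  have h5 := mul_le_mul_of_nonneg_left hlim hS.le
  field_simp at h5 ⊢
  linarith

end SpherePoincare

/-! ### Combining angular and radial inequalities -/

section PolarPoincare

/-- The measure on `(0, ∞)` with density the radial weight. -/
noncomputable def radialMeasure (m α : ℝ) : Measure ℝ :=
  (volume.restrict (Set.Ioi 0)).withDensity fun r => ENNReal.ofReal (radialWeight m α r)

variable {m α : ℝ}

theorem measurable_radialWeight : Measurable (radialWeight m α) := by
  unfold radialWeight
  fun_prop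

theorem integral_radialMeasure (f : ℝ → ℝ) :
    ∫ r, f r ∂(radialMeasure m α) = ∫ r in Set.Ioi 0, f r * radialWeight m α r := by
  rw [radialMeasure, integral_withDensity_eq_integral_toReal_smul
    measurable_radialWeight.ennreal_ofReal (.of_forall fun x => by simp)]
  refine setIntegral_congr_fun measurableSet_Ioi fun r hr => ?_
  simp only [ENNReal.toReal_ofReal (radialWeight_pos hr).le, smul_eq_mul, mul_comm]

theorem isFiniteMeasure_radialMeasure (hm : -1 < m) (hα : 0 < α) :
    IsFiniteMeasure (radialMeasure m α) :=
  isFiniteMeasure_withDensity_ofReal (integrableOn_radialWeight hm hα).2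

theorem ae_pos_radialMeasure : ∀ᵐ r ∂(radialMeasure m α), 0 < r :=
  (withDensity_absolutelyContinuous _ _).ae_le (ae_restrict_mem measurableSet_Ioi)

variable {Θ : Type*} [MeasurableSpace Θ]

theorem abs_average_le {σ : Measure Θ} [IsFiniteMeasure σ] (hS : 0 < σ.real Set.univ)
    {f : Θ → ℝ} {B : ℝ} (hB : ∀ θ, |f θ| ≤ B) : |(∫ θ, f θ ∂σ) / σ.real Set.univ| ≤ B := by
  rw [abs_div, abs_of_pos hS, div_le_iff₀ hS]
  simpa using norm_integral_le_of_norm_le_const (μ := σ) (f := f) (.of_forall hB)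

theorem integral_sq_sub_average {σ : Measure Θ} [IsFiniteMeasure σ] (hS : 0 < σ.real Set.univ)
    {f : Θ → ℝ} (hf : Measurable f) {B : ℝ} (hB : ∀ θ, |f θ| ≤ B) :
    ∫ θ, (f θ - (∫ θ, f θ ∂σ) / σ.real Set.univ) ^ 2 ∂σ =
      (∫ θ, f θ ^ 2 ∂σ) - σ.real Set.univ * ((∫ θ, f θ ∂σ) / σ.real Set.univ) ^ 2 := by
  set S := σ.real Set.univ with hSd
  set A := (∫ θ, f θ ∂σ) / S with hA
  have hfi := integrable_of_bdd (μ := σ) hf hB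
  have hf2 : Integrable (fun θ => f θ ^ 2) σ := integrable_of_bdd (hf.pow_const 2)
    fun θ => abs_sq_le_of_abs_le (hB θ)
  have h1 : ∀ θ, (f θ - A) ^ 2 = f θ ^ 2 - (2 * A * f θ - A ^ 2) := fun θ => by ring
  have hi : Integrable (fun θ => 2 * A * f θ - A ^ 2) σ :=
    (hfi.const_mul _).sub (integrable_const _)
  simp only [h1]
  rw [integral_sub hf2 hi,
    integral_sub (hfi.const_mul _) (integrable_const _), integral_const_mul, integral_const,
    smul_eq_mul, ← hSd]
  have h2 : ∫ θ, f θ ∂σ = S * A := by rw [hA]; field_simp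
  rw [h2]
  ring

theorem hasDerivAt_average {σ : Measure Θ} [IsFiniteMeasure σ] {f fr : Θ → ℝ → ℝ} {B : ℝ}
    (hf : ∀ r, Measurable fun θ => f θ r) (hfr : ∀ r, Measurable fun θ => fr θ r)
    (hfB : ∀ θ r, |f θ r| ≤ B) (hfrB : ∀ θ r, |fr θ r| ≤ B)
    (hd : ∀ θ r, HasDerivAt (f θ) (fr θ r) r) (r : ℝ) :
    HasDerivAt (fun r => (∫ θ, f θ r ∂σ) / σ.real Set.univ)
      ((∫ θ, fr θ r ∂σ) / σ.real Set.univ) r :=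
  ((hasDerivAt_integral_of_dominated_loc_of_deriv_le (μ := σ) (F := fun r θ => f θ r)
    (F' := fun r θ => fr θ r) (bound := fun _ => B) univ_mem
    (.of_forall fun r => (hf r).aestronglyMeasurable) (integrable_of_bdd (hf r) fun θ => hfB θ r)
    (hfr r).aestronglyMeasurable (.of_forall fun θ r _ => hfrB θ r) (integrable_const _)
    (.of_forall fun θ r _ => hd θ r)).2).div_const _

/-- Poincaré inequality in polar coordinates: a spectral inequality in the angular variable
and radial inequalities combine to a Poincaré inequality for the product. -/
theorem polar_poincare (σ : Measure Θ) [IsFiniteMeasure σ] (hS : 0 < σ.real Set.univ) {c : ℝ}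
    (hm : 1 ≤ m) (hα : 1 ≤ α) (hH : RadialHardy m α c) (hP : RadialPoincare m α c)
    {f fr N : Θ → ℝ → ℝ} (hf : Measurable fun p : Θ × ℝ => f p.1 p.2)
    (hfr : Measurable fun p : Θ × ℝ => fr p.1 p.2) (hN : Measurable fun p : Θ × ℝ => N p.1 p.2)
    {B : ℝ} (hfB : ∀ θ r, |f θ r| ≤ B) (hfrB : ∀ θ r, |fr θ r| ≤ B) (hNB : ∀ θ r, |N θ r| ≤ B)
    (hd : ∀ θ r, HasDerivAt (f θ) (fr θ r) r) {a : ℝ} (ha : ∀ θ r, |f θ r - a| ≤ B * |r|)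
    (hsph : ∀ r, 0 < r → m * (σ.real Set.univ * (∫ θ, f θ r ^ 2 ∂σ) - (∫ θ, f θ r ∂σ) ^ 2) ≤
      σ.real Set.univ * (r ^ 2 * ∫ θ, (N θ r - fr θ r ^ 2) ∂σ)) :
    c * (σ.real Set.univ * (∫ r in Set.Ioi 0, radialWeight m α r) *
        (∫ p, f p.1 p.2 ^ 2 ∂(σ.prod (radialMeasure m α))) -
        (∫ p, f p.1 p.2 ∂(σ.prod (radialMeasure m α))) ^ 2) ≤
      σ.real Set.univ * (∫ r in Set.Ioi 0, radialWeight m α r) *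
        ∫ p, N p.1 p.2 ∂(σ.prod (radialMeasure m α)) := by
  have hfin := isFiniteMeasure_radialMeasure (m := m) (α := α) (by linarith) (by linarith)
  obtain ⟨θ₀⟩ : Nonempty Θ := by
    by_contra hne
    rw [not_nonempty_iff] at hne
    rw [Measure.eq_zero_of_isEmpty σ] at hS
    simp at hS
  have hB0 : 0 ≤ B := (abs_nonneg _).trans (hfB θ₀ 0)
  set ν := radialMeasure m α with hν
  set ρ := σ.prod ν with hρ
  set S := σ.real Set.univ with hSd
  -- The spherical average; `q = f - A` has zero mean on each sphere, so the cross terms between `A`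
  -- and `q` vanish, both in `L²` and in the radial energy.
  set A : ℝ → ℝ := fun r => (∫ θ, f θ r ∂σ) / S with hA
  set A' : ℝ → ℝ := fun r => (∫ θ, fr θ r ∂σ) / S with hA'
  have hfs : ∀ r, Measurable fun θ => f θ r := fun r => hf.comp measurable_prodMk_right
  have hfrs : ∀ r, Measurable fun θ => fr θ r := fun r => hfr.comp measurable_prodMk_right
  have hAd : ∀ r, HasDerivAt A (A' r) r := hasDerivAt_average hfs hfrs hfB hfrB hd
  have hAB : ∀ r, |A r| ≤ B := fun r => abs_average_le hS fun θ => hfB θ r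
  have hA'B : ∀ r, |A' r| ≤ B := fun r => abs_average_le hS fun θ => hfrB θ r
  have hAm : Measurable A := (continuous_iff_continuousAt.2 fun r =>
    (hAd r).continuousAt).measurable
  have hA'm : Measurable A' := by
    have : A' = deriv A := funext fun r => (hAd r).deriv.symm
    rw [this]
    exact measurable_deriv A
  have hAa : ∀ r, |A r - a| ≤ B * |r| := by
    intro r
    have h1 := abs_average_le hS fun θ => ha θ r
    rwa [integral_sub (integrable_of_bdd (hfs r) fun θ => hfB θ r) (integrable_const _),
      integral_const, smul_eq_mul, sub_div, ← hSd, mul_div_cancel_left₀ _ hS.ne'] at h1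
  have hq2 : ∀ r, ∫ θ, (f θ r - A r) ^ 2 ∂σ = (∫ θ, f θ r ^ 2 ∂σ) - S * A r ^ 2 := fun r =>
    integral_sq_sub_average hS (hfs r) fun θ => hfB θ r
  have hqr2 : ∀ r, ∫ θ, (fr θ r - A' r) ^ 2 ∂σ = (∫ θ, fr θ r ^ 2 ∂σ) - S * A' r ^ 2 := fun r =>
    integral_sq_sub_average hS (hfrs r) fun θ => hfrB θ r
  have hqB : ∀ θ r, |f θ r - A r| ≤ 2 * B := fun θ r =>
    (abs_sub _ _).trans (by linarith [hfB θ r, hAB r])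
  have hqrB : ∀ θ r, |fr θ r - A' r| ≤ 2 * B := fun θ r =>
    (abs_sub _ _).trans (by linarith [hfrB θ r, hA'B r])
  -- All rays start from the common value `a` at the origin, hence so does the average, and `q =
  -- O(r)` as the Hardy inequality requires.
  have hqr : ∀ θ r, |f θ r - A r| ≤ 2 * B * |r| := by
    intro θ r
    have : f θ r - A r = (f θ r - a) - (A r - a) := by ring
    rw [this]
    exact (abs_sub _ _).trans (by linarith [ha θ r, hAa r])
  have hqm : Measurable fun p : Θ × ℝ => f p.1 p.2 - A p.2 := hf.sub (hAm.comp measurable_snd)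
  have hqrm : Measurable fun p : Θ × ℝ => fr p.1 p.2 - A' p.2 :=
    hfr.sub (hA'm.comp measurable_snd)
  have hqd : ∀ θ r, HasDerivAt (fun r => f θ r - A r) (fr θ r - A' r) r := fun θ r =>
    (hd θ r).sub (hAd r)
  have i1 : Integrable (fun p : Θ × ℝ => (f p.1 p.2 - A p.2) ^ 2) ρ :=
    integrable_of_bdd (hqm.pow_const 2) fun p => abs_sq_le_of_abs_le (hqB _ _)
  have i2 : Integrable (fun p : Θ × ℝ => (fr p.1 p.2 - A' p.2) ^ 2) ρ :=
    integrable_of_bdd (hqrm.pow_const 2) fun p => abs_sq_le_of_abs_le (hqrB _ _)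
  have i3 : Integrable (fun p : Θ × ℝ => (f p.1 p.2 - A p.2) ^ 2 * (m / p.2 ^ 2)) ρ := by
    refine integrable_of_bdd (C := (2 * B) ^ 2 * m) ((hqm.pow_const 2).mul
      (measurable_const.div (measurable_snd.pow_const 2))) fun p => ?_
    rcases eq_or_ne p.2 0 with h0 | h0
    · rw [h0]
      simp
      positivity
    · rw [abs_of_nonneg (by positivity), mul_div_assoc', div_le_iff₀ (by positivity)]
      have h1 := abs_sq_le_of_abs_le (hqr p.1 p.2)
      rw [abs_of_nonneg (sq_nonneg _), mul_pow, sq_abs] at h1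
      nlinarith [mul_le_mul_of_nonneg_right h1 (by linarith : 0 ≤ m)]
  have i4 : Integrable (fun p : Θ × ℝ => f p.1 p.2 ^ 2) ρ :=
    integrable_of_bdd (hf.pow_const 2) fun p => abs_sq_le_of_abs_le (hfB _ _)
  have i5 : Integrable (fun p : Θ × ℝ => fr p.1 p.2 ^ 2) ρ :=
    integrable_of_bdd (hfr.pow_const 2) fun p => abs_sq_le_of_abs_le (hfrB _ _)
  have i6 : Integrable (fun p : Θ × ℝ => N p.1 p.2) ρ := integrable_of_bdd hN fun p => hNB _ _
  have i7 : Integrable (fun p : Θ × ℝ => f p.1 p.2) ρ := integrable_of_bdd hf fun p => hfB _ _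
  have j1 : Integrable (fun r => A r ^ 2) ν :=
    integrable_of_bdd (hAm.pow_const 2) fun r => abs_sq_le_of_abs_le (hAB r)
  have j2 : Integrable (fun r => A' r ^ 2) ν :=
    integrable_of_bdd (hA'm.pow_const 2) fun r => abs_sq_le_of_abs_le (hA'B r)
  -- The Hardy inequality along each ray, integrated over the angle.
  have H1 : c * ∫ p, (f p.1 p.2 - A p.2) ^ 2 ∂ρ ≤ (∫ p, (fr p.1 p.2 - A' p.2) ^ 2 ∂ρ) +
      ∫ p, (f p.1 p.2 - A p.2) ^ 2 * (m / p.2 ^ 2) ∂ρ := by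
    rw [integral_prod _ i1, integral_prod _ i2, integral_prod _ i3, ← integral_const_mul,
      ← integral_add i2.integral_prod_left i3.integral_prod_left]
    refine integral_mono (i1.integral_prod_left.const_mul _)
      (i2.integral_prod_left.add i3.integral_prod_left) fun θ => ?_
    have hlip : IsBoundedLipZero fun r => f θ r - A r := by
      refine ⟨⟨2 * B, fun r _ => ⟨(hqd θ r).differentiableAt, hqB θ r, ?_⟩⟩, 2 * B,
        fun r hr => ?_⟩
      · rw [(hqd θ r).deriv]
        exact hqrB θ r
      · have := hqr θ r
        rwa [abs_of_pos hr] at this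
    have h := hH _ hlip
    simp only [(hqd θ _).deriv] at h
    simp only [hν, integral_radialMeasure]
    exact h
  -- The angular inequality at each radius bounds the potential term by the tangential energy, which
  -- is the full energy `N` minus the radial part.
  have H2 : ∫ p, (f p.1 p.2 - A p.2) ^ 2 * (m / p.2 ^ 2) ∂ρ ≤
      (∫ p, N p.1 p.2 ∂ρ) - ∫ p, fr p.1 p.2 ^ 2 ∂ρ := by
    have i8 : Integrable (fun p : Θ × ℝ => N p.1 p.2 - fr p.1 p.2 ^ 2) ρ := i6.sub i5
    rw [← integral_sub i6 i5, integral_prod_symm _ i3, integral_prod_symm _ i8]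
    refine integral_mono_ae i3.integral_prod_right i8.integral_prod_right ?_
    filter_upwards [ae_pos_radialMeasure] with r hr
    have h := hsph r hr
    rw [integral_mul_const, hq2]
    have h2 : ∫ θ, f θ r ∂σ = S * A r := by simp only [hA]; field_simp
    rw [h2] at h
    rw [mul_div_assoc', div_le_iff₀ (by positivity)]
    refine le_of_mul_le_mul_left ?_ hS
    linarith
  have H3 : ∫ p, (f p.1 p.2 - A p.2) ^ 2 ∂ρ =
      (∫ p, f p.1 p.2 ^ 2 ∂ρ) - S * ∫ r, A r ^ 2 ∂ν := by
    rw [integral_prod_symm _ i1, integral_prod_symm _ i4, ← integral_const_mul,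
      ← integral_sub i4.integral_prod_right (j1.const_mul _)]
    exact integral_congr_ae (.of_forall fun r => hq2 r)
  have H4 : ∫ p, (fr p.1 p.2 - A' p.2) ^ 2 ∂ρ =
      (∫ p, fr p.1 p.2 ^ 2 ∂ρ) - S * ∫ r, A' r ^ 2 ∂ν := by
    rw [integral_prod_symm _ i2, integral_prod_symm _ i5, ← integral_const_mul,
      ← integral_sub i5.integral_prod_right (j2.const_mul _)]
    exact integral_congr_ae (.of_forall fun r => hqr2 r)
  have H5 : ∫ p, f p.1 p.2 ∂ρ = S * ∫ r, A r ∂ν := by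
    rw [integral_prod_symm _ i7, ← integral_const_mul]
    refine integral_congr_ae (.of_forall fun r => ?_)
    simp only [hA]
    field_simp
  -- The Poincaré inequality for the average; with `H1` and `H2` it accounts for the whole variance
  -- and the whole energy.
  have H6 := hP A ⟨B, fun r _ => ⟨(hAd r).differentiableAt, hAB r, by
    rw [(hAd r).deriv]; exact hA'B r⟩⟩
  simp only [(hAd _).deriv] at H6
  rw [← integral_radialMeasure (fun r => A r ^ 2), ← integral_radialMeasure A,
    ← integral_radialMeasure (fun r => A' r ^ 2), ← hν] at H6
  have hI : 0 < ∫ r in Set.Ioi 0, radialWeight m α r :=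
    integral_radialWeight_pos (by linarith) (by linarith)
  rw [H5]
  rw [H3] at H1
  rw [H4] at H1
  have H7 := add_le_add H1 H2
  have H8 : c * ((∫ p, f p.1 p.2 ^ 2 ∂ρ) - S * ∫ r, A r ^ 2 ∂ν) ≤
      (∫ p, N p.1 p.2 ∂ρ) - S * ∫ r, A' r ^ 2 ∂ν := by linarith
  have H9 := mul_le_mul_of_nonneg_left H8 (mul_pos hS hI).le
  have H10 := mul_le_mul_of_nonneg_left H6 (mul_pos hS hS).le
  linarith

end PolarPoincare

/-! ### The Poincaré inequality for the exponential power weight -/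

section ExpPowerPoincare

variable {n : ℕ} {α : ℝ}

theorem integral_exp_neg_norm_rpow [NeZero n] :
    ∫ x : EuclideanSpace ℝ (Fin n), Real.exp (-(‖x‖ ^ α) / α) =
      (sphereMeasure n).real Set.univ * ∫ r in Set.Ioi 0, radialWeight (n - 1) α r := by
  have h := integral_radial_prod (n := n) α (fun _ => 1) (fun _ => 1)
  simpa using h

theorem neg_one_lt_natCast_sub_one [NeZero n] : (-1 : ℝ) < (n : ℝ) - 1 := by
  have : (0 : ℝ) < n := by exact_mod_cast NeZero.pos n
  linarith

theorem integral_exp_neg_norm_rpow_pos [NeZero n] (hα : 0 < α) :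
    0 < ∫ x : EuclideanSpace ℝ (Fin n), Real.exp (-(‖x‖ ^ α) / α) := by
  rw [integral_exp_neg_norm_rpow]
  exact mul_pos sphereMeasure_real_univ_pos
    (integral_radialWeight_pos neg_one_lt_natCast_sub_one hα)

theorem integrable_exp_neg_norm_rpow [NeZero n] (hα : 0 < α) :
    Integrable fun x : EuclideanSpace ℝ (Fin n) => Real.exp (-(‖x‖ ^ α) / α) := by
  by_contra h
  exact (integral_exp_neg_norm_rpow_pos hα).ne' (integral_undef h)

theorem integral_mul_exp_eq_polar [NeZero n] (hα : 0 < α) {f : EuclideanSpace ℝ (Fin n) → ℝ}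
    (hf : Continuous f) {B : ℝ} (hB : ∀ x, |f x| ≤ B) :
    ∫ x, f x * Real.exp (-(‖x‖ ^ α) / α) =
      ∫ p : Metric.sphere (0 : EuclideanSpace ℝ (Fin n)) 1 × ℝ,
        f (p.2 • (p.1 : EuclideanSpace ℝ (Fin n)))
          ∂((sphereMeasure n).prod (radialMeasure (n - 1) α)) := by
  have hn : 1 ≤ n := NeZero.one_le
  have hfin := isFiniteMeasure_radialMeasure (m := (n : ℝ) - 1) neg_one_lt_natCast_sub_one hα
  have hi : Integrable fun x => f x * Real.exp (-(‖x‖ ^ α) / α) :=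
    (integrable_exp_neg_norm_rpow hα).bdd_mul hf.aestronglyMeasurable (.of_forall hB)
  have hi2 : Integrable (fun p : Metric.sphere (0 : EuclideanSpace ℝ (Fin n)) 1 × ℝ =>
      f (p.2 • (p.1 : EuclideanSpace ℝ (Fin n))))
      ((sphereMeasure n).prod (radialMeasure (n - 1) α)) := by
    refine integrable_of_bdd (Continuous.measurable ?_) fun p => hB _
    fun_prop
  rw [integral_polar, integral_prod _ (integrable_polar hi), integral_prod _ hi2]
  refine integral_congr_ae (.of_forall fun θ => ?_)
  have hθ : ‖(θ : EuclideanSpace ℝ (Fin n))‖ = 1 := by simp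
  simp only
  rw [integral_radialMeasure, integral_volumeIoiPow (n - 1) fun r =>
    f (r • (θ : EuclideanSpace ℝ (Fin n))) *
      Real.exp (-(‖r • (θ : EuclideanSpace ℝ (Fin n))‖ ^ α) / α)]
  refine setIntegral_congr_fun measurableSet_Ioi fun r hr => ?_
  have h2 : ((n : ℝ) - 1) = ((n - 1 : ℕ) : ℝ) := by push_cast [hn]; ring
  simp only [radialWeight, h2, Real.rpow_natCast]
  rw [norm_smul, hθ, mul_one, Real.norm_of_nonneg (le_of_lt hr)]
  ring

theorem continuous_gradient {φ : EuclideanSpace ℝ (Fin n) → ℝ} (hφ : ContDiff ℝ 1 φ) :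
    Continuous (∇ φ) :=
  (InnerProductSpace.toDual ℝ (EuclideanSpace ℝ (Fin n))).symm.continuous.comp
    (hφ.continuous_fderiv (by simp))

theorem gradient_comp_smul {φ : EuclideanSpace ℝ (Fin n) → ℝ} (hφ : Differentiable ℝ φ) (r : ℝ)
    (x : EuclideanSpace ℝ (Fin n)) : ∇ (fun y => φ (r • y)) x = r • ∇ φ (r • x) := by
  refine HasGradientAt.gradient ?_
  rw [hasGradientAt_iff_hasFDerivAt]
  have h := (hφ (r • x)).hasGradientAt.hasFDerivAt.comp x
    ((hasFDerivAt_id x).const_smul r)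
  refine h.congr_fderiv ?_
  generalize ∇ φ (r • x) = G
  ext v
  simp

theorem hasDerivAt_comp_smul {φ : EuclideanSpace ℝ (Fin n) → ℝ} (hφ : Differentiable ℝ φ)
    (θ : EuclideanSpace ℝ (Fin n)) (r : ℝ) :
    HasDerivAt (fun r : ℝ => φ (r • θ)) (inner ℝ θ (∇ φ (r • θ))) r := by
  have h := (hφ (r • θ)).hasGradientAt.hasFDerivAt.comp_hasDerivAt r
    ((hasDerivAt_id r).smul_const θ)
  refine h.congr_deriv ?_
  generalize ∇ φ (r • θ) = G
  simp [real_inner_comm]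

/-- The Poincaré inequality for the exponential power weight. -/
theorem expPower_poincare (hn : 2 ≤ n) (hα : 1 ≤ α) {φ : EuclideanSpace ℝ (Fin n) → ℝ}
    (hφ : ContDiff ℝ 1 φ) {B : ℝ} (hB : ∀ x, |φ x| ≤ B) (hB' : ∀ x, ‖∇ φ x‖ ≤ B) :
    (n - 1) / secondMoment n α *
      ((∫ x : EuclideanSpace ℝ (Fin n), Real.exp (-(‖x‖ ^ α) / α)) *
        (∫ x, φ x ^ 2 * Real.exp (-(‖x‖ ^ α) / α)) -
      (∫ x, φ x * Real.exp (-(‖x‖ ^ α) / α)) ^ 2) ≤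
    (∫ x : EuclideanSpace ℝ (Fin n), Real.exp (-(‖x‖ ^ α) / α)) *
      ∫ x, ‖∇ φ x‖ ^ 2 * Real.exp (-(‖x‖ ^ α) / α) := by
  have : NeZero n := ⟨by omega⟩
  have hα0 : 0 < α := by linarith
  have hB0 : 0 ≤ B := (abs_nonneg _).trans (hB 0)
  have hn1 : (1 : ℝ) ≤ (n : ℝ) - 1 := by
    have : (2 : ℝ) ≤ n := by exact_mod_cast hn
    linarith
  have hd : Differentiable ℝ φ := hφ.differentiable (by simp)
  have hc := hφ.continuous
  have hgc := continuous_gradient hφ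
  obtain ⟨hH, hP⟩ := radialHardy_radialPoincare hn1 hα
  rw [sub_add_cancel] at hH hP
  have hθ : ∀ θ : Metric.sphere (0 : EuclideanSpace ℝ (Fin n)) 1,
    ‖(θ : EuclideanSpace ℝ (Fin n))‖ = 1 := fun θ => by simp
  -- A single bound serves for `φ`, for its radial derivative and for `‖∇ φ‖ ^ 2`, whence `B + B ^
  -- 2`.
  have hBB : B ≤ B + B ^ 2 := by nlinarith
  have key := polar_poincare (sphereMeasure n) sphereMeasure_real_univ_pos hn1 hα hH hP
    (f := fun θ r => φ (r • (θ : EuclideanSpace ℝ (Fin n))))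
    (fr := fun θ r => inner ℝ (θ : EuclideanSpace ℝ (Fin n))
      (∇ φ (r • (θ : EuclideanSpace ℝ (Fin n)))))
    (N := fun θ r => ‖∇ φ (r • (θ : EuclideanSpace ℝ (Fin n)))‖ ^ 2)
    (Continuous.measurable (by fun_prop)) (Continuous.measurable (by fun_prop))
    (Continuous.measurable (by fun_prop)) (B := B + B ^ 2) (a := φ 0)
    (fun θ r => (hB _).trans hBB)
    (fun θ r => by
      have h := abs_real_inner_le_norm (θ : EuclideanSpace ℝ (Fin n))
        (∇ φ (r • (θ : EuclideanSpace ℝ (Fin n))))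
      rw [hθ, one_mul] at h
      exact h.trans ((hB' _).trans hBB))
    (fun θ r => by
      rw [abs_of_nonneg (sq_nonneg _)]
      have := pow_le_pow_left₀ (norm_nonneg _) (hB' (r • (θ : EuclideanSpace ℝ (Fin n)))) 2
      linarith)
    (fun θ r => hasDerivAt_comp_smul hd _ r)
    (fun θ r => by
      have h := convex_univ.norm_image_sub_le_of_norm_fderiv_le (𝕜 := ℝ) (f := φ) (C := B)
        (fun x _ => hd x) (fun x _ => by
          have := hB' x
          rwa [gradient, LinearIsometryEquiv.norm_map] at this)
        (Set.mem_univ 0) (Set.mem_univ (r • (θ : EuclideanSpace ℝ (Fin n))))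
      rw [sub_zero, norm_smul, hθ, mul_one] at h
      exact h.trans (mul_le_mul_of_nonneg_right hBB (abs_nonneg r)))
    -- The sphere inequality for the dilate `y ↦ φ (r • y)`, whose gradient carries a factor `r`;
    -- the square of this factor is the `r ^ 2` in the angular hypothesis.
    (fun r hr => by
      have h := sphere_poincare hn (φ := fun y => φ (r • y))
        (hφ.comp (contDiff_const_smul r))
      simp only [gradient_comp_smul hd, norm_smul, real_inner_smul_right, mul_pow,
        Real.norm_eq_abs, sq_abs, ← mul_sub, integral_const_mul] at h
      exact h)
  rw [← integral_exp_neg_norm_rpow] at key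
  rw [integral_mul_exp_eq_polar hα0 (f := fun x => φ x ^ 2) (hc.pow 2)
      fun x => abs_sq_le_of_abs_le (hB x),
    integral_mul_exp_eq_polar hα0 hc hB,
    integral_mul_exp_eq_polar hα0 (f := fun x => ‖∇ φ x‖ ^ 2) (hgc.norm.pow 2) (B := B ^ 2) fun x => by
      rw [abs_of_nonneg (sq_nonneg _)]
      exact pow_le_pow_left₀ (norm_nonneg _) (hB' x) 2]
  exact key

end ExpPowerPoincare

/-! ### The probability measure and the Poincaré inequality on the form domain -/

section ExpPowerMeasure

variable {n : ℕ} {α : ℝ}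

theorem expPowerWeight_univ [NeZero n] (hα : 0 < α) :
    expPowerWeight n α Set.univ =
      ENNReal.ofReal (∫ x : EuclideanSpace ℝ (Fin n), Real.exp (-(‖x‖ ^ α) / α)) := by
  rw [expPowerWeight, withDensity_apply _ MeasurableSet.univ, Measure.restrict_univ,
    ← ofReal_integral_eq_lintegral_ofReal (integrable_exp_neg_norm_rpow hα)
      (.of_forall fun x => (Real.exp_pos _).le)]

theorem expPowerWeight_univ_ne_zero [NeZero n] (hα : 0 < α) :
    expPowerWeight n α Set.univ ≠ 0 := by
  rw [expPowerWeight_univ hα]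
  simpa using integral_exp_neg_norm_rpow_pos hα

theorem expPowerWeight_univ_ne_top [NeZero n] (hα : 0 < α) :
    expPowerWeight n α Set.univ ≠ ⊤ := by
  rw [expPowerWeight_univ hα]
  exact ENNReal.ofReal_ne_top

theorem isProbabilityMeasure_expPowerMeasure [NeZero n] (hα : 0 < α) :
    IsProbabilityMeasure (expPowerMeasure n α) := by
  refine ⟨?_⟩
  rw [expPowerMeasure, Measure.smul_apply, smul_eq_mul,
    ENNReal.inv_mul_cancel (expPowerWeight_univ_ne_zero hα) (expPowerWeight_univ_ne_top hα)]

theorem integral_expPowerMeasure [NeZero n] (hα : 0 < α) (f : EuclideanSpace ℝ (Fin n) → ℝ) :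
    ∫ x, f x ∂(expPowerMeasure n α) =
      (∫ x : EuclideanSpace ℝ (Fin n), Real.exp (-(‖x‖ ^ α) / α))⁻¹ *
        ∫ x, f x * Real.exp (-(‖x‖ ^ α) / α) := by
  have hm : Measurable fun x : EuclideanSpace ℝ (Fin n) =>
      ENNReal.ofReal (Real.exp (-(‖x‖ ^ α) / α)) := by fun_prop
  rw [expPowerMeasure, integral_smul_measure, expPowerWeight_univ hα, expPowerWeight,
    integral_withDensity_eq_integral_toReal_smul hm (.of_forall fun x => by simp),
    ENNReal.toReal_inv, ENNReal.toReal_ofReal (integral_exp_neg_norm_rpow_pos hα).le, smul_eq_mul]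
  congr 1
  refine integral_congr_ae (.of_forall fun x => ?_)
  simp only [ENNReal.toReal_ofReal (Real.exp_pos _).le, smul_eq_mul, mul_comm]

theorem expPowerMeasure_absolutelyContinuous : expPowerMeasure n α ≪ volume :=
  (Measure.smul_absolutelyContinuous).trans (withDensity_absolutelyContinuous _ _)

theorem continuous_gradient_of_isTest {φ : EuclideanSpace ℝ (Fin n) → ℝ} (hφ : IsTest φ) :
    Continuous (∇ φ) :=
  continuous_gradient (hφ.1.of_le (by simp))

theorem hasCompactSupport_gradient {φ : EuclideanSpace ℝ (Fin n) → ℝ}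
    (hφ : HasCompactSupport φ) : HasCompactSupport (∇ φ) :=
  (hφ.fderiv (𝕜 := ℝ)).comp_left (g := (InnerProductSpace.toDual ℝ
    (EuclideanSpace ℝ (Fin n))).symm) (map_zero _)

theorem IsTest.exists_bound {φ : EuclideanSpace ℝ (Fin n) → ℝ} (hφ : IsTest φ) :
    ∃ B, (∀ x, |φ x| ≤ B) ∧ ∀ x, ‖∇ φ x‖ ≤ B := by
  obtain ⟨B, hB⟩ := hφ.2.exists_bound_of_continuous hφ.1.continuous
  obtain ⟨B', hB'⟩ := (hasCompactSupport_gradient hφ.2).exists_bound_of_continuous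
    (continuous_gradient_of_isTest hφ)
  exact ⟨max B B', fun x => (hB x).trans (le_max_left _ _), fun x =>
    (hB' x).trans (le_max_right _ _)⟩

theorem memLp_of_bdd {F : Type*} [NormedAddCommGroup F] [NeZero n] (hα : 0 < α)
    {f : EuclideanSpace ℝ (Fin n) → F} (hf : AEStronglyMeasurable f volume) {B : ℝ}
    (hB : ∀ x, ‖f x‖ ≤ B) : MemLp f 2 (expPowerMeasure n α) := by
  have := isProbabilityMeasure_expPowerMeasure (n := n) hα
  exact MemLp.of_bound (hf.mono_ac expPowerMeasure_absolutelyContinuous) B (.of_forall hB)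

theorem inner_Lp_eq {F : Type*} [NormedAddCommGroup F] [InnerProductSpace ℝ F] {X : Type*}
    [MeasurableSpace X] {μ : Measure X} {f g : Lp F 2 μ} {u v : X → F} (hf : f =ᵐ[μ] u)
    (hg : g =ᵐ[μ] v) : inner ℝ f g = ∫ x, inner ℝ (u x) (v x) ∂μ := by
  rw [L2.inner_def]
  refine integral_congr_ae ?_
  filter_upwards [hf, hg] with x h1 h2
  rw [h1, h2]

theorem norm_sq_Lp_eq {F : Type*} [NormedAddCommGroup F] [InnerProductSpace ℝ F] {X : Type*}
    [MeasurableSpace X] {μ : Measure X} {f : Lp F 2 μ} {u : X → F} (hf : f =ᵐ[μ] u) :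
    ‖f‖ ^ 2 = ∫ x, ‖u x‖ ^ 2 ∂μ := by
  rw [← real_inner_self_eq_norm_sq, inner_Lp_eq hf hf]
  simp only [real_inner_self_eq_norm_sq]

/-- The constant function `1` in `L²(μ)`. -/
noncomputable def constOne (n : ℕ) (α : ℝ) [IsFiniteMeasure (expPowerMeasure n α)] :
    Lp ℝ 2 (expPowerMeasure n α) := Lp.const 2 (expPowerMeasure n α) (1 : ℝ)

theorem constOne_ae [IsFiniteMeasure (expPowerMeasure n α)] :
    constOne n α =ᵐ[expPowerMeasure n α] fun _ => (1 : ℝ) :=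
  Lp.coeFn_const ..

theorem norm_constOne [IsProbabilityMeasure (expPowerMeasure n α)] : ‖constOne n α‖ = 1 := by
  have h := norm_sq_Lp_eq (constOne_ae (n := n) (α := α))
  simp only [norm_one, one_pow, integral_const, probReal_univ, smul_eq_mul, mul_one] at h
  exact (pow_eq_one_iff_of_nonneg (norm_nonneg _) two_ne_zero).1 h

theorem inner_constOne [IsProbabilityMeasure (expPowerMeasure n α)]
    {f : Lp ℝ 2 (expPowerMeasure n α)} {u : EuclideanSpace ℝ (Fin n) → ℝ}
    (hf : f =ᵐ[expPowerMeasure n α] u) :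
    inner ℝ (constOne n α) f = ∫ x, u x ∂(expPowerMeasure n α) := by
  rw [inner_Lp_eq constOne_ae hf]
  simp

/-- The Poincaré inequality on the domain of the Dirichlet form. -/
theorem poincare_of_mem_closure (hn : 2 ≤ n) (hα : 1 ≤ α)
    [IsProbabilityMeasure (expPowerMeasure n α)]
    {p : Lp ℝ 2 (expPowerMeasure n α) × Lp (EuclideanSpace ℝ (Fin n)) 2 (expPowerMeasure n α)}
    (hp : p ∈ (gradientGraph n α).topologicalClosure) :
    (n - 1) / secondMoment n α * (‖p.1‖ ^ 2 - inner ℝ (constOne n α) p.1 ^ 2) ≤ ‖p.2‖ ^ 2 := by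
  have : NeZero n := ⟨by omega⟩
  have hα0 : 0 < α := by linarith
  have hcl : IsClosed {p : Lp ℝ 2 (expPowerMeasure n α) ×
      Lp (EuclideanSpace ℝ (Fin n)) 2 (expPowerMeasure n α) |
      (n - 1) / secondMoment n α * (‖p.1‖ ^ 2 - inner ℝ (constOne n α) p.1 ^ 2) ≤ ‖p.2‖ ^ 2} :=
    isClosed_le (by fun_prop) (by fun_prop)
  -- Both sides are continuous in the pair, so the inequality for test functions extends to the
  -- closure of the gradient graph.
  refine closure_minimal ?_ hcl hp
  rintro q ⟨φ, hφ, h1, h2⟩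
  obtain ⟨B, hB, hB'⟩ := hφ.exists_bound
  have key := expPower_poincare hn hα (hφ.1.of_le (by simp)) hB hB'
  have hI := integral_exp_neg_norm_rpow_pos (n := n) hα0
  simp only [Set.mem_ofPred_eq]
  rw [norm_sq_Lp_eq h1, norm_sq_Lp_eq h2, inner_constOne h1, integral_expPowerMeasure hα0,
    integral_expPowerMeasure hα0, integral_expPowerMeasure hα0]
  simp only [Real.norm_eq_abs, sq_abs]
  have h4 := mul_le_mul_of_nonneg_left key (sq_nonneg
    (∫ x : EuclideanSpace ℝ (Fin n), Real.exp (-(‖x‖ ^ α) / α))⁻¹)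
  set I := ∫ x : EuclideanSpace ℝ (Fin n), Real.exp (-(‖x‖ ^ α) / α)
  set a := ∫ x, φ x ^ 2 * Real.exp (-(‖x‖ ^ α) / α)
  set b := ∫ x, φ x * Real.exp (-(‖x‖ ^ α) / α)
  set d := ∫ x, ‖∇ φ x‖ ^ 2 * Real.exp (-(‖x‖ ^ α) / α)
  have e1 : I⁻¹ ^ 2 * ((n - 1) / secondMoment n α * (I * a - b ^ 2)) =
      (n - 1) / secondMoment n α * (I⁻¹ * a - (I⁻¹ * b) ^ 2) := by
    field_simp
  have e2 : I⁻¹ ^ 2 * (I * d) = I⁻¹ * d := by field_simp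
  rwa [e1, e2] at h4

end ExpPowerMeasure

/-! ### Integration by parts for the diffusion operator -/

section IntegrationByParts

variable {n : ℕ} {α : ℝ}

theorem hasDerivAt_exp_neg_rpow (hα : 1 ≤ α) (r : ℝ) :
    HasDerivAt (fun r : ℝ => Real.exp (-(r ^ α) / α))
      (-(r ^ (α - 1)) * Real.exp (-(r ^ α) / α)) r := by
  have h := ((Real.hasDerivAt_rpow_const (x := r) (Or.inr hα)).neg.div_const α).exp
  refine h.congr_deriv ?_
  have : α ≠ 0 := by linarith
  simp only [Pi.neg_apply]
  field_simp

theorem rpow_sub_one_mul_exp_le (hα : 1 ≤ α) {r : ℝ} (hr : 0 ≤ r) :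
    r ^ (α - 1) * Real.exp (-(r ^ α) / α) ≤ α := by
  have hα0 : 0 < α := by linarith
  rcases le_total r 1 with h | h
  · have h1 : r ^ (α - 1) ≤ 1 := Real.rpow_le_one hr h (by linarith)
    have h2 : Real.exp (-(r ^ α) / α) ≤ 1 :=
      Real.exp_le_one_iff.2 (div_nonpos_of_nonpos_of_nonneg
        (neg_nonpos.2 (Real.rpow_nonneg hr _)) hα0.le)
    exact (mul_le_one₀ h1 (Real.exp_pos _).le h2).trans hα
  · have h1 : r ^ (α - 1) ≤ r ^ α := Real.rpow_le_rpow_of_exponent_le h (by linarith)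
    have h2 : r ^ α / α ≤ Real.exp (r ^ α / α) := by linarith [Real.add_one_le_exp (r ^ α / α)]
    rw [neg_div, Real.exp_neg, mul_inv_le_iff₀ (Real.exp_pos _)]
    rw [div_le_iff₀ hα0] at h2
    linarith

/-- The radial profile has derivative bounded by `α` on `[0, ∞)`. Lipschitz regularity is what
remains at the origin when `α = 1`, where the density is not differentiable, and it suffices for
integration by parts. -/
theorem lipschitzWith_exp_neg_norm_rpow (hα : 1 ≤ α) :
    LipschitzWith α.toNNReal
      fun x : EuclideanSpace ℝ (Fin n) => Real.exp (-(‖x‖ ^ α) / α) := by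
  refine LipschitzWith.of_dist_le_mul fun x y => ?_
  have h := (convex_Ici (0 : ℝ)).norm_image_sub_le_of_norm_hasDerivWithin_le (C := α)
    (fun r _ => (hasDerivAt_exp_neg_rpow hα r).hasDerivWithinAt) (fun r hr => by
      have hr : 0 ≤ r := hr
      rw [norm_mul, norm_neg, Real.norm_of_nonneg (Real.rpow_nonneg hr _),
        Real.norm_of_nonneg (Real.exp_pos _).le]
      exact rpow_sub_one_mul_exp_le hα hr) (norm_nonneg y) (norm_nonneg x)
  rw [Real.coe_toNNReal _ (by linarith), dist_eq_norm, dist_eq_norm]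
  exact h.trans (mul_le_mul_of_nonneg_left (abs_norm_sub_norm_le x y) (by linarith))

theorem lineDeriv_exp_neg_norm_rpow (hα : 1 ≤ α) {x : EuclideanSpace ℝ (Fin n)} (hx : x ≠ 0)
    (v : EuclideanSpace ℝ (Fin n)) :
    lineDeriv ℝ (fun x : EuclideanSpace ℝ (Fin n) => Real.exp (-(‖x‖ ^ α) / α)) x v =
      -(‖x‖ ^ (α - 2) * inner ℝ x v * Real.exp (-(‖x‖ ^ α) / α)) := by
  have hx0 := norm_pos_iff.2 hx
  have h := (hasDerivAt_exp_neg_rpow hα ‖x‖).comp_hasFDerivAt x (hasFDerivAt_norm_of_ne hx)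
  have h2 : ‖x‖ ^ (α - 1) = ‖x‖ ^ (α - 2) * ‖x‖ := by
    rw [← Real.rpow_add_one hx0.ne']
    ring_nf
  have h3 := (h.hasLineDerivAt v).lineDeriv
  simp only [Function.comp_def] at h3
  rw [h3, h2]
  simp
  field_simp

theorem laplacian_eq_sum_fderiv (ψ : EuclideanSpace ℝ (Fin n) → ℝ)
    (x : EuclideanSpace ℝ (Fin n)) :
    Δ ψ x = ∑ i, fderiv ℝ (fderiv ℝ ψ) x (EuclideanSpace.basisFun (Fin n) ℝ i)
      (EuclideanSpace.basisFun (Fin n) ℝ i) := by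
  rw [InnerProductSpace.laplacian_eq_iteratedFDeriv_orthonormalBasis ψ
    (EuclideanSpace.basisFun (Fin n) ℝ)]
  simp [iteratedFDeriv_two_apply]

theorem IsTest.continuous_laplacian {ψ : EuclideanSpace ℝ (Fin n) → ℝ} (hψ : IsTest ψ) :
    Continuous (Δ ψ) := by
  have h : ContDiff ℝ 1 (fderiv ℝ ψ) := 
    (contDiff_infty.1 hψ.1 2).fderiv_right one_add_one_eq_two.le
  have h2 : Continuous (fderiv ℝ (fderiv ℝ ψ)) := h.continuous_fderiv (by simp)
  have h3 : Δ ψ = fun x => ∑ i, fderiv ℝ (fderiv ℝ ψ) x (EuclideanSpace.basisFun (Fin n) ℝ i)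
      (EuclideanSpace.basisFun (Fin n) ℝ i) := funext (laplacian_eq_sum_fderiv ψ)
  rw [h3]
  fun_prop

theorem IsTest.hasCompactSupport_laplacian {ψ : EuclideanSpace ℝ (Fin n) → ℝ} (hψ : IsTest ψ) :
    HasCompactSupport (Δ ψ) := by
  refine (hψ.2.fderiv (𝕜 := ℝ) |>.fderiv (𝕜 := ℝ)).mono fun x hx => ?_
  rw [Function.mem_support] at hx ⊢
  intro h0
  rw [laplacian_eq_sum_fderiv, h0] at hx
  simp at hx

/-- Integration by parts for the diffusion operator. -/
theorem integral_mul_neg_expPowerL (hα : 1 ≤ α) {φ ψ : EuclideanSpace ℝ (Fin n) → ℝ}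
    (hφ : IsTest φ) (hψ : IsTest ψ) :
    ∫ x, φ x * -expPowerL n α ψ x * Real.exp (-(‖x‖ ^ α) / α) =
      ∫ x, inner ℝ (∇ φ x) (∇ ψ x) * Real.exp (-(‖x‖ ^ α) / α) := by
  set b := EuclideanSpace.basisFun (Fin n) ℝ with hb
  set G : EuclideanSpace ℝ (Fin n) → ℝ := fun x => Real.exp (-(‖x‖ ^ α) / α) with hG
  have hGl : LipschitzWith α.toNNReal G := lipschitzWith_exp_neg_norm_rpow hα
  have hψ1 : ContDiff ℝ 1 (fderiv ℝ ψ) := 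
    (contDiff_infty.1 hψ.1 2).fderiv_right one_add_one_eq_two.le
  have hφ1 : ContDiff ℝ 1 φ := hφ.1.of_le (by simp)
  have hψ1' : ContDiff ℝ 1 ψ := hψ.1.of_le (by simp)
  -- The components of the field `φ ∇ ψ`; each is `C¹` with compact support, and summing the
  -- integrations by parts against the density in every basis direction gives the identity.
  set g : Fin n → EuclideanSpace ℝ (Fin n) → ℝ := fun i x => φ x * fderiv ℝ ψ x (b i) with hg
  have hg1 : ∀ i, ContDiff ℝ 1 (g i) := fun i => hφ1.mul (hψ1.clm_apply contDiff_const)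
  have hgs : ∀ i, HasCompactSupport (g i) := fun i => hφ.2.mul_right
  have hgd : ∀ i x, lineDeriv ℝ (g i) x (-(b i)) =
      -(fderiv ℝ φ x (b i) * fderiv ℝ ψ x (b i) +
        φ x * fderiv ℝ (fderiv ℝ ψ) x (b i) (b i)) := by
    intro i x
    have h1 := (hφ1.differentiable (by simp) x).hasFDerivAt.mul
      ((hψ1.differentiable (by simp) x).hasFDerivAt.clm_apply (hasFDerivAt_const (b i) x))
    have h2 := (h1.hasLineDerivAt (-(b i))).lineDeriv
    refine h2.trans ?_
    simp
    ring
  have hkey : ∀ i, ∫ x, lineDeriv ℝ G x (b i) * g i x =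
      ∫ x, -(fderiv ℝ φ x (b i) * fderiv ℝ ψ x (b i) +
        φ x * fderiv ℝ (fderiv ℝ ψ) x (b i) (b i)) * G x := by
    intro i
    obtain ⟨D, hD⟩ := (hg1 i).lipschitzWith_of_hasCompactSupport (hgs i) (by simp)
    rw [LipschitzWith.integral_lineDeriv_mul_eq hGl hD (hgs i) (b i)]
    simp only [hgd]
  have iL : ∀ i, Integrable fun x => lineDeriv ℝ G x (b i) * g i x := fun i =>
    ((hg1 i).continuous.integrable_of_hasCompactSupport (hgs i)).bdd_mul
      (measurable_lineDeriv hGl.continuous).aestronglyMeasurable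
      (.of_forall fun x => norm_lineDeriv_le_of_lipschitz ℝ hGl)
  have c1 : Continuous fun x => fderiv ℝ φ x := hφ1.continuous_fderiv (by simp)
  have c2 : Continuous fun x => fderiv ℝ ψ x := hψ1'.continuous_fderiv (by simp)
  have c3 : Continuous fun x => fderiv ℝ (fderiv ℝ ψ) x := hψ1.continuous_fderiv (by simp)
  have c4 := hφ1.continuous
  have c5 := hGl.continuous
  have c6 := hψ.continuous_laplacian
  have c7 := continuous_gradient_of_isTest hφ
  have c8 := continuous_gradient_of_isTest hψ
  have iR : ∀ i, Integrable fun x => -(fderiv ℝ φ x (b i) * fderiv ℝ ψ x (b i) +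
      φ x * fderiv ℝ (fderiv ℝ ψ) x (b i) (b i)) * G x := by
    intro i
    refine Continuous.integrable_of_hasCompactSupport (by fun_prop) ?_
    refine HasCompactSupport.mul_right ?_
    refine ((hφ.2.fderiv_apply (𝕜 := ℝ) (b i)).mul_right.add hφ.2.mul_right).comp_left
      (g := fun t : ℝ => -t) neg_zero
  have hsum := Finset.sum_congr (rfl : Finset.univ = Finset.univ) fun i _ => hkey i
  rw [← integral_finsetSum _ fun i _ => iL i, ← integral_finsetSum _ fun i _ => iR i] at hsum
  have hdot : ∀ u v : EuclideanSpace ℝ (Fin n), ∑ i, inner ℝ u (b i) * inner ℝ v (b i) =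
      inner ℝ u v := by
    intro u v
    rw [← b.sum_inner_mul_inner u v]
    exact Finset.sum_congr rfl fun i _ => by rw [real_inner_comm (b i) v]
  -- The derivative of the density is known only off the origin, which is null unless `n = 0`; in
  -- that case both sides vanish.
  have eL : (fun x => ∑ i, lineDeriv ℝ G x (b i) * g i x) =ᵐ[volume]
      fun x => -(φ x * (‖x‖ ^ (α - 2) * inner ℝ x (∇ ψ x)) * G x) := by
    rcases Nat.eq_zero_or_pos n with rfl | hn
    · refine .of_forall fun x => ?_
      have : x = 0 := Subsingleton.elim _ _
      simp [this]
    have : NeZero n := ⟨hn.ne'⟩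
    filter_upwards [compl_mem_ae_iff.2
      (measure_singleton (μ := volume) (0 : EuclideanSpace ℝ (Fin n)))] with x hx
    rw [← hdot, Finset.mul_sum, Finset.mul_sum, Finset.sum_mul, ← Finset.sum_neg_distrib]
    refine Finset.sum_congr rfl fun i _ => ?_
    rw [lineDeriv_exp_neg_norm_rpow hα hx, inner_gradient_left]
    simp only [hg]
    ring
  have eR : ∀ x, ∑ i, -(fderiv ℝ φ x (b i) * fderiv ℝ ψ x (b i) +
      φ x * fderiv ℝ (fderiv ℝ ψ) x (b i) (b i)) * G x =
      -(inner ℝ (∇ φ x) (∇ ψ x) * G x) - φ x * Δ ψ x * G x := by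
    intro x
    rw [← hdot, laplacian_eq_sum_fderiv]
    simp only [inner_gradient_left]
    rw [← Finset.sum_mul, Finset.sum_neg_distrib, Finset.sum_add_distrib, Finset.mul_sum]
    ring
  have iP : Integrable fun x => φ x * (‖x‖ ^ (α - 2) * inner ℝ x (∇ ψ x)) * G x := by
    have := ((integrable_finsetSum Finset.univ fun i _ => iL i).congr eL).neg
    simpa [Pi.neg_def] using this
  have iQ : Integrable fun x => inner ℝ (∇ φ x) (∇ ψ x) * G x := by
    refine Continuous.integrable_of_hasCompactSupport (by fun_prop) ?_
    refine HasCompactSupport.mul_right ((hasCompactSupport_gradient hφ.2).mono fun x hx => ?_)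
    rw [Function.mem_support] at hx ⊢
    intro h0
    rw [h0, inner_zero_left] at hx
    exact hx rfl
  have iS : Integrable fun x => φ x * Δ ψ x * G x :=
    Continuous.integrable_of_hasCompactSupport (by fun_prop) hφ.2.mul_right.mul_right
  have iQ' : Integrable fun x => -(inner ℝ (∇ φ x) (∇ ψ x) * G x) := iQ.neg
  rw [integral_congr_ae eL, integral_congr_ae (.of_forall eR), integral_neg,
    integral_sub iQ' iS, integral_neg] at hsum
  have e3 : ∀ x, φ x * -expPowerL n α ψ x * G x =
      φ x * (‖x‖ ^ (α - 2) * inner ℝ x (∇ ψ x)) * G x - φ x * Δ ψ x * G x := by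
    intro x
    rw [expPowerL]
    ring
  rw [integral_congr_ae (.of_forall e3), integral_sub iP iS]
  linarith

/-- The diffusion operator maps test functions to bounded functions. -/
theorem IsTest.exists_bound_expPowerL (hα : 1 ≤ α) {ψ : EuclideanSpace ℝ (Fin n) → ℝ}
    (hψ : IsTest ψ) : ∃ B, ∀ x, ‖-expPowerL n α ψ x‖ ≤ B := by
  obtain ⟨B₁, hB₁⟩ := hψ.hasCompactSupport_laplacian.exists_bound_of_continuous
    hψ.continuous_laplacian
  -- For `α < 2` the factor `‖x‖ ^ (α - 2)` is singular at the origin, but with the factor `x` the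
  -- drift term is at most `‖x‖ ^ (α - 1) ‖∇ ψ‖`, which is continuous as `α ≥ 1`.
  have hc : Continuous fun x : EuclideanSpace ℝ (Fin n) => ‖x‖ ^ (α - 1) * ‖∇ ψ x‖ :=
    (continuous_norm.rpow_const fun x => Or.inr (by linarith)).mul
      (continuous_gradient_of_isTest hψ).norm
  obtain ⟨B₂, hB₂⟩ := (hasCompactSupport_gradient hψ.2).norm.mul_left.exists_bound_of_continuous hc
  refine ⟨B₁ + B₂, fun x => ?_⟩
  rw [norm_neg, expPowerL]
  refine (norm_sub_le _ _).trans (add_le_add (hB₁ x) (le_trans ?_ (hB₂ x)))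
  rw [Pi.mul_apply, norm_mul, norm_mul, norm_norm, Real.norm_of_nonneg (Real.rpow_nonneg (norm_nonneg x) _),
    Real.norm_of_nonneg (Real.rpow_nonneg (norm_nonneg x) _)]
  by_cases hx : x = 0
  · simp only [hx, inner_zero_left, norm_zero, mul_zero]
    positivity
  have h2 : ‖x‖ ^ (α - 1) = ‖x‖ ^ (α - 2) * ‖x‖ := by
    rw [← Real.rpow_add_one (norm_ne_zero_iff.2 hx)]
    ring_nf
  rw [h2, mul_assoc]
  exact mul_le_mul_of_nonneg_left (norm_inner_le_norm _ _) (Real.rpow_nonneg (norm_nonneg x) _)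

theorem IsTest.measurable_expPowerL {ψ : EuclideanSpace ℝ (Fin n) → ℝ} (hψ : IsTest ψ) :
    Measurable fun x => -expPowerL n α ψ x := by
  have h1 := hψ.continuous_laplacian.measurable
  have h2 := (continuous_gradient_of_isTest hψ).measurable
  unfold expPowerL
  fun_prop

end IntegrationByParts

/-! ### The operator and its Dirichlet form -/

section FormGraph

variable {n : ℕ} {α : ℝ}

theorem IsTest.exists_mem_gradientGraph [NeZero n] (hα : 0 < α)
    {φ : EuclideanSpace ℝ (Fin n) → ℝ} (hφ : IsTest φ) :
    ∃ p ∈ gradientGraph n α, p.1 =ᵐ[expPowerMeasure n α] φ ∧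
      p.2 =ᵐ[expPowerMeasure n α] fun x => ∇ φ x := by
  obtain ⟨B, hB, hB'⟩ := hφ.exists_bound
  have h1 := memLp_of_bdd hα hφ.1.continuous.aestronglyMeasurable hB
  have h2 := memLp_of_bdd hα (continuous_gradient_of_isTest hφ).aestronglyMeasurable hB'
  exact ⟨(h1.toLp φ, h2.toLp (∇ φ)), ⟨φ, hφ, h1.coeFn_toLp, h2.coeFn_toLp⟩, h1.coeFn_toLp,
    h2.coeFn_toLp⟩

theorem IsTest.exists_mem_expPowerGraph [NeZero n] (hα : 1 ≤ α)
    {φ : EuclideanSpace ℝ (Fin n) → ℝ} (hφ : IsTest φ) :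
    ∃ p ∈ expPowerGraph n α, p.1 =ᵐ[expPowerMeasure n α] φ ∧
      p.2 =ᵐ[expPowerMeasure n α] fun x => -expPowerL n α φ x := by
  have hα0 : 0 < α := by linarith
  obtain ⟨B, hB, -⟩ := hφ.exists_bound
  obtain ⟨B', hB'⟩ := hφ.exists_bound_expPowerL hα
  have h1 := memLp_of_bdd hα0 hφ.1.continuous.aestronglyMeasurable hB
  have h2 := memLp_of_bdd hα0 hφ.measurable_expPowerL.aestronglyMeasurable hB'
  exact ⟨(h1.toLp φ, h2.toLp _), ⟨φ, hφ, h1.coeFn_toLp, h2.coeFn_toLp⟩, h1.coeFn_toLp,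
    h2.coeFn_toLp⟩

theorem dense_expPowerMinimal_domain [NeZero n] (hα : 1 ≤ α) :
    Dense ((expPowerMinimal n α).domain : Set (Lp ℝ 2 (expPowerMeasure n α))) := by
  have := isProbabilityMeasure_expPowerMeasure (n := n) (α := α) (by linarith)
  refine (Lp.dense_hasCompactSupport_contDiff (E := EuclideanSpace ℝ (Fin n)) (F := ℝ)
    (μ := expPowerMeasure n α) (p := 2) ENNReal.ofNat_ne_top).mono ?_
  rintro f ⟨g, hfg, hg1, hg2⟩
  obtain ⟨p, hp, h1, -⟩ := IsTest.exists_mem_expPowerGraph hα ⟨hg2, hg1⟩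
  rw [← expPowerMinimal_graph, LinearPMap.mem_graph_iff] at hp
  obtain ⟨y, hy, -⟩ := hp
  have : f = p.1 := Lp.ext (hfg.trans h1.symm)
  rw [this, ← hy]
  exact y.2

/-- Integration by parts between the graph of the minimal operator and the form domain. -/
theorem inner_expPowerGraph_eq [NeZero n] (hα : 1 ≤ α)
    {p q : Lp ℝ 2 (expPowerMeasure n α) × Lp (EuclideanSpace ℝ (Fin n)) 2 (expPowerMeasure n α)}
    (hp : p ∈ (gradientGraph n α).topologicalClosure)
    {ψ : EuclideanSpace ℝ (Fin n) → ℝ} (hψ : IsTest ψ)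
    (hq : q.2 =ᵐ[expPowerMeasure n α] fun x => ∇ ψ x)
    {h : Lp ℝ 2 (expPowerMeasure n α)}
    (hh : h =ᵐ[expPowerMeasure n α] fun x => -expPowerL n α ψ x) :
    inner ℝ p.1 h = inner ℝ p.2 q.2 := by
  have hcl : IsClosed {p : Lp ℝ 2 (expPowerMeasure n α) ×
      Lp (EuclideanSpace ℝ (Fin n)) 2 (expPowerMeasure n α) |
      inner ℝ p.1 h = inner ℝ p.2 q.2} := isClosed_eq (by fun_prop) (by fun_prop)
  refine closure_minimal ?_ hcl hp
  rintro r ⟨φ, hφ, h1, h2⟩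
  simp only [Set.mem_ofPred_eq]
  rw [inner_Lp_eq h1 hh, inner_Lp_eq h2 hq, integral_expPowerMeasure (by linarith),
    integral_expPowerMeasure (by linarith), ← integral_mul_neg_expPowerL hα hφ hψ]
  simp [mul_comm]

/-- Against a test function, the adjoint moves the minimal operator onto it and integration by parts
brings back the gradients. Both sides are continuous in `q`, so the identity passes to the closure.
-/
theorem expPowerOperator_form [NeZero n] (hα : 1 ≤ α) (f : (expPowerOperator n α).domain) :
    ∃ F, ((f : Lp ℝ 2 (expPowerMeasure n α)), F) ∈ (gradientGraph n α).topologicalClosure ∧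
      ∀ q ∈ (gradientGraph n α).topologicalClosure,
        inner ℝ (expPowerOperator n α f) q.1 = (inner ℝ F q.2 : ℝ) := by
  have hdense := dense_expPowerMinimal_domain (n := n) hα
  obtain ⟨hf1, hf2⟩ := (f.2 : (f : Lp ℝ 2 (expPowerMeasure n α)) ∈
    dirichletDomain n α ⊓ (expPowerMinimal n α).adjoint.domain)
  obtain ⟨p, hp, hpf⟩ := hf1
  have hpf : p.1 = f := hpf
  refine ⟨p.2, by rw [← hpf]; exact hp, fun q hq => ?_⟩
  have hcl : IsClosed {q : Lp ℝ 2 (expPowerMeasure n α) ×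
      Lp (EuclideanSpace ℝ (Fin n)) 2 (expPowerMeasure n α) |
      inner ℝ (expPowerOperator n α f) q.1 = (inner ℝ p.2 q.2 : ℝ)} :=
    isClosed_eq (by fun_prop) (by fun_prop)
  refine closure_minimal ?_ hcl hq
  rintro r ⟨ψ, hψ, h1, h2⟩
  simp only [Set.mem_ofPred_eq]
  obtain ⟨s, hs, k1, k2⟩ := hψ.exists_mem_expPowerGraph (n := n) hα
  rw [← expPowerMinimal_graph, LinearPMap.mem_graph_iff] at hs
  obtain ⟨y, hy1, hy2⟩ := hs
  have hA : expPowerOperator n α f = (expPowerMinimal n α).adjoint ⟨f, hf2⟩ :=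
    LinearPMap.domRestrict_apply rfl
  have hr : r.1 = y := by
    rw [hy1]
    exact Lp.ext (h1.trans k1.symm)
  have hadj := LinearPMap.adjoint_isFormalAdjoint hdense ⟨f, hf2⟩ y
  rw [hA, hr, hadj, hy2, ← hpf]
  exact inner_expPowerGraph_eq hα hp hψ h2 k2

/-- Testing the weak equation on smooth compactly supported functions shows that `p.1` lies in the
domain of the adjoint with image `h`; it lies in the form domain by hypothesis. -/
theorem expPowerOperator_of_form [NeZero n] (hα : 1 ≤ α)
    {p : Lp ℝ 2 (expPowerMeasure n α) × Lp (EuclideanSpace ℝ (Fin n)) 2 (expPowerMeasure n α)}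
    (hp : p ∈ (gradientGraph n α).topologicalClosure) (h : Lp ℝ 2 (expPowerMeasure n α))
    (hph : ∀ q ∈ (gradientGraph n α).topologicalClosure, inner ℝ h q.1 = (inner ℝ p.2 q.2 : ℝ)) :
    ∃ f : (expPowerOperator n α).domain,
      (f : Lp ℝ 2 (expPowerMeasure n α)) = p.1 ∧ expPowerOperator n α f = h := by
  have hdense := dense_expPowerMinimal_domain (n := n) hα
  have hadj : ∀ x : (expPowerMinimal n α).domain,
      (inner ℝ h (x : Lp ℝ 2 (expPowerMeasure n α)) : ℝ) =
        inner ℝ p.1 (expPowerMinimal n α x) := by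
    intro x
    have hx := LinearPMap.mem_graph (expPowerMinimal n α) x
    rw [expPowerMinimal_graph] at hx
    obtain ⟨ψ, hψ, h1, h2⟩ := hx
    obtain ⟨q, hq, k1, k2⟩ := hψ.exists_mem_gradientGraph (n := n) (α := α) (by linarith)
    have hqx : q.1 = x := Lp.ext (k1.trans h1.symm)
    rw [← hqx, hph q (Submodule.le_topologicalClosure _ hq)]
    exact (inner_expPowerGraph_eq hα hp hψ k2 h2).symm
  have hdom : p.1 ∈ (expPowerMinimal n α).adjoint.domain :=
    LinearPMap.mem_adjoint_domain_of_exists _ ⟨h, hadj⟩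
  refine ⟨⟨p.1, ⟨p, hp, rfl⟩, hdom⟩, rfl, ?_⟩
  have hA : expPowerOperator n α ⟨p.1, ⟨p, hp, rfl⟩, hdom⟩ =
      (expPowerMinimal n α).adjoint ⟨p.1, hdom⟩ := LinearPMap.domRestrict_apply rfl
  rw [hA]
  exact LinearPMap.adjoint_apply_eq hdense _ hadj

end FormGraph

/-! ### Affine functions in the form domain -/

section AffineFunctions

variable {n : ℕ} {α : ℝ}

theorem integral_norm_sq_expPowerMeasure [NeZero n] (hα : 0 < α) :
    ∫ x, ‖x‖ ^ 2 ∂(expPowerMeasure n α) = secondMoment n α := by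
  have h := integral_radial_prod (n := n) α (fun _ => 1) (fun r => r ^ 2)
  simp only [one_mul, integral_const, smul_eq_mul, mul_one] at h
  rw [integral_expPowerMeasure hα, h, integral_exp_neg_norm_rpow,
    integral_sq_mul_radialWeight neg_one_lt_natCast_sub_one hα, sub_add_cancel]
  have h1 := sphereMeasure_real_univ_pos (n := n)
  have h2 := integral_radialWeight_pos (m := (n : ℝ) - 1) neg_one_lt_natCast_sub_one hα
  field_simp

theorem integrable_norm_sq_expPowerMeasure [NeZero n] (hα : 0 < α) :
    Integrable (fun x => ‖x‖ ^ 2) (expPowerMeasure n α) := by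
  by_contra h
  have h1 := integral_norm_sq_expPowerMeasure (n := n) hα
  rw [integral_undef h] at h1
  exact (secondMoment_pos (n := n) (by exact_mod_cast NeZero.pos n) hα).ne h1

theorem integral_expPowerMeasure_neg [NeZero n] (hα : 0 < α)
    (f : EuclideanSpace ℝ (Fin n) → ℝ) :
    ∫ x, f (-x) ∂(expPowerMeasure n α) = ∫ x, f x ∂(expPowerMeasure n α) := by
  rw [integral_expPowerMeasure hα, integral_expPowerMeasure hα,
    ← integral_neg_eq_self fun x => f x * Real.exp (-(‖x‖ ^ α) / α)]
  simp only [norm_neg]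

theorem gradient_mul_affine {χ : EuclideanSpace ℝ (Fin n) → ℝ} (hχ : Differentiable ℝ χ) (a : ℝ)
    (v x : EuclideanSpace ℝ (Fin n)) :
    ∇ (fun x => χ x * (a + inner ℝ v x)) x = χ x • v + (a + inner ℝ v x) • ∇ χ x := by
  refine HasGradientAt.gradient ?_
  rw [hasGradientAt_iff_hasFDerivAt]
  have h1 : HasFDerivAt (fun x => a + inner ℝ v x) (innerSL ℝ v) x :=
    (innerSL ℝ v).hasFDerivAt.const_add a
  refine ((hχ x).hasGradientAt.hasFDerivAt.mul h1).congr_fderiv ?_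
  generalize ∇ χ x = G
  ext w
  simp

/-- Smooth cutoff functions with vanishing gradients. -/
theorem exists_cutoff (n : ℕ) : ∃ χ : ℕ → EuclideanSpace ℝ (Fin n) → ℝ, ∃ M : ℝ, 0 ≤ M ∧
    (∀ k, IsTest (χ k)) ∧ (∀ k x, |χ k x| ≤ 1) ∧ (∀ k x, (1 + ‖x‖) * ‖∇ (χ k) x‖ ≤ M) ∧
    ∀ x, ∀ᶠ k in atTop, χ k x = 1 ∧ ∇ (χ k) x = 0 := by
  let f : ContDiffBump (0 : EuclideanSpace ℝ (Fin n)) := ⟨1, 2, one_pos, one_lt_two⟩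
  have hf : IsTest (f : EuclideanSpace ℝ (Fin n) → ℝ) := ⟨f.contDiff, f.hasCompactSupport⟩
  obtain ⟨B, -, hB⟩ := hf.exists_bound
  have hB0 : 0 ≤ B := (norm_nonneg _).trans (hB 0)
  have hg0 : ∀ x, 2 < ‖x‖ → ∇ f x = 0 := by
    intro x hx
    have h1 : fderiv ℝ f x = 0 := by
      by_contra hne
      have h2 : x ∈ tsupport f := support_fderiv_subset ℝ hne
      rw [f.tsupport_eq, mem_closedBall_zero_iff] at h2
      exact hx.not_ge h2
    rw [gradient, h1, map_zero]
  -- Dilates of one bump. The gradient of the `k`-th dilate is at most `B / (k + 1)` and vanishes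
  -- beyond `‖x‖ = 2 (k + 1)`, where `1 + ‖x‖ ≤ 3 (k + 1)` has been valid up to then; hence the
  -- constant `3 B`.
  refine ⟨fun k x => f (((k : ℝ) + 1)⁻¹ • x), 3 * B, by positivity, fun k => ?_, fun k x => ?_,
    fun k x => ?_, fun x => ?_⟩
  · have hk : ((k : ℝ) + 1)⁻¹ ≠ 0 := by positivity
    exact ⟨hf.1.comp (contDiff_const_smul _), hf.2.comp_homeomorph (Homeomorph.smulOfNeZero _ hk)⟩
  · rw [abs_of_nonneg f.nonneg]
    exact f.le_one
  · rw [gradient_comp_smul hf.differentiable, norm_smul, norm_inv,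
      Real.norm_of_nonneg (by positivity)]
    have hk : (0 : ℝ) < (k : ℝ) + 1 := by positivity
    rcases lt_or_ge 2 ‖((k : ℝ) + 1)⁻¹ • x‖ with h | h
    · rw [hg0 _ h]
      simp
      positivity
    · rw [norm_smul, norm_inv, Real.norm_of_nonneg hk.le, inv_mul_le_iff₀ hk] at h
      have h1 : (1 + ‖x‖) * ((k : ℝ) + 1)⁻¹ ≤ 3 := by
        rw [mul_inv_le_iff₀ hk]
        have : (0 : ℝ) ≤ k := by positivity
        linarith
      rw [← mul_assoc]
      exact mul_le_mul h1 (hB _) (norm_nonneg _) (by norm_num)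
  · obtain ⟨K, hK⟩ := exists_nat_gt ‖x‖
    filter_upwards [eventually_ge_atTop K] with k hk
    have hk' : (K : ℝ) ≤ k := by exact_mod_cast hk
    have hk0 : (0 : ℝ) < (k : ℝ) + 1 := by positivity
    have hx : ((k : ℝ) + 1)⁻¹ • x ∈ Metric.ball (0 : EuclideanSpace ℝ (Fin n)) f.rIn := by
      rw [mem_ball_zero_iff, norm_smul, norm_inv, Real.norm_of_nonneg hk0.le,
        inv_mul_lt_iff₀ hk0]
      change ‖x‖ < (k + 1) * 1
      linarith
    refine ⟨f.one_of_mem_closedBall (Metric.ball_subset_closedBall hx), ?_⟩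
    rw [gradient_comp_smul hf.differentiable]
    have h1 : (f : EuclideanSpace ℝ (Fin n) → ℝ) =ᶠ[𝓝 (((k : ℝ) + 1)⁻¹ • x)] fun _ => 1 :=
      f.eventuallyEq_one_of_mem_ball hx
    rw [h1.gradient_eq, gradient_fun_const, smul_zero]

theorem tendsto_Lp_of_tendsto_integral {F : Type*} [NormedAddCommGroup F] [InnerProductSpace ℝ F]
    {X : Type*} [MeasurableSpace X] {μ : Measure X} {f : ℕ → Lp F 2 μ} {g : Lp F 2 μ}
    {u : ℕ → X → F} {v : X → F} (hf : ∀ k, f k =ᵐ[μ] u k) (hg : g =ᵐ[μ] v)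
    (h : Tendsto (fun k => ∫ x, ‖u k x - v x‖ ^ 2 ∂μ) atTop (𝓝 0)) :
    Tendsto f atTop (𝓝 g) := by
  rw [tendsto_iff_norm_sub_tendsto_zero]
  have h1 : ∀ k, ‖f k - g‖ = √(∫ x, ‖u k x - v x‖ ^ 2 ∂μ) := by
    intro k
    have h2 : (f k - g : Lp F 2 μ) =ᵐ[μ] fun x => u k x - v x := by
      filter_upwards [Lp.coeFn_sub (f k) g, hf k, hg] with x a b c
      rw [a, Pi.sub_apply, b, c]
    rw [← norm_sq_Lp_eq h2, Real.sqrt_sq (norm_nonneg _)]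
  simp only [h1]
  simpa using h.sqrt

/-- Affine functions belong to the domain of the Dirichlet form. -/
theorem exists_affine_mem_closure [NeZero n] (hα : 0 < α) (a : ℝ)
    (v : EuclideanSpace ℝ (Fin n)) :
    ∃ p ∈ (gradientGraph n α).topologicalClosure,
      p.1 =ᵐ[expPowerMeasure n α] (fun x => a + inner ℝ v x) ∧
      p.2 =ᵐ[expPowerMeasure n α] fun _ => v := by
  have hprob := isProbabilityMeasure_expPowerMeasure (n := n) hα
  obtain ⟨χ, M, hM, hχ, hχ1, hχM, hχlim⟩ := exists_cutoff n
  set u : EuclideanSpace ℝ (Fin n) → ℝ := fun x => a + inner ℝ v x with hu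
  have huc : ContDiff ℝ ∞ u := contDiff_const.add (contDiff_const.inner ℝ contDiff_id)
  set C := |a| + ‖v‖ with hC
  have hC0 : 0 ≤ C := by positivity
  have huC : ∀ x, |u x| ≤ C * (1 + ‖x‖) := by
    intro x
    have h1 := abs_real_inner_le_norm v x
    have h2 := abs_add_le a (inner ℝ v x)
    simp only [hu, hC]
    nlinarith [abs_nonneg a, norm_nonneg v, norm_nonneg x,
      mul_nonneg (abs_nonneg a) (norm_nonneg x)]
  have hdom : Integrable (fun x => (2 * C * (1 + ‖x‖)) ^ 2) (expPowerMeasure n α) := by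
    have h1 : Integrable (fun x : EuclideanSpace ℝ (Fin n) =>
        8 * C ^ 2 * (1 + ‖x‖ ^ 2)) (expPowerMeasure n α) :=
      ((integrable_const 1).add (integrable_norm_sq_expPowerMeasure hα)).const_mul _
    refine h1.mono' (Continuous.aestronglyMeasurable (by fun_prop)) (.of_forall fun x => ?_)
    rw [Real.norm_of_nonneg (sq_nonneg _)]
    nlinarith [mul_nonneg (sq_nonneg C) (sq_nonneg (1 - ‖x‖))]
  have hu2 : MemLp u 2 (expPowerMeasure n α) := by
    rw [memLp_two_iff_integrable_sq huc.continuous.aestronglyMeasurable]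
    refine hdom.mono' (huc.continuous.pow 2).aestronglyMeasurable (.of_forall fun x => ?_)
    rw [norm_pow]
    refine pow_le_pow_left₀ (norm_nonneg _) ((huC x).trans ?_) 2
    nlinarith [mul_nonneg hC0 (add_nonneg zero_le_one (norm_nonneg x))]
  have hv2 : MemLp (fun _ : EuclideanSpace ℝ (Fin n) => v) 2 (expPowerMeasure n α) :=
    memLp_const v
  refine ⟨(hu2.toLp u, hv2.toLp _), ?_, hu2.coeFn_toLp, hv2.coeFn_toLp⟩
  have hφ : ∀ k, IsTest fun x => χ k x * u x := fun k =>
    ⟨(hχ k).1.mul huc, (hχ k).2.mul_right⟩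
  choose p hp hp1 hp2 using fun k => (hφ k).exists_mem_gradientGraph (n := n) hα
  have hgr : ∀ k x, ∇ (fun x => χ k x * u x) x = χ k x • v + u x • ∇ (χ k) x := fun k x =>
    gradient_mul_affine (hχ k).differentiable a v x
  refine mem_closure_of_tendsto (f := p) (b := atTop) ?_ (.of_forall hp)
  rw [Prod.tendsto_iff]
  constructor
  · refine tendsto_Lp_of_tendsto_integral hp1 hu2.coeFn_toLp ?_
    have h0 : (0 : ℝ) = ∫ _ : EuclideanSpace ℝ (Fin n), 0 ∂(expPowerMeasure n α) := by simp
    rw [h0]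
    refine tendsto_integral_of_dominated_convergence _ (fun k => ?_) hdom (fun k => ?_)
      (.of_forall fun x => ?_)
    · have := (hφ k).1.continuous
      have := huc.continuous
      exact Continuous.aestronglyMeasurable (by fun_prop)
    · refine .of_forall fun x => ?_
      rw [Real.norm_of_nonneg (sq_nonneg _)]
      refine pow_le_pow_left₀ (norm_nonneg _) ?_ 2
      have h1 : χ k x * u x - u x = (χ k x - 1) * u x := by ring
      have h2 : |χ k x - 1| ≤ 2 := (abs_sub _ _).trans (by rw [abs_one]; linarith [hχ1 k x])
      rw [h1, norm_mul, mul_assoc]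
      exact mul_le_mul h2 (huC x) (abs_nonneg _) (by norm_num)
    · refine tendsto_const_nhds.congr' ?_
      filter_upwards [hχlim x] with k hk
      rw [hk.1]
      simp
  · refine tendsto_Lp_of_tendsto_integral hp2 hv2.coeFn_toLp ?_
    have h0 : (0 : ℝ) = ∫ _ : EuclideanSpace ℝ (Fin n), 0 ∂(expPowerMeasure n α) := by simp
    rw [h0]
    -- The linear growth of `u` is offset by the decay of the cutoff gradient, `(1 + ‖x‖) ‖∇ χ‖ ≤
    -- M`, so a constant dominates.
    refine tendsto_integral_of_dominated_convergence (fun _ => (2 * ‖v‖ + C * M) ^ 2)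
      (fun k => ?_) (integrable_const _) (fun k => ?_) (.of_forall fun x => ?_)
    · have := continuous_gradient_of_isTest (hφ k)
      exact Continuous.aestronglyMeasurable (by fun_prop)
    · refine .of_forall fun x => ?_
      rw [Real.norm_of_nonneg (sq_nonneg _)]
      refine pow_le_pow_left₀ (norm_nonneg _) ?_ 2
      have h1 : χ k x • v + u x • ∇ (χ k) x - v = (χ k x - 1) • v + u x • ∇ (χ k) x := by
        rw [sub_smul, one_smul]
        abel
      have h2 : |χ k x - 1| ≤ 2 := (abs_sub _ _).trans (by rw [abs_one]; linarith [hχ1 k x])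
      rw [hgr, h1]
      refine (norm_add_le _ _).trans (add_le_add ?_ ?_)
      · rw [norm_smul]
        exact mul_le_mul_of_nonneg_right h2 (norm_nonneg _)
      · rw [norm_smul]
        calc ‖u x‖ * ‖∇ (χ k) x‖ ≤ C * (1 + ‖x‖) * ‖∇ (χ k) x‖ :=
              mul_le_mul_of_nonneg_right (huC x) (norm_nonneg _)
          _ = C * ((1 + ‖x‖) * ‖∇ (χ k) x‖) := by ring
          _ ≤ C * M := mul_le_mul_of_nonneg_left (hχM k x) hC0
    · refine tendsto_const_nhds.congr' ?_
      filter_upwards [hχlim x] with k hk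
      rw [hgr, hk.1, hk.2]
      simp

end AffineFunctions

/-! ### The spectral gap and its asymptotics -/

section Main

variable {n : ℕ} {α : ℝ}

/-- Some coordinate function has a large second moment. -/
theorem exists_coordinate_secondMoment [NeZero n] (hα : 0 < α) :
    ∃ v : EuclideanSpace ℝ (Fin n), ‖v‖ = 1 ∧
      secondMoment n α / n ≤ ∫ x, inner ℝ v x ^ 2 ∂(expPowerMeasure n α) := by
  set b := EuclideanSpace.basisFun (Fin n) ℝ with hb
  have hi : ∀ i, Integrable (fun x => inner ℝ (b i) x ^ 2) (expPowerMeasure n α) := by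
    intro i
    refine (integrable_norm_sq_expPowerMeasure hα).mono'
      (Continuous.aestronglyMeasurable (by fun_prop)) (.of_forall fun x => ?_)
    rw [Real.norm_of_nonneg (sq_nonneg _)]
    exact inner_sq_le_norm_sq (b.norm_eq_one i)
  have hsum : ∑ i, ∫ x, inner ℝ (b i) x ^ 2 ∂(expPowerMeasure n α) = secondMoment n α := by
    rw [← integral_finsetSum _ fun i _ => hi i, ← integral_norm_sq_expPowerMeasure hα]
    refine integral_congr_ae (.of_forall fun x => ?_)
    simp only
    rw [← real_inner_self_eq_norm_sq, ← b.sum_inner_mul_inner x x]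
    exact Finset.sum_congr rfl fun i _ => by rw [real_inner_comm x (b i), sq]
  have hn : (n : ℝ) ≠ 0 := by exact_mod_cast NeZero.ne n
  -- Choosing the largest of the coordinate moments avoids any use of rotation invariance.
  obtain ⟨i, -, h⟩ := Finset.exists_le_of_sum_le (s := Finset.univ)
    (f := fun _ : Fin n => secondMoment n α / n)
    (g := fun i => ∫ x, inner ℝ (b i) x ^ 2 ∂(expPowerMeasure n α))
    ⟨0, Finset.mem_univ _⟩ (by
      rw [hsum, Finset.sum_const, Finset.card_univ, Fintype.card_fin, nsmul_eq_mul]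
      field_simp
      exact le_rfl)
  exact ⟨b i, b.norm_eq_one i, h⟩

/-- The spectral gap of the exponential power distributions, in terms of the second moment. -/
theorem spectralGap_expPowerOperator (hn : 2 ≤ n) (hα : 1 ≤ α) :
    IsGreatest (gapSet (expPowerOperator n α)) (spectralGap (expPowerOperator n α)) ∧
      (n - 1) / secondMoment n α ≤ spectralGap (expPowerOperator n α) ∧
      spectralGap (expPowerOperator n α) ≤ n / secondMoment n α := by
  have : NeZero n := ⟨by omega⟩
  have hα0 : 0 < α := by linarith
  have hprob := isProbabilityMeasure_expPowerMeasure (n := n) hα0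
  have hn2 : (2 : ℝ) ≤ n := by exact_mod_cast hn
  have hn0 : (0 : ℝ) < n := by linarith
  have hsm : 0 < secondMoment n α := secondMoment_pos hn0 hα0
  obtain ⟨v, hv, hvm⟩ := exists_coordinate_secondMoment (n := n) hα0
  -- The constant `1` supplies the unit vector of zero energy, and the linear function `⟨v, x⟩`,
  -- centered because the measure is symmetric, is the trial function for the upper bound.
  obtain ⟨e, he, he1, he2⟩ := exists_affine_mem_closure (n := n) hα0 1 0
  obtain ⟨p, hp, hp1, hp2⟩ := exists_affine_mem_closure (n := n) hα0 0 v
  have hee : e = (constOne n α, 0) := by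
    refine Prod.ext (Lp.ext ?_) (Lp.ext (he2.trans (Lp.coeFn_zero _ _ _).symm))
    refine he1.trans (EventuallyEq.trans ?_ constOne_ae.symm)
    exact .of_forall fun x => by simp
  have hpe : inner ℝ (constOne n α) p.1 = (0 : ℝ) := by
    rw [inner_constOne hp1]
    have h := integral_expPowerMeasure_neg (n := n) hα0 fun x => 0 + inner ℝ v x
    simp only [zero_add, inner_neg_right, integral_neg] at h ⊢
    linarith
  have hp1n : secondMoment n α / n ≤ ‖p.1‖ ^ 2 := by
    rw [norm_sq_Lp_eq hp1]
    simpa using hvm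
  have hp2n : ‖p.2‖ ^ 2 = 1 := by
    rw [norm_sq_Lp_eq hp2]
    simp [hv]
  have hp0 : p.1 ≠ 0 := by
    intro h0
    rw [h0, norm_zero] at hp1n
    have : 0 < secondMoment n α / n := by positivity
    linarith
  have hc : 0 < ((n : ℝ) - 1) / secondMoment n α := div_pos (by linarith) hsm
  obtain ⟨h1, h2, h3⟩ := spectralGap_of_form (A := expPowerOperator n α)
    (V := (gradientGraph n α).topologicalClosure) (gradientGraph n α).isClosed_topologicalClosure
    (e := constOne n α) norm_constOne (hee ▸ he) (expPowerOperator_form hα)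
    (fun q hq h hqh => expPowerOperator_of_form hα hq h hqh) hc
    (fun q hq hqe => by
      have := poincare_of_mem_closure hn hα hq
      rwa [hqe, zero_pow two_ne_zero, sub_zero] at this) hp hpe hp0
  refine ⟨h1, h2, ?_⟩
  have h4 := h3 p hp hpe
  rw [hp2n] at h4
  have h5 := (mul_le_mul_of_nonneg_left hp1n (hc.le.trans h2)).trans h4
  rw [mul_div_assoc', div_le_one hn0] at h5
  rwa [le_div_iff₀ hsm]

theorem div_secondMoment (a n α : ℝ) :
    a / secondMoment n α =
      a * Real.Gamma (n / α) / (α ^ (2 / α) * Real.Gamma ((n + 2) / α)) := by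
  rw [secondMoment, div_div_eq_mul_div]

theorem le_div_secondMoment (hn : 2 ≤ n) (hα : 1 ≤ α) :
    ((n : ℝ) - 1) / (n + 1) * (n : ℝ) ^ (1 - 2 / α) ≤ (n - 1) / secondMoment n α := by
  have hn2 : (2 : ℝ) ≤ n := by exact_mod_cast hn
  have hn0 : (0 : ℝ) < n := by linarith
  have h := secondMoment_le hn0 hα
  have h1 : (n : ℝ) ^ (1 - 2 / α) * (n : ℝ) ^ (2 / α - 1) = 1 := by
    rw [← Real.rpow_add hn0]
    simp
  rw [le_div_iff₀ (secondMoment_pos hn0 (by linarith))]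
  have h2 : 0 ≤ ((n : ℝ) - 1) / (n + 1) * (n : ℝ) ^ (1 - 2 / α) :=
    mul_nonneg (div_nonneg (by linarith) (by linarith)) (Real.rpow_nonneg hn0.le _)
  refine (mul_le_mul_of_nonneg_left h h2).trans_eq ?_
  calc _ = ((n : ℝ) - 1) / (n + 1) * (n + 1) *
        ((n : ℝ) ^ (1 - 2 / α) * (n : ℝ) ^ (2 / α - 1)) := by ring
    _ = _ := by
      rw [h1, mul_one, div_mul_cancel₀]
      linarith

theorem div_secondMoment_le (hn : 2 ≤ n) (hα : 1 ≤ α) :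
    (n : ℝ) / secondMoment n α ≤ ((n : ℝ) + 2) / n * (n : ℝ) ^ (1 - 2 / α) := by
  have hn2 : (2 : ℝ) ≤ n := by exact_mod_cast hn
  have hn0 : (0 : ℝ) < n := by linarith
  have h := le_secondMoment hn0 hα
  have h1 : (n : ℝ) ^ (1 - 2 / α) * (n : ℝ) ^ (2 / α) = n := by
    rw [← Real.rpow_add hn0]
    simp
  rw [div_le_iff₀ (secondMoment_pos hn0 (by linarith))]
  have h2 : 0 ≤ ((n : ℝ) + 2) / n * (n : ℝ) ^ (1 - 2 / α) := by positivity
  refine Eq.trans_le ?_ (mul_le_mul_of_nonneg_left h h2)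
  calc (n : ℝ) = ((n : ℝ) ^ (1 - 2 / α) * (n : ℝ) ^ (2 / α)) := h1.symm
    _ = _ := by field_simp

end Main
theorem mainTheorem5 (α : ℝ) (hα : 1 ≤ α) :
    (∀ n : ℕ, 2 ≤ n →
      IsGreatest (gapSet (expPowerOperator n α)) (spectralGap (expPowerOperator n α)) ∧
      ((n : ℝ) - 1) * Real.Gamma (n / α) / (α ^ (2 / α) * Real.Gamma ((n + 2) / α))
        ≤ spectralGap (expPowerOperator n α) ∧
      spectralGap (expPowerOperator n α)
        ≤ (n : ℝ) * Real.Gamma (n / α) / (α ^ (2 / α) * Real.Gamma ((n + 2) / α)) ∧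
      ((n : ℝ) - 1) / (n + 1) * (n : ℝ) ^ (1 - 2 / α) ≤ spectralGap (expPowerOperator n α) ∧
      spectralGap (expPowerOperator n α) ≤ ((n : ℝ) + 2) / n * (n : ℝ) ^ (1 - 2 / α)) ∧
    Asymptotics.IsEquivalent atTop (fun n : ℕ => spectralGap (expPowerOperator n α))
      (fun n : ℕ => (n : ℝ) ^ (1 - 2 / α)) := by
  have main : ∀ n : ℕ, 2 ≤ n →
      ((n : ℝ) - 1) / (n + 1) * (n : ℝ) ^ (1 - 2 / α) ≤ spectralGap (expPowerOperator n α) ∧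
      spectralGap (expPowerOperator n α) ≤ ((n : ℝ) + 2) / n * (n : ℝ) ^ (1 - 2 / α) := by
    intro n hn
    obtain ⟨-, h2, h3⟩ := spectralGap_expPowerOperator hn hα
    exact ⟨(le_div_secondMoment hn hα).trans h2, h3.trans (div_secondMoment_le hn hα)⟩
  refine ⟨fun n hn => ?_, ?_⟩
  · obtain ⟨h1, h2, h3⟩ := spectralGap_expPowerOperator hn hα
    rw [div_secondMoment] at h2 h3
    exact ⟨h1, h2, h3, main n hn⟩
  · have hpos : ∀ᶠ n : ℕ in atTop, (0 : ℝ) < (n : ℝ) ^ (1 - 2 / α) := by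
      filter_upwards [eventually_gt_atTop 0] with n hn
      exact Real.rpow_pos_of_pos (by exact_mod_cast hn) _
    rw [Asymptotics.isEquivalent_iff_tendsto_one (hpos.mono fun n hn => hn.ne')]
    have hinv : Tendsto (fun n : ℕ => 2 / (n : ℝ)) atTop (𝓝 0) :=
      tendsto_const_div_atTop_nhds_zero_nat 2
    have hinv1 : Tendsto (fun n : ℕ => 2 * (1 / ((n : ℝ) + 1))) atTop (𝓝 (2 * 0)) :=
      tendsto_one_div_add_atTop_nhds_zero_nat.const_mul 2
    -- The squeezing ratios are `(n - 1) / (n + 1) = 1 - 2 / (n + 1)` and `(n + 2) / n = 1 + 2 / n`.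
    have hlow : Tendsto (fun n : ℕ => 1 - 2 * (1 / ((n : ℝ) + 1))) atTop (𝓝 1) := by
      simpa using hinv1.const_sub 1
    have hup : Tendsto (fun n : ℕ => 1 + 2 / (n : ℝ)) atTop (𝓝 1) := by
      simpa using hinv.const_add 1
    refine tendsto_of_tendsto_of_tendsto_of_le_of_le' hlow hup ?_ ?_
    · filter_upwards [hpos, eventually_ge_atTop 2] with n h0 hn
      rw [Pi.div_apply, le_div_iff₀ h0]
      refine Eq.trans_le ?_ (main n hn).1
      have : (n : ℝ) + 1 ≠ 0 := by positivity
      field_simp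
      ring
    · filter_upwards [hpos, eventually_ge_atTop 2] with n h0 hn
      rw [Pi.div_apply, div_le_iff₀ h0]
      refine (main n hn).2.trans_eq ?_
      have : (n : ℝ) ≠ 0 := by positivity
      field_simp
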